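/- **Setting.** Let $V=V_s\oplus V'$ be an orthogonal direct sum of finite dimensional real Euclidean spaces with scalar product $(\cdot,\cdot)$, and let $R\subset V_s$ be a reduced irreducible crystallographic root system spanning $V_s$, whose Weyl group preserves the scalar product (for instance the roots of a simple complex Lie algebra with the Killing form), with coroots $\alpha^\vee=2\alpha/(\alpha,\alpha)$, root lattice $Q$ and coroot lattice $Q^\vee$. Fix a base of $R$ with highest root $\theta$, and a lattice (discrete subgroup) $Y\subset V$ with $Q^\vee\subseteq Y$ and $(Y,Q)\subseteq\mathbb Z$. Let $\mathfrak h=\mathbb C\otimes V$, $\widehat V=V\oplus\mathbb Rc\oplus\mathbb Rd$, $\widehat{\mathfrak h}=\mathfrak h\oplus\mathbb Cc\oplus\mathbb Cd$, with the symmetric bilinear form extending $(\cdot,\cdot)$ such that $(c,d)=1$ and $(c,c)=(d,d)=(c,v)=(d,v)=0$ for $v\in\mathfrak h$. The coefficient of $d$ is called the level; $\widehat V^+\subset\widehat V$ is the set of elements of level $\xi>0$, and $\partial_u$ is the derivative in direction $u$. For $(a,a)\ne0$ put $a^\vee=2a/(a,a)$ and $s_a(x)=x-(x,a^\vee)a$;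 for $u\in V$ put $t_u(v+\eta c+\xi d)=v+\xi u+(\eta-\tfrac{\xi}{2}(u,u)-(v,u))c+\xi d$. Let $W$ be generated by the $s_\alpha$ ($\alpha\in R$), and $\widehat W^Y=W\ltimes Y$ by $W$ and the $t_y$ ($y\in Y$). Let $\widehat R=R+\mathbb Zc$, with simple roots $\widehat F$ = the simple roots of $R$ and $-\theta+c$, positive roots $\widehat R^+$ (the elements of $\widehat R$ which are nonnegative integral combinations of $\widehat F$), and $\Omega=\{\omega\in\widehat W^Y:\omega(\widehat R^+)\subseteq\widehat R^+\}$. Let $k:\widehat R\to\mathbb C$ be $\widehat W^Y$-invariant, let $\widehat{\mathfrak h}_{reg}$ be the set of $\widehat\lambda\in\widehat{\mathfrak h}$ with $(a^\vee,\widehat\lambda)\ne0,k_a$ for all $a\in\widehat R$, and let $\widehat{\mathfrak h}^+_{reg}$ be the set of its elements whose level has positive real part. Let $M$ be a finite dimensional complex $\widehat W^Y$-module, with representation map $\pi_M$, which is unitarizable (it has an invariant Hermitian inner product). **Theorem.** There is exactly one family of functions $J_w:\widehat{\mathfrak h}_{reg}\to\mathbb C[\widehat W^Y]$ ($w\in\widehat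 W^Y$) such that $J_{uw}(\widehat\lambda)=J_u(w\widehat\lambda)J_w(\widehat\lambda)$ for all $u,w\in\widehat W^Y$, $$J_{s_a}(\widehat\lambda)=\frac{(a^\vee,\widehat\lambda)s_a+k_a}{(a^\vee,\widehat\lambda)-k_a}\quad(a\in\widehat F),\qquad J_\omega(\widehat\lambda)=\omega\quad(\omega\in\Omega).$$ Let $J_w$ act on $M$ through $\pi_M$. For all $\widehat v\in\widehat V^+$ and $\widehat\lambda\in\widehat{\mathfrak h}^+_{reg}$ the series $$E_M(\widehat v;\widehat\lambda)=\sum_{y\in Y}e^{(t_y\widehat\lambda,\widehat v)}J_{t_y}(\widehat\lambda),\qquad E_M^+(\widehat v;\widehat\lambda)=\sum_{w\in\widehat W^Y}e^{(w\widehat\lambda,\widehat v)}J_w(\widehat\lambda)$$ converge (unconditionally) in $\mathrm{End}_{\mathbb C}(M)$, and: 1. $E_M^+(\widehat v;\widehat\lambda)=\sum_{w\in W}E_M(\widehat v;w\widehat\lambda)J_w(\widehat\lambda)$. 2. Let $\widehat\lambda\in\widehat{\mathfrak h}_{reg}$ have level $\kappa$ with $\mathrm{Re}\,\kappa>0$.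 (a) $f=E_M(\cdot;\widehat\lambda)$ is real analytic on $\widehat V^+$ and $\partial_cf=\kappa f$. (b) $f=E_M^+(\cdot;\widehat\lambda)$ is real analytic on $\widehat V^+$, and there $\partial_cf=\kappa f$ and $(\Delta+2\partial_c\partial_d)f=(\widehat\lambda,\widehat\lambda)f$, with $\Delta$ the Laplacian of $V$. Moreover $f$ is $\widehat Q(\widehat W^Y)$-invariant: it is fixed by all products of the operators $\widehat Q(s_a)$ ($a\in\widehat F$) and $\widehat Q(\omega)$ ($\omega\in\Omega$), where $$(\widehat Q(s_a)f)(\widehat v)=\pi_M(s_a)f(s_a\widehat v)-k_a\int_0^{(a,\widehat v)}f(\widehat v-ta^\vee)\,dt,\qquad(\widehat Q(\omega)f)(\widehat v)=\pi_M(\omega)f(\omega^{-1}\widehat v).$$ 3. Let $\widehat v\in\widehat V$ have level $\xi>0$. Each of the functions $\Psi=E_M(\widehat v;\cdot)$ and $\Psi=E_M^+(\widehat v;\cdot)$ is holomorphic on $\widehat{\mathfrak h}^+_{reg}$ with $\partial_c\Psi=\xi\Psi$, and solves the affine difference Knizhnik–Zamolodchikov equations $\Psi(t_y\widehat\lambda)J_{t_y}(\widehat\lambda)=\Psi(\widehat\lambda)$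 for all $y\in Y$. The function $\Psi=E_M^+(\widehat v;\cdot)$ satisfies moreover $\Psi(w\widehat\lambda)J_w(\widehat\lambda)=\Psi(\widehat\lambda)$ for all $w\in W$. -/

import Mathlib

open scoped Matrix

noncomputable section

namespace AffineBethe

/-! ### The spaces `V̂ = V ⊕ ℝc ⊕ ℝd` and `ĥ = h ⊕ ℂc ⊕ ℂd`

In orthonormal coordinates `V = V_s ⊕ V'` is `ι ⊕ ι' → ℝ`, with `V_s = ι → ℝ`, `V' = ι' → ℝ` and
the dot product as scalar product; `h` is its complexification `ι ⊕ ι' → ℂ`. -/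

/-- `Hat 𝕜 κ` consists of the triples `(v, η, ξ)`, standing for `v + η c + ξ d`. -/
abbrev Hat (𝕜 κ : Type*) := (κ → 𝕜) × 𝕜 × 𝕜

section Space

variable {𝕜 κ : Type*} [Field 𝕜] [Fintype κ]

/-- The symmetric bilinear form with `(c, d) = 1`, `(c, c) = (d, d) = (c, v) = (d, v) = 0`. -/
def form (x y : Hat 𝕜 κ) : 𝕜 := x.1 ⬝ᵥ y.1 + x.2.1 * y.2.2 + x.2.2 * y.2.1

/-- The basis element `c`. -/
def cVec : Hat 𝕜 κ := (0, 1, 0)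

/-- The basis element `d`. -/
def dVec : Hat 𝕜 κ := (0, 0, 1)

/-- The covector `a^∨ = 2a / (a, a)`. -/
def vee (a : Hat 𝕜 κ) : Hat 𝕜 κ := (2 / form a a) • a

theorem form_add_left (x y z : Hat 𝕜 κ) : form (x + y) z = form x z + form y z := by
  simp only [form, Prod.fst_add, Prod.snd_add, add_dotProduct]; ring

theorem form_smul_left (r : 𝕜) (x y : Hat 𝕜 κ) : form (r • x) y = r * form x y := by
  simp only [form, Prod.smul_fst, Prod.smul_snd, smul_dotProduct, smul_eq_mul]; ring

theorem form_comm (x y : Hat 𝕜 κ) : form x y = form y x := by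
  simp only [form, dotProduct_comm x.1]; ring

/-- The reflection `s_a(x) = x - (x, a^∨) a` as a linear map. -/
def reflMap (a : Hat 𝕜 κ) : Hat 𝕜 κ →ₗ[𝕜] Hat 𝕜 κ where
  toFun x := x - form x (vee a) • a
  map_add' x y := by rw [form_add_left, add_smul]; abel
  map_smul' r x := by rw [form_smul_left, mul_smul, RingHom.id_apply, smul_sub]

theorem reflMap_involutive (a : Hat 𝕜 κ) : Function.Involutive (reflMap a) := by
  intro x
  change x - form x (vee a) • a - form (x - form x (vee a) • a) (vee a) • a = x
  have h : form (x - form x (vee a) • a) (vee a) =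
      form x (vee a) - form x (vee a) * form a (vee a) := by
    rw [sub_eq_add_neg, ← neg_smul, form_add_left, form_smul_left]; ring
  have h2 : form a (vee a) • a = (2 : 𝕜) • a ∨ vee a = 0 := by
    by_cases h0 : form a a = 0
    · right; simp [vee, h0]
    · left; rw [form_comm, vee, form_smul_left, div_mul_cancel₀ _ h0]
  rcases h2 with h2 | h2
  · rw [h, sub_smul, mul_smul, h2, two_smul, smul_add]; abel
  · rw [h2]; simp [form]

/-- The reflection `s_a` as a linear automorphism (meaningful if `(a, a) ≠ 0`). -/
def refl (a : Hat 𝕜 κ) : Hat 𝕜 κ ≃ₗ[𝕜] Hat 𝕜 κ :=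
  LinearEquiv.ofInvolutive (reflMap a) (reflMap_involutive a)

/-- The map `t_u(v + ηc + ξd) = v + ξu + (η - (ξ/2)(u,u) - (v,u)) c + ξd`. -/
def translMap (u : κ → 𝕜) : Hat 𝕜 κ →ₗ[𝕜] Hat 𝕜 κ where
  toFun x := (x.1 + x.2.2 • u, x.2.1 - x.2.2 / 2 * (u ⬝ᵥ u) - x.1 ⬝ᵥ u, x.2.2)
  map_add' x y := by
    refine Prod.ext ?_ (Prod.ext ?_ rfl)
    · simp only [Prod.fst_add, Prod.snd_add, add_smul]; abel
    · simp only [Prod.fst_add, Prod.snd_add, add_dotProduct]; ring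
  map_smul' r x := by
    refine Prod.ext ?_ (Prod.ext ?_ rfl)
    · simp only [Prod.smul_fst, Prod.smul_snd, smul_eq_mul, mul_smul, smul_add, RingHom.id_apply]
    · simp only [Prod.smul_fst, Prod.smul_snd, smul_eq_mul, smul_dotProduct, RingHom.id_apply]
      ring

end Space

section Complexify

variable {κ : Type*} [Fintype κ]

theorem translMap_neg (u : κ → ℝ) (x : Hat ℝ κ) : translMap (-u) (translMap u x) = x := by
  refine Prod.ext ?_ (Prod.ext ?_ rfl)
  · simp [translMap]
  · simp [translMap]; ring

/-- The map `t_u` as a linear automorphism of `V̂`, with inverse `t_{-u}`. -/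
def transl (u : κ → ℝ) : Hat ℝ κ ≃ₗ[ℝ] Hat ℝ κ :=
  LinearEquiv.ofLinearMap (translMap u) (translMap (-u))
    (LinearMap.ext fun x => by simpa using translMap_neg (-u) x)
    (LinearMap.ext fun x => translMap_neg u x)

/-- The inclusion of `V̂` in `ĥ`. -/
def toC (x : Hat ℝ κ) : Hat ℂ κ := (fun j => (x.1 j : ℂ), (x.2.1 : ℂ), (x.2.2 : ℂ))

/-- The real part of an element of `ĥ = V̂ ⊕ iV̂`. -/
def rePart (z : Hat ℂ κ) : Hat ℝ κ := (fun j => (z.1 j).re, z.2.1.re, z.2.2.re)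

/-- The imaginary part of an element of `ĥ = V̂ ⊕ iV̂`. -/
def imPart (z : Hat ℂ κ) : Hat ℝ κ := (fun j => (z.1 j).im, z.2.1.im, z.2.2.im)

/-- The complex linear extension to `ĥ` of a linear automorphism `g` of `V̂`. -/
def cAct (g : Hat ℝ κ ≃ₗ[ℝ] Hat ℝ κ) (z : Hat ℂ κ) : Hat ℂ κ :=
  toC (g (rePart z)) + Complex.I • toC (g (imPart z))

/-- `V̂⁺ = V ⊕ ℝc ⊕ ℝ_{>0}d`. -/
def VPlus (κ : Type*) : Set (Hat ℝ κ) := {x | 0 < x.2.2}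

end Complexify

/-! ### Root systems and extended affine Weyl groups -/

/-- A reduced irreducible crystallographic root system in `V_s` for which the scalar product
is Weyl group invariant, with a base, its highest root `θ`, and a lattice `Y` in `V = V_s ⊕ V'`
such that `Q^∨ ⊆ Y` and `(Y, Q) ⊆ ℤ`. -/
structure Datum (I ι ι' : Type*) [Finite I] [Fintype ι] [Fintype ι'] where
  /-- the root system, in `V_s` -/
  P : RootPairing I ℝ (ι → ℝ) (Module.Dual ℝ (ι → ℝ))
  isRootSystem : P.IsRootSystem
  isCrystallographic : P.IsCrystallographic
  isReduced : P.IsReduced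
  isIrreducible : P.IsIrreducible
  /-- the coroot of `α`, as a functional on `V_s`, is the scalar product with `2α / (α, α)` -/
  pairing_coroot : ∀ (i : I) (x : ι → ℝ),
    P.toLinearMap x (P.coroot i) = 2 * (P.root i ⬝ᵥ x) / (P.root i ⬝ᵥ P.root i)
  /-- the simple roots -/
  base : P.Base
  /-- the highest root -/
  θ : I
  highest : ∀ i : I, P.root θ - P.root i ∈ AddSubmonoid.closure (P.root '' base.support)
  /-- the lattice -/
  Y : AddSubgroup (ι ⊕ ι' → ℝ)
  discrete : DiscreteTopology Y
  coroot_mem : ∀ i : I,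
    (2 / (P.root i ⬝ᵥ P.root i)) • (Sum.elim (P.root i) 0 : ι ⊕ ι' → ℝ) ∈ Y
  integral : ∀ y ∈ Y, ∀ i : I, ∃ z : ℤ, y ⬝ᵥ (Sum.elim (P.root i) 0 : ι ⊕ ι' → ℝ) = z

namespace Datum

variable {I ι ι' : Type*} [Finite I] [Fintype ι] [Fintype ι'] (D : Datum I ι ι')

/-- The root with index `i` as a vector of `V`. -/
def rootV (i : I) : ι ⊕ ι' → ℝ := Sum.elim (D.P.root i) 0

/-- The affine root `α + mc`. -/
def affRoot (i : I) (m : ℤ) : Hat ℝ (ι ⊕ ι') := (D.rootV i, (m : ℝ), 0)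

/-- The affine root system `R̂ = R ⊕ ℤc`. -/
def affRoots : Set (Hat ℝ (ι ⊕ ι')) := {a | ∃ (i : I) (m : ℤ), a = D.affRoot i m}

/-- The simple affine roots: the simple roots together with `a₀ = -θ + c`. -/
def simpleRoots : Set (Hat ℝ (ι ⊕ ι')) :=
  {a | (∃ i ∈ D.base.support, a = D.affRoot i 0) ∨ a = (-D.rootV D.θ, 1, 0)}

/-- The positive affine roots: nonnegative integral combinations of simple affine roots. -/
def posRoots : Set (Hat ℝ (ι ⊕ ι')) :=
  {a | a ∈ D.affRoots ∧ a ∈ AddSubmonoid.closure D.simpleRoots}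

theorem simpleRoots_subset : D.simpleRoots ⊆ D.affRoots := by
  rintro a (⟨i, -, rfl⟩ | rfl)
  · exact ⟨i, 0, rfl⟩
  · refine ⟨D.P.reflectionPerm D.θ D.θ, 1, ?_⟩
    simp only [affRoot, rootV, Int.cast_one, D.P.root_reflectionPerm, D.P.reflection_apply_self]
    congr 1
    funext j
    cases j <;> simp

/-- The extended affine Weyl group `Ŵ^Y = W ⋉ Y`, as the group of automorphisms of `V̂`
generated by the `s_α` (`α ∈ R`) and the `t_y` (`y ∈ Y`). -/
def WHat : Subgroup (Hat ℝ (ι ⊕ ι') ≃ₗ[ℝ] Hat ℝ (ι ⊕ ι')) :=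
  Subgroup.closure ((Set.range fun i : I => refl (D.affRoot i 0)) ∪
    (Set.range fun y : D.Y => transl (y : ι ⊕ ι' → ℝ)))

/-- The element `t_y` of `Ŵ^Y`. -/
def t (y : D.Y) : D.WHat := ⟨transl y, Subgroup.subset_closure (Or.inr ⟨y, rfl⟩)⟩

theorem root_dot_pos (i : I) : D.rootV i ⬝ᵥ D.rootV i ≠ 0 := by
  intro h
  have h0 : D.rootV i = 0 := dotProduct_self_eq_zero.mp h
  refine D.P.ne_zero i ?_
  funext j
  simpa [rootV] using congrFun h0 (Sum.inl j)

theorem rootV_dot (i : I) : D.rootV i ⬝ᵥ D.rootV i = D.P.root i ⬝ᵥ D.P.root i := by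
  simp [rootV, dotProduct]

/-- `s_{α+mc} = s_α t_{mα^∨}`. -/
theorem refl_affRoot (i : I) (m : ℤ) : refl (D.affRoot i m) =
    refl (D.affRoot i 0) *
      transl ((m : ℝ) • (2 / (D.rootV i ⬝ᵥ D.rootV i)) • D.rootV i) := by
  have h := D.root_dot_pos i
  refine LinearEquiv.ext fun x => ?_
  obtain ⟨v, η, ξ⟩ := x
  change reflMap (D.affRoot i m) _ = reflMap (D.affRoot i 0) (translMap _ _)
  set α := D.rootV i with hα
  refine Prod.ext ?_ (Prod.ext ?_ ?_)
  · simp only [reflMap, translMap, vee, form, affRoot, LinearMap.coe_mk, AddHom.coe_mk,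
      ← hα, Prod.fst_sub, Prod.smul_fst, Prod.smul_snd, dotProduct_smul, add_dotProduct,
      smul_dotProduct, smul_eq_mul]
    generalize α ⬝ᵥ α = q at h
    generalize v ⬝ᵥ α = p
    funext j
    simp only [Pi.sub_apply, Pi.smul_apply, Pi.add_apply, smul_eq_mul]
    field_simp
    simp only [mul_zero, zero_mul, add_zero]
    field_simp
    ring
  · simp only [reflMap, translMap, vee, form, affRoot, LinearMap.coe_mk, AddHom.coe_mk,
      ← hα, Prod.snd_sub, Prod.fst_sub, Prod.smul_fst, Prod.smul_snd, dotProduct_smul,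
      add_dotProduct, smul_dotProduct, smul_eq_mul, Int.cast_zero]
    generalize α ⬝ᵥ α = q at h
    generalize v ⬝ᵥ α = p
    simp only [mul_zero, zero_mul, add_zero]
    field_simp
    ring
  · simp [reflMap, translMap, affRoot]

theorem refl_mem {a : Hat ℝ (ι ⊕ ι')} (ha : a ∈ D.affRoots) : refl a ∈ D.WHat := by
  obtain ⟨i, m, rfl⟩ := ha
  rw [refl_affRoot]
  refine mul_mem (Subgroup.subset_closure (Or.inl ⟨i, rfl⟩))
    (Subgroup.subset_closure (Or.inr ⟨⟨_, ?_⟩, rfl⟩))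
  rw [rootV_dot, Int.cast_smul_eq_zsmul]
  exact zsmul_mem (D.coroot_mem i) m

/-- The reflection `s_a` in an affine root `a`, as an element of `Ŵ^Y`. -/
def s (a : D.affRoots) : D.WHat := ⟨refl a, D.refl_mem a.2⟩

/-- The finite Weyl group `W`, generated by the `s_α` with `α ∈ R`, as a subgroup of `Ŵ^Y`. -/
def W : Subgroup D.WHat :=
  Subgroup.closure (Set.range fun i : I => D.s ⟨D.affRoot i 0, i, 0, rfl⟩)

/-- The set `Ω` of all `ω ∈ Ŵ^Y` with `ω(R̂⁺) ⊆ R̂⁺`. -/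
def Ω : Set D.WHat := {ω | ∀ a ∈ D.posRoots, ω.1 a ∈ D.posRoots}

/-- `k` restricts to a `Ŵ^Y`-invariant function on `R̂` (its other values are never used). -/
def IsMultiplicity (k : Hat ℝ (ι ⊕ ι') → ℂ) : Prop :=
  ∀ w : D.WHat, ∀ a ∈ D.affRoots, k (w.1 a) = k a

/-- `ĥ_reg`. -/
def reg (k : Hat ℝ (ι ⊕ ι') → ℂ) : Set (Hat ℂ (ι ⊕ ι')) :=
  {z | ∀ a ∈ D.affRoots, form (toC (vee a)) z ≠ 0 ∧ form (toC (vee a)) z ≠ k a}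

/-- `ĥ⁺_reg`: the elements of `ĥ_reg` whose level has positive real part. -/
def regPlus (k : Hat ℝ (ι ⊕ ι') → ℂ) : Set (Hat ℂ (ι ⊕ ι')) :=
  {z | z ∈ D.reg k ∧ 0 < z.2.2.re}

/-! ### The cocycle -/

/-- `J_w : ĥ_reg → ℂ[Ŵ^Y]` is the family (its values off `ĥ_reg` are never used) with
`J_{uw}(z) = J_u(wz) J_w(z)`, with
`J_{s_a}(z) = ((a^∨, z) s_a + k_a) / ((a^∨, z) - k_a)` for simple affine roots `a`, and with
`J_ω(z) = ω` for `ω ∈ Ω`. -/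
structure IsCocycle (k : Hat ℝ (ι ⊕ ι') → ℂ)
    (J : D.WHat → Hat ℂ (ι ⊕ ι') → MonoidAlgebra ℂ D.WHat) : Prop where
  mul : ∀ u w : D.WHat, ∀ z ∈ D.reg k, J (u * w) z = J u (cAct w.1 z) * J w z
  simple : ∀ a (ha : a ∈ D.simpleRoots), ∀ z ∈ D.reg k,
    J (D.s ⟨a, D.simpleRoots_subset ha⟩) z =
      (form (toC (vee a)) z - k a)⁻¹ •
        (form (toC (vee a)) z •
          MonoidAlgebra.of ℂ D.WHat (D.s ⟨a, D.simpleRoots_subset ha⟩) + k a • 1)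
  omega : ∀ ω ∈ D.Ω, ∀ z ∈ D.reg k, J ω z = MonoidAlgebra.of ℂ D.WHat ω

/-! ### Representations -/

section Rep

variable {M : Type*} [NormedAddCommGroup M] [NormedSpace ℂ M] [FiniteDimensional ℂ M]

/-- The representation carries an invariant Hermitian inner product. -/
def IsUnitarizable {G M : Type*} [Group G] [AddCommGroup M] [Module ℂ M]
    (ρ : Representation ℂ G M) : Prop :=
  ∃ B : InnerProductSpace.Core ℂ M, ∀ (g : G) (x y : M), B.inner (ρ g x) (ρ g y) = B.inner x y

variable {D}

/-- The action of the group algebra; all endomorphisms of the finite dimensional space `M` are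
continuous, and `End(M)` is `M →L[ℂ] M`. -/
def act (ρ : Representation ℂ D.WHat M) (x : MonoidAlgebra ℂ D.WHat) : M →L[ℂ] M :=
  LinearMap.toContinuousLinearMap (ρ.asAlgebraHom x)

/-- The representation operator `π_M(w)`. -/
def repL (ρ : Representation ℂ D.WHat M) (w : D.WHat) : M →L[ℂ] M :=
  LinearMap.toContinuousLinearMap (ρ w)

/-! ### The series -/

/-- The term `e^{(wz, v)} J_w(z)`, as an endomorphism of `M`. -/
def term (ρ : Representation ℂ D.WHat M)
    (J : D.WHat → Hat ℂ (ι ⊕ ι') → MonoidAlgebra ℂ D.WHat)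
    (v : Hat ℝ (ι ⊕ ι')) (z : Hat ℂ (ι ⊕ ι')) (w : D.WHat) : M →L[ℂ] M :=
  Complex.exp (form (cAct w.1 z) (toC v)) • act ρ (J w z)

/-- `E_M(v; z) = ∑_{y ∈ Y} e^{(t_y z, v)} J_{t_y}(z)`. -/
def E (ρ : Representation ℂ D.WHat M)
    (J : D.WHat → Hat ℂ (ι ⊕ ι') → MonoidAlgebra ℂ D.WHat)
    (v : Hat ℝ (ι ⊕ ι')) (z : Hat ℂ (ι ⊕ ι')) : M →L[ℂ] M :=
  ∑' y : D.Y, term ρ J v z (D.t y)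

/-- `E_M⁺(v; z) = ∑_{w ∈ Ŵ^Y} e^{(wz, v)} J_w(z)`. -/
def EPlus (ρ : Representation ℂ D.WHat M)
    (J : D.WHat → Hat ℂ (ι ⊕ ι') → MonoidAlgebra ℂ D.WHat)
    (v : Hat ℝ (ι ⊕ ι')) (z : Hat ℂ (ι ⊕ ι')) : M →L[ℂ] M :=
  ∑' w : D.WHat, term ρ J v z w

/-! ### Functions of `v`: differential and integral-reflection operators -/

/-- `f` is an `End(M)`-valued real analytic function on `V̂⁺` with `∂_c f = κ f`. -/
def MemLevel {κ : Type*} [Fintype κ] (γ : ℂ) (f : Hat ℝ κ → M →L[ℂ] M) : Prop :=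
  AnalyticOnNhd ℝ f (VPlus κ) ∧ ∀ v ∈ VPlus κ, lineDeriv ℝ f v cVec = γ • f v

open Classical in
/-- The operator `Δ̂ = Δ + 2 ∂_c ∂_d`, with `Δ` the Laplacian of `V`. -/
def laplaceHat {κ : Type*} [Fintype κ] (f : Hat ℝ κ → M →L[ℂ] M) (v : Hat ℝ κ) : M →L[ℂ] M :=
  (∑ j : κ, lineDeriv ℝ (fun x => lineDeriv ℝ f x (Pi.single j 1, 0, 0)) v
      (Pi.single j 1, 0, 0)) +
    (2 : ℂ) • lineDeriv ℝ (fun x => lineDeriv ℝ f x dVec) v cVec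

/-- The space `Ŝ_{End(M)}(γ, Γ)` of real analytic functions on `V̂⁺` with values in `End(M)`
such that `∂_c f = γ f` and `Δ̂ f = Γ f`. -/
def MemS {κ : Type*} [Fintype κ] (γ Γ : ℂ) (f : Hat ℝ κ → M →L[ℂ] M) : Prop :=
  MemLevel γ f ∧ ∀ v ∈ VPlus κ, laplaceHat f v = Γ • f v

/-- `Q̂(s_a) = s_a ⊗ π(s_a) - k_a I(a)` with `(I(a)f)(v) = ∫_0^{(a,v)} f(v - t a^∨) dt`, where
`w ∈ Ŵ^Y` acts on `End(M)` by composition with `π_M(w)` on the left. -/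
def qRefl (ρ : Representation ℂ D.WHat M) (k : Hat ℝ (ι ⊕ ι') → ℂ) (a : D.affRoots) :
    Function.End (Hat ℝ (ι ⊕ ι') → M →L[ℂ] M) :=
  fun f v => repL ρ (D.s a) ∘L f ((D.s a).1⁻¹ v) -
    k a.1 • ∫ τ in (0 : ℝ)..form a.1 v, f (v - τ • vee a.1)

/-- `Q̂(ω) = ω ⊗ π(ω)`. -/
def qOmega (ρ : Representation ℂ D.WHat M) (ω : D.WHat) :
    Function.End (Hat ℝ (ι ⊕ ι') → M →L[ℂ] M) :=
  fun f v => repL ρ ω ∘L f (ω.1⁻¹ v)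

/-- The set of operators `Q̂(Ŵ^Y)`. As `Ŵ^Y` is generated by the simple reflections (which are
involutions) and the group `Ω`, it consists of all products of operators `Q̂(s_a)`, with `a` a
simple affine root, and `Q̂(ω)`, with `ω ∈ Ω`. -/
def qOperators (ρ : Representation ℂ D.WHat M) (k : Hat ℝ (ι ⊕ ι') → ℂ) :
    Submonoid (Function.End (Hat ℝ (ι ⊕ ι') → M →L[ℂ] M)) :=
  Submonoid.closure
    ({q | ∃ a : D.affRoots, a.1 ∈ D.simpleRoots ∧ q = qRefl ρ k a} ∪
      {q | ∃ ω ∈ D.Ω, q = qOmega ρ ω})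

/-- `f`, as a function on `V̂⁺`, is fixed by `Q̂(Ŵ^Y)`. -/
def IsQInvariant (ρ : Representation ℂ D.WHat M) (k : Hat ℝ (ι ⊕ ι') → ℂ)
    (f : Hat ℝ (ι ⊕ ι') → M →L[ℂ] M) : Prop :=
  ∀ q ∈ qOperators ρ k, Set.EqOn (q f) f (VPlus (ι ⊕ ι'))

/-! ### Functions of `z`: affine difference Knizhnik-Zamolodchikov equations -/

/-- `adKZ_ξ`: the holomorphic `End(M)`-valued functions `Ψ` on `ĥ⁺_reg` such that
`∂_c Ψ = ξ Ψ` and `Ψ(t_y z) J_{t_y}(z) = Ψ(z)` for all `y ∈ Y`. -/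
def MemAdKZ (ρ : Representation ℂ D.WHat M) (k : Hat ℝ (ι ⊕ ι') → ℂ)
    (J : D.WHat → Hat ℂ (ι ⊕ ι') → MonoidAlgebra ℂ D.WHat) (ξ : ℂ)
    (Ψ : Hat ℂ (ι ⊕ ι') → M →L[ℂ] M) : Prop :=
  (∀ z ∈ D.regPlus k, DifferentiableAt ℂ Ψ z) ∧
  (∀ z ∈ D.regPlus k, lineDeriv ℂ Ψ z cVec = ξ • Ψ z) ∧
  ∀ y : D.Y, ∀ z ∈ D.regPlus k, Ψ (cAct (D.t y).1 z) ∘L act ρ (J (D.t y) z) = Ψ z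

/-- Invariance under the action of `W`: `Ψ(wz) J_w(z) = Ψ(z)` for all `w ∈ W`. -/
def IsWInvariant (ρ : Representation ℂ D.WHat M) (k : Hat ℝ (ι ⊕ ι') → ℂ)
    (J : D.WHat → Hat ℂ (ι ⊕ ι') → MonoidAlgebra ℂ D.WHat)
    (Ψ : Hat ℂ (ι ⊕ ι') → M →L[ℂ] M) : Prop :=
  ∀ w ∈ D.W, ∀ z ∈ D.regPlus k, Ψ (cAct w.1 z) ∘L act ρ (J w z) = Ψ z

end Rep

end Datum

end AffineBethe

end

open scoped Matrix

noncomputable section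

namespace AffineBethe

/-! ### Reflections and the bilinear form. -/

section FormAlgebra

variable {𝕜 κ : Type*} [Field 𝕜] [Fintype κ]

/-! The cocycle is constructed without a presentation of Ŵ^Y by braid relations. Every element is a
word in simple affine reflections and elements of Ω (`exists_word`), and the cocycle rule forces the
value `wordJ` along a word. This gives uniqueness, and existence amounts to independence of the
chosen word (`wordJ_eq`).

For this independence let each letter act on the span of vectors e_w, which stand for the orbit
points wz: s_a e_w = (1 - k_a/x) e_{s_a w} - (k_a/x) e_w with x = (a^∨, wz), and ω e_w = e_{ωw}. If
these operators define a representation of Ŵ^Y, then the value of the cocycle at wz for a letter l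
sends e_w to e_{lw} (`asAlgebraHom_letterJ`). Thus `wordJ` along L sends e_1 to the basis vector of
the element that L represents, and a finite dimensional argument shows that this image determines it
(`orbitMap_injOn`).

That the operators do form a representation is `wordOp_eq`. Consider the functionals A for which A
composed with the operator of a word depends only on the group element. The functional e_w ↦ det w
is one of them. The property survives multiplication by a linear function of the orbit point
(`comp_mulOp_mem`): moving the function through a word produces one correction for each reflection
letter, and the corrections are the values of an odd function at the roots of the word, whose sum
depends only on the group element (`mulOp_wordOp`, `sum_wordRoots_eq`). If z has trivial stabilizer,
linear functions separate the orbit points, so there are enough such functionals. Points with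
trivial stabilizer are dense in ĥ_reg (`dense_free`), and continuity gives the remaining points.

The analysis rests on one estimate, `exists_majorant`. The real part of (t_y z, v) is at most an
affine function of ‖y‖ minus a positive multiple of ‖y‖² (`re_form_transl_le`). The operators of
J_{t_y} grow at most exponentially in y, by the cocycle rule and a regularity bound that is uniform
along orbits (`eventually_URegular`, `exists_norm_act_cocycle_t_le`). The resulting Gaussian
majorant leaves room for a factor e^{r‖·‖}, and so yields convergence, analyticity in v, holomorphy
in z and termwise operations.

The equations then hold for algebraic reasons. Those in z come from reindexing the sums with the
cocycle rule; the differential equations hold for each exponential; and Q̂(s_a) changes the sum by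
terms C(s_a w) - C(w), which are antisymmetric under w ↦ s_a w (`qRefl_EPlus`). -/

theorem form_add_right (x y z : Hat 𝕜 κ) : form x (y + z) = form x y + form x z := by
  rw [form_comm, form_add_left, form_comm y, form_comm z]

theorem form_smul_right (r : 𝕜) (x y : Hat 𝕜 κ) : form x (r • y) = r * form x y := by
  rw [form_comm, form_smul_left, form_comm]

theorem form_neg_left (x y : Hat 𝕜 κ) : form (-x) y = -form x y := by
  rw [← neg_one_smul 𝕜, form_smul_left, neg_one_mul]

theorem form_sub_left (x y z : Hat 𝕜 κ) : form (x - y) z = form x z - form y z := by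
  rw [sub_eq_add_neg, form_add_left, form_neg_left, sub_eq_add_neg]

theorem form_sub_right (x y z : Hat 𝕜 κ) : form x (y - z) = form x y - form x z := by
  rw [form_comm, form_sub_left, form_comm y, form_comm z]

theorem form_cVec (x : Hat 𝕜 κ) : form x cVec = x.2.2 := by
  simp [form, cVec]

theorem refl_apply (a x : Hat 𝕜 κ) : refl a x = x - form x (vee a) • a := rfl

theorem refl_mul_self (a : Hat 𝕜 κ) : refl a * refl a = 1 :=
  LinearEquiv.ext fun x => reflMap_involutive a x

theorem refl_inv (a : Hat 𝕜 κ) : (refl a)⁻¹ = refl a :=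
  inv_eq_of_mul_eq_one_left (refl_mul_self a)

theorem form_vee_self {a : Hat 𝕜 κ} (ha : form a a ≠ 0) : form a (vee a) = 2 := by
  rw [vee, form_smul_right, div_mul_cancel₀ _ ha]

theorem refl_self {a : Hat 𝕜 κ} (ha : form a a ≠ 0) : refl a a = -a := by
  rw [refl_apply, form_vee_self ha, two_smul]; abel

theorem form_refl_refl (a x y : Hat 𝕜 κ) : form (refl a x) (refl a y) = form x y := by
  simp only [refl_apply, vee, form_sub_left, form_sub_right, form_smul_left, form_smul_right]
  rw [form_comm a y]
  by_cases h : form a a = 0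
  · simp [h]
  · field_simp; ring

theorem vee_neg (a : Hat 𝕜 κ) : vee (-a) = -vee a := by
  rw [vee, vee, form_neg_left, form_comm, form_neg_left, neg_neg, smul_neg]

theorem refl_neg (a : Hat 𝕜 κ) : refl (-a) = refl a := by
  refine LinearEquiv.ext fun x => ?_
  rw [refl_apply, refl_apply, vee_neg, form_comm, form_neg_left, form_comm, smul_neg, neg_smul,
    neg_neg]

theorem vee_map {g : Hat 𝕜 κ ≃ₗ[𝕜] Hat 𝕜 κ} (hg : ∀ x y, form (g x) (g y) = form x y)
    (a : Hat 𝕜 κ) : vee (g a) = g (vee a) := by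
  rw [vee, vee, hg, map_smul]

theorem refl_map {g : Hat 𝕜 κ ≃ₗ[𝕜] Hat 𝕜 κ} (hg : ∀ x y, form (g x) (g y) = form x y)
    (a : Hat 𝕜 κ) : refl (g a) = g * refl a * g⁻¹ := by
  refine LinearEquiv.ext fun x => ?_
  obtain ⟨x, rfl⟩ := g.surjective x
  have h : g⁻¹ (g x) = x := g.symm_apply_apply x
  rw [LinearEquiv.mul_apply, LinearEquiv.mul_apply, h, refl_apply, refl_apply, vee_map hg, hg,
    map_sub, map_smul]

/-- A reflection is the transvection along a with functional -(·, a^∨), so its determinant is 1 -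
(a, a^∨). This provides the sign character from which the separating functionals are built. -/
theorem det_refl {a : Hat 𝕜 κ} (ha : form a a ≠ 0) :
    LinearMap.det (refl a : Hat 𝕜 κ →ₗ[𝕜] Hat 𝕜 κ) = -1 := by
  let f : Module.Dual 𝕜 (Hat 𝕜 κ) :=
    { toFun := fun x => -form x (vee a)
      map_add' := fun x y => by rw [form_add_left]; ring
      map_smul' := fun r x => by rw [form_smul_left]; simp }
  have h : (refl a : Hat 𝕜 κ →ₗ[𝕜] Hat 𝕜 κ) = LinearMap.transvection f a := by
    refine LinearMap.ext fun x => ?_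
    rw [LinearMap.transvection.apply, LinearEquiv.coe_coe, refl_apply, sub_eq_add_neg, ← neg_smul]
    rfl
  rw [h, LinearMap.transvection.det]
  change 1 + -form a (vee a) = -1
  rw [form_vee_self ha]; ring

end FormAlgebra

/-! ### Complexification of automorphisms of V̂. -/

section Complexification

variable {κ : Type*}

theorem toC_add (x y : Hat ℝ κ) : toC (x + y) = toC x + toC y := by
  refine Prod.ext ?_ (Prod.ext ?_ ?_)
  · funext j; simp [toC]
  · simp [toC]
  · simp [toC]

theorem toC_smul (r : ℝ) (x : Hat ℝ κ) : toC (r • x) = (r : ℂ) • toC x := by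
  refine Prod.ext ?_ (Prod.ext ?_ ?_)
  · funext j; simp [toC]
  · simp [toC]
  · simp [toC]

theorem toC_neg (x : Hat ℝ κ) : toC (-x) = -toC x := by
  rw [← neg_one_smul ℝ x, toC_smul]; simp

theorem toC_sub (x y : Hat ℝ κ) : toC (x - y) = toC x - toC y := by
  rw [sub_eq_add_neg, toC_add, toC_neg, sub_eq_add_neg]

theorem rePart_add (x y : Hat ℂ κ) : rePart (x + y) = rePart x + rePart y := by
  refine Prod.ext ?_ (Prod.ext ?_ ?_) <;> first | (funext j; simp [rePart]) | simp [rePart]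

theorem imPart_add (x y : Hat ℂ κ) : imPart (x + y) = imPart x + imPart y := by
  refine Prod.ext ?_ (Prod.ext ?_ ?_) <;> first | (funext j; simp [imPart]) | simp [imPart]

theorem rePart_smul (r : ℂ) (x : Hat ℂ κ) :
    rePart (r • x) = r.re • rePart x - r.im • imPart x := by
  refine Prod.ext ?_ (Prod.ext ?_ ?_) <;>
    first | (funext j; simp [rePart, imPart]) | simp [rePart, imPart]

theorem imPart_smul (r : ℂ) (x : Hat ℂ κ) :
    imPart (r • x) = r.re • imPart x + r.im • rePart x := by
  refine Prod.ext ?_ (Prod.ext ?_ ?_) <;>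
    first | (funext j; simp [rePart, imPart]) | simp [rePart, imPart]

theorem toC_rePart_add_imPart (z : Hat ℂ κ) :
    toC (rePart z) + Complex.I • toC (imPart z) = z := by
  refine Prod.ext ?_ (Prod.ext ?_ ?_)
  · funext j
    simp [toC, rePart, imPart, mul_comm Complex.I]
  · simp [toC, rePart, imPart, mul_comm Complex.I]
  · simp [toC, rePart, imPart, mul_comm Complex.I]

theorem rePart_toC (x : Hat ℝ κ) : rePart (toC x) = x := rfl

theorem imPart_toC (x : Hat ℝ κ) : imPart (toC x) = 0 := rfl

/-- `cAct g` as a complex linear map. -/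
def cActL (g : Hat ℝ κ ≃ₗ[ℝ] Hat ℝ κ) : Hat ℂ κ →ₗ[ℂ] Hat ℂ κ where
  toFun := cAct g
  map_add' x y := by
    simp only [cAct, rePart_add, imPart_add, map_add, toC_add, smul_add]; abel
  map_smul' r x := by
    have h : r = r.re + r.im * Complex.I := (Complex.re_add_im r).symm
    simp only [cAct, rePart_smul, imPart_smul, map_add, map_sub, map_smul, toC_add, toC_sub,
      toC_smul, smul_add, RingHom.id_apply, smul_smul]
    set p := toC (g (rePart x))
    set q := toC (g (imPart x))
    -- The only coefficient identity that needs I² = -1; the rest is linear and left to `module`.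
    have e1 : r * Complex.I = Complex.I * r.re - r.im := by
      conv_lhs => rw [h, add_mul]
      linear_combination (r.im : ℂ) * Complex.I_mul_I
    have e2 : r • p + (r * Complex.I) • q =
        (r.re + r.im * Complex.I) • p + (Complex.I * r.re - r.im) • q := by
      rw [e1, ← h]
    rw [e2]
    module

theorem cActL_apply (g : Hat ℝ κ ≃ₗ[ℝ] Hat ℝ κ) (z : Hat ℂ κ) : cActL g z = cAct g z := rfl

theorem cAct_add (g : Hat ℝ κ ≃ₗ[ℝ] Hat ℝ κ) (x y : Hat ℂ κ) :
    cAct g (x + y) = cAct g x + cAct g y := map_add (cActL g) x y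

theorem cAct_smul (g : Hat ℝ κ ≃ₗ[ℝ] Hat ℝ κ) (r : ℂ) (x : Hat ℂ κ) :
    cAct g (r • x) = r • cAct g x := map_smul (cActL g) r x

theorem cAct_toC (g : Hat ℝ κ ≃ₗ[ℝ] Hat ℝ κ) (x : Hat ℝ κ) : cAct g (toC x) = toC (g x) := by
  have h0 : toC (0 : Hat ℝ κ) = 0 := by simpa using toC_smul 0 (0 : Hat ℝ κ)
  rw [cAct, rePart_toC, imPart_toC, map_zero, h0, smul_zero, add_zero]

theorem cAct_one (z : Hat ℂ κ) : cAct (1 : Hat ℝ κ ≃ₗ[ℝ] Hat ℝ κ) z = z :=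
  toC_rePart_add_imPart z

theorem cAct_mul (g h : Hat ℝ κ ≃ₗ[ℝ] Hat ℝ κ) (z : Hat ℂ κ) :
    cAct (g * h) z = cAct g (cAct h z) := by
  rw [cAct.eq_1 h, cAct_add, cAct_smul, cAct_toC, cAct_toC]; rfl

variable [Fintype κ]

theorem form_toC_toC (x y : Hat ℝ κ) : form (toC x) (toC y) = (form x y : ℝ) := by
  simp [form, toC, dotProduct]

theorem form_cAct {g : Hat ℝ κ ≃ₗ[ℝ] Hat ℝ κ} (hg : ∀ x y, form (g x) (g y) = form x y)
    (x y : Hat ℂ κ) : form (cAct g x) (cAct g y) = form x y := by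
  have key : ∀ a b : Hat ℝ κ, form (toC (g a)) (toC (g b)) = form (toC a) (toC b) := by
    intro a b; rw [form_toC_toC, form_toC_toC, hg]
  conv_rhs => rw [← toC_rePart_add_imPart x, ← toC_rePart_add_imPart y]
  simp only [cAct, form_add_left, form_add_right, form_smul_left, form_smul_right, key]

theorem form_toC_cAct {g : Hat ℝ κ ≃ₗ[ℝ] Hat ℝ κ} (hg : ∀ x y, form (g x) (g y) = form x y)
    (x : Hat ℝ κ) (z : Hat ℂ κ) : form (toC (g x)) (cAct g z) = form (toC x) z := by
  rw [← cAct_toC, form_cAct hg]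

theorem cAct_refl (a : Hat ℝ κ) (z : Hat ℂ κ) :
    cAct (refl a) z = z - form (toC (vee a)) z • toC a := by
  conv_rhs => rw [← toC_rePart_add_imPart z]
  simp only [cAct, refl_apply, toC_sub, toC_smul, form_add_right, form_smul_right, form_toC_toC,
    form_comm (vee a)]
  module

/-- Replaces the definition through real and imaginary parts by the closed formula, on which the
growth estimates are based. -/
theorem cAct_transl (u : κ → ℝ) (z : Hat ℂ κ) :
    cAct (transl u) z = translMap (fun j => (u j : ℂ)) z := by
  conv_rhs => rw [← toC_rePart_add_imPart z, map_add, map_smul]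
  have key : ∀ x : Hat ℝ κ, toC (transl u x) = translMap (fun j => (u j : ℂ)) (toC x) := by
    intro x
    refine Prod.ext ?_ (Prod.ext ?_ ?_)
    · funext j; simp [toC, transl, translMap]
    · simp [toC, transl, translMap, dotProduct]
    · simp [toC, transl, translMap]
  rw [cAct, key, key]

end Complexification

/-! ### Invariance of the form, the level, the affine roots and the regular set. -/

namespace Datum

variable {I ι ι' : Type*} [Finite I] [Fintype ι] [Fintype ι'] (D : Datum I ι ι')

theorem form_affRoot_self (i : I) (m : ℤ) :
    form (D.affRoot i m) (D.affRoot i m) = D.rootV i ⬝ᵥ D.rootV i := by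
  simp [form, affRoot]

theorem form_affRoot_ne {a : Hat ℝ (ι ⊕ ι')} (ha : a ∈ D.affRoots) : form a a ≠ 0 := by
  obtain ⟨i, m, rfl⟩ := ha
  rw [form_affRoot_self]; exact D.root_dot_pos i

theorem ne_zero_of_mem {a : Hat ℝ (ι ⊕ ι')} (ha : a ∈ D.affRoots) : a ≠ 0 := by
  rintro rfl
  exact D.form_affRoot_ne ha (by simp [form])

theorem level_of_mem {a : Hat ℝ (ι ⊕ ι')} (ha : a ∈ D.affRoots) : a.2.2 = 0 := by
  obtain ⟨i, m, rfl⟩ := ha; rfl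

theorem form_transl_transl {κ : Type*} [Fintype κ] (u : κ → ℝ) (x y : Hat ℝ κ) :
    form (transl u x) (transl u y) = form x y := by
  change form (translMap u x) (translMap u y) = form x y
  simp only [form, translMap, LinearMap.coe_mk, AddHom.coe_mk, dotProduct_add, add_dotProduct,
    dotProduct_smul, smul_dotProduct, smul_eq_mul, dotProduct_comm u y.1]
  ring

/-- Induction over generators and inverses for elements of `Ŵ^Y`. -/
theorem WHat_induction {p : (Hat ℝ (ι ⊕ ι') ≃ₗ[ℝ] Hat ℝ (ι ⊕ ι')) → Prop}
    (hs : ∀ i, p (refl (D.affRoot i 0))) (ht : ∀ y : D.Y, p (transl y)) (h1 : p 1)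
    (hmul : ∀ g h, p g → p h → p (g * h)) (w : D.WHat) : p w.1 := by
  have hinv : ∀ u : ι ⊕ ι' → ℝ, (transl u)⁻¹ = transl (-u) := fun u =>
    inv_eq_of_mul_eq_one_left (LinearEquiv.ext fun x => translMap_neg u x)
  refine Subgroup.closure_induction'' (p := fun g _ => p g) ?_ ?_ h1
    (fun g h _ _ hg hh => hmul g h hg hh) w.2
  · rintro _ (⟨i, rfl⟩ | ⟨y, rfl⟩)
    exacts [hs i, ht y]
  · rintro _ (⟨i, rfl⟩ | ⟨y, rfl⟩)
    · change p (refl (D.affRoot i 0))⁻¹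
      rw [refl_inv]; exact hs i
    · change p (transl (y : ι ⊕ ι' → ℝ))⁻¹
      rw [hinv]; exact ht (-y)

theorem form_WHat (w : D.WHat) (x y : Hat ℝ (ι ⊕ ι')) : form (w.1 x) (w.1 y) = form x y := by
  revert x y
  refine D.WHat_induction (p := fun g => ∀ x y, form (g x) (g y) = form x y) ?_ ?_ ?_ ?_ w
  · exact fun i x y => form_refl_refl _ x y
  · exact fun y => form_transl_transl _
  · exact fun x y => rfl
  · intro g h hg hh x y
    rw [LinearEquiv.mul_apply, LinearEquiv.mul_apply, hg, hh]

theorem WHat_cVec (w : D.WHat) : w.1 cVec = cVec := by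
  refine D.WHat_induction (p := fun g => g cVec = cVec) ?_ ?_ rfl ?_ w
  · intro i
    rw [refl_apply]
    simp [form, cVec, vee, affRoot]
  · intro y
    change translMap _ _ = _
    simp [translMap, cVec]
  · intro g h hg hh
    rw [LinearEquiv.mul_apply, hh, hg]

/-- The level is the pairing with c, which the group fixes. -/
theorem WHat_level (w : D.WHat) (x : Hat ℝ (ι ⊕ ι')) : (w.1 x).2.2 = x.2.2 := by
  rw [← form_cVec (w.1 x), ← D.WHat_cVec w, form_WHat, form_cVec]

/-- By `pairing_coroot` the Euclidean reflection agrees on V_s with that of the root pairing, which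
permutes the roots; c is orthogonal to the roots. -/
theorem refl_affRoot_affRoot (i j : I) (m : ℤ) :
    refl (D.affRoot i 0) (D.affRoot j m) = D.affRoot (D.P.reflectionPerm i j) m := by
  have h := D.pairing_coroot i (D.P.root j)
  have h2 := D.P.root_reflectionPerm i j
  rw [D.P.reflection_apply] at h2
  have h3 : D.rootV (D.P.reflectionPerm i j) = D.rootV j -
      (2 * (D.rootV i ⬝ᵥ D.rootV j) / (D.rootV i ⬝ᵥ D.rootV i)) • D.rootV i := by
    funext l
    cases l with
    | inl l =>
      simp only [rootV, Sum.elim_inl, Pi.sub_apply, Pi.smul_apply, h2]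
      rw [show D.P.coroot' i (D.P.root j) = D.P.toLinearMap (D.P.root j) (D.P.coroot i) from rfl, h]
      simp [dotProduct]
    | inr l => simp [rootV]
  rw [refl_apply, vee, form_smul_right, form_affRoot_self]
  refine Prod.ext ?_ (Prod.ext ?_ ?_)
  · simp only [affRoot, form, h3, Prod.fst_sub, Prod.smul_fst]
    rw [dotProduct_comm (D.rootV j)]
    congr 2
    simp
    ring
  · simp [affRoot]
  · simp [affRoot]

/-- Integrality of (Y, Q) keeps the c-coefficient integral. The shift z is kept explicit because it
counts inversions and gives the periodicity of k. -/
theorem transl_affRoot (y : D.Y) (i : I) (m : ℤ) :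
    ∃ z : ℤ, (y : ι ⊕ ι' → ℝ) ⬝ᵥ D.rootV i = z ∧
      transl (y : ι ⊕ ι' → ℝ) (D.affRoot i m) = D.affRoot i (m - z) := by
  obtain ⟨z, hz⟩ := D.integral y y.2 i
  refine ⟨z, hz, ?_⟩
  change translMap _ _ = _
  simp only [translMap, affRoot, LinearMap.coe_mk, AddHom.coe_mk]
  rw [dotProduct_comm (D.rootV i), rootV, hz]
  simp

theorem WHat_affRoots (w : D.WHat) {a : Hat ℝ (ι ⊕ ι')} (ha : a ∈ D.affRoots) :
    w.1 a ∈ D.affRoots := by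
  revert a
  refine D.WHat_induction (p := fun g => ∀ {a}, a ∈ D.affRoots → g a ∈ D.affRoots) ?_ ?_ ?_ ?_ w
  · rintro i _ ⟨j, m, rfl⟩
    exact ⟨_, m, D.refl_affRoot_affRoot i j m⟩
  · rintro y _ ⟨j, m, rfl⟩
    obtain ⟨z, -, h⟩ := D.transl_affRoot y j m
    exact ⟨j, m - z, h⟩
  · exact fun h => h
  · exact fun g h hg hh a ha => hg (hh ha)

theorem neg_mem_affRoots {a : Hat ℝ (ι ⊕ ι')} (ha : a ∈ D.affRoots) : -a ∈ D.affRoots := by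
  rw [← refl_self (D.form_affRoot_ne ha)]
  exact D.WHat_affRoots (D.s ⟨a, ha⟩) ha

theorem s_coe (a : D.affRoots) : (D.s a).1 = refl a.1 := rfl

theorem s_mul_self (a : D.affRoots) : D.s a * D.s a = 1 := Subtype.ext (refl_mul_self a.1)

theorem s_inv (a : D.affRoots) : (D.s a)⁻¹ = D.s a := inv_eq_of_mul_eq_one_left (D.s_mul_self a)

theorem s_neg (a : D.affRoots) : D.s ⟨-a.1, D.neg_mem_affRoots a.2⟩ = D.s a :=
  Subtype.ext (refl_neg a.1)

/-- `s_{wa} = w s_a w⁻¹`. -/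
theorem s_map (w : D.WHat) (a : D.affRoots) :
    D.s ⟨w.1 a.1, D.WHat_affRoots w a.2⟩ = w * D.s a * w⁻¹ :=
  Subtype.ext (refl_map (D.form_WHat w) a.1)

theorem cAct_WHat_mul (u w : D.WHat) (z : Hat ℂ (ι ⊕ ι')) :
    cAct (u * w).1 z = cAct u.1 (cAct w.1 z) := cAct_mul u.1 w.1 z

theorem cAct_WHat_level (w : D.WHat) (z : Hat ℂ (ι ⊕ ι')) : (cAct w.1 z).2.2 = z.2.2 := by
  have hc : toC (cVec : Hat ℝ (ι ⊕ ι')) = cVec := by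
    refine Prod.ext ?_ (Prod.ext ?_ ?_)
    · funext j; simp [toC, cVec]
    · simp [toC, cVec]
    · simp [toC, cVec]
  rw [← form_cVec, form_comm, ← hc]
  conv_lhs => rw [← D.WHat_cVec w]
  rw [form_toC_cAct (D.form_WHat w), hc, form_comm, form_cVec]

/-- The value `(a^∨, z)`. -/
def xval (a : Hat ℝ (ι ⊕ ι')) (z : Hat ℂ (ι ⊕ ι')) : ℂ := form (toC (vee a)) z

-- Since -a = s_a(a), invariance makes k even. This evenness later makes the correction terms odd in
-- the root.
variable {D} in
theorem IsMultiplicity.neg {k : Hat ℝ (ι ⊕ ι') → ℂ} (hk : D.IsMultiplicity k)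
    {a : Hat ℝ (ι ⊕ ι')} (ha : a ∈ D.affRoots) : k (-a) = k a := by
  rw [← refl_self (D.form_affRoot_ne ha)]
  exact hk (D.s ⟨a, ha⟩) a ha

theorem xval_neg (a : Hat ℝ (ι ⊕ ι')) (z : Hat ℂ (ι ⊕ ι')) : xval (-a) z = -xval a z := by
  rw [xval, vee_neg, toC_neg, form_neg_left, xval]

theorem xval_map (w : D.WHat) (a : Hat ℝ (ι ⊕ ι')) (z : Hat ℂ (ι ⊕ ι')) :
    xval (w.1 a) (cAct w.1 z) = xval a z := by
  rw [xval, vee_map (D.form_WHat w), form_toC_cAct (D.form_WHat w), xval]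

theorem WHat_apply_inv (w : D.WHat) (x : Hat ℝ (ι ⊕ ι')) : w.1 ((w⁻¹).1 x) = x :=
  w.1.apply_symm_apply x

theorem WHat_inv_apply (w : D.WHat) (x : Hat ℝ (ι ⊕ ι')) : (w⁻¹).1 (w.1 x) = x :=
  w.1.symm_apply_apply x

theorem xval_cAct (w : D.WHat) (a : Hat ℝ (ι ⊕ ι')) (z : Hat ℂ (ι ⊕ ι')) :
    xval a (cAct w.1 z) = xval ((w⁻¹).1 a) z := by
  conv_lhs => rw [← D.WHat_apply_inv w a]
  rw [xval_map]

variable {D} in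
theorem reg_cAct {k : Hat ℝ (ι ⊕ ι') → ℂ} (hk : D.IsMultiplicity k) (w : D.WHat)
    {z : Hat ℂ (ι ⊕ ι')} (hz : z ∈ D.reg k) : cAct w.1 z ∈ D.reg k := by
  intro a ha
  change xval a _ ≠ 0 ∧ xval a _ ≠ k a
  rw [xval_cAct, ← hk w⁻¹ a ha]
  exact hz _ (D.WHat_affRoots w⁻¹ ha)

variable {D} in
theorem regPlus_cAct {k : Hat ℝ (ι ⊕ ι') → ℂ} (hk : D.IsMultiplicity k) (w : D.WHat)
    {z : Hat ℂ (ι ⊕ ι')} (hz : z ∈ D.regPlus k) : cAct w.1 z ∈ D.regPlus k :=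
  ⟨reg_cAct hk w hz.1, by rw [cAct_WHat_level]; exact hz.2⟩

end Datum

namespace Datum

/-! ### Linear functionals that detect positivity. -/

section Functionals

variable {ι ι' : Type*}

/-- The inclusion of `V_s` in `V̂`. -/
def emb (ι ι' : Type*) : (ι → ℝ) →ₗ[ℝ] Hat ℝ (ι ⊕ ι') where
  toFun x := (Sum.elim x 0, 0, 0)
  map_add' x y := by
    refine Prod.ext ?_ (Prod.ext ?_ ?_)
    · funext j; cases j <;> simp
    · simp
    · simp
  map_smul' r x := by
    refine Prod.ext ?_ (Prod.ext ?_ ?_)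
    · funext j; cases j <;> simp
    · simp
    · simp

/-- The linear functional on `V̂` which extends `h` by `s` on `c` and by `0` on `V' ⊕ ℝd`. -/
def extFun (ι' : Type*) (h : (ι → ℝ) →ₗ[ℝ] ℝ) (s : ℝ) : Hat ℝ (ι ⊕ ι') →ₗ[ℝ] ℝ where
  toFun x := h (fun j => x.1 (Sum.inl j)) + s * x.2.1
  map_add' x y := by
    have : (fun j => (x + y).1 (Sum.inl j)) =
        (fun j => x.1 (Sum.inl j)) + fun j => y.1 (Sum.inl j) := rfl
    rw [this, map_add]; simp; ring
  map_smul' r x := by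
    have : (fun j => (r • x).1 (Sum.inl j)) = r • fun j => x.1 (Sum.inl j) := rfl
    rw [this, map_smul]; simp; ring

theorem extFun_emb (h : (ι → ℝ) →ₗ[ℝ] ℝ) (s : ℝ) (x : ι → ℝ) :
    extFun ι' h s (emb ι ι' x) = h x := by
  simp [extFun, emb]

theorem extFun_cVec (h : (ι → ℝ) →ₗ[ℝ] ℝ) (s : ℝ) : extFun ι' h s cVec = s := by
  have : (fun _ => 0 : ι → ℝ) = 0 := rfl
  simp [extFun, cVec, this]

end Functionals

variable {I ι ι' : Type*} [Finite I] [Fintype ι] [Fintype ι'] (D : Datum I ι ι')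

/-! ### Positive affine roots -/

theorem emb_root (i : I) : emb ι ι' (D.P.root i) = D.affRoot i 0 := by
  simp [emb, affRoot, rootV]

theorem affRoot_eq (i : I) (m : ℤ) :
    D.affRoot i m = emb ι ι' (D.P.root i) + (m : ℝ) • cVec := by
  simp [emb, affRoot, rootV, cVec]

/-- The affine simple root `-θ + c`. -/
theorem zero_root_eq : ((-D.rootV D.θ, 1, 0) : Hat ℝ (ι ⊕ ι')) =
    -emb ι ι' (D.P.root D.θ) + cVec := by
  simp [emb, rootV, cVec]

/-- Simple roots are linearly independent, so values on them can be prescribed; a left inverse of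
the linear combination map extends the prescription to V_s. -/
theorem exists_dual (c : I → ℝ) :
    ∃ h : (ι → ℝ) →ₗ[ℝ] ℝ, ∀ i ∈ D.base.support, h (D.P.root i) = c i := by
  have hli := D.base.linearIndepOn_root
  obtain ⟨g, hg⟩ := LinearMap.exists_leftInverse_of_injective
    (Finsupp.linearCombination ℝ fun i : (D.base.support : Set I) => D.P.root i)
    (LinearMap.ker_eq_bot.mpr hli)
  refine ⟨(Finsupp.linearCombination ℝ fun i : (D.base.support : Set I) => c i) ∘ₗ g,
    fun i hi => ?_⟩
  have := LinearMap.congr_fun hg (Finsupp.single ⟨i, hi⟩ 1)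
  simp only [LinearMap.comp_apply, Finsupp.linearCombination_single, one_smul,
    LinearMap.id_apply] at this
  rw [LinearMap.comp_apply, this]
  simp

theorem nonneg_of_mem_closure {h : (ι → ℝ) →ₗ[ℝ] ℝ}
    (hh : ∀ i ∈ D.base.support, 0 ≤ h (D.P.root i)) {x : ι → ℝ}
    (hx : x ∈ AddSubmonoid.closure (D.P.root '' D.base.support)) : 0 ≤ h x := by
  induction hx using AddSubmonoid.closure_induction with
  | mem x hx => obtain ⟨i, hi, rfl⟩ := hx; exact hh i hi
  | zero => simp
  | add x y _ _ hx hy => rw [map_add]; exact add_nonneg hx hy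

theorem support_nonempty : D.base.support.Nonempty := by
  have : Nonempty I := ⟨D.θ⟩
  exact D.base.support_nonempty

/-- Maximality only controls differences θ - α; adding back a simple α gives θ itself. -/
theorem highest_mem : D.P.root D.θ ∈ AddSubmonoid.closure (D.P.root '' D.base.support) := by
  obtain ⟨i, hi⟩ := D.support_nonempty
  have := add_mem (D.highest i) (AddSubmonoid.subset_closure ⟨i, hi, rfl⟩)
  rwa [sub_add_cancel] at this

theorem root_neg (i : I) : D.P.root (D.P.reflectionPerm i i) = -D.P.root i := by
  rw [D.P.root_reflectionPerm, D.P.reflection_apply_self]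

theorem emb_mem_closure {x : ι → ℝ}
    (hx : x ∈ AddSubmonoid.closure (D.P.root '' D.base.support)) :
    emb ι ι' x ∈ AddSubmonoid.closure D.simpleRoots := by
  induction hx using AddSubmonoid.closure_induction with
  | mem x hx =>
    obtain ⟨i, hi, rfl⟩ := hx
    exact AddSubmonoid.subset_closure (Or.inl ⟨i, hi, D.emb_root i⟩)
  | zero => simp
  | add x y _ _ hx hy => rw [map_add]; exact add_mem hx hy

/-- There is a linear functional which is positive on the simple affine roots. -/
theorem exists_pos_functional :
    ∃ φ : Hat ℝ (ι ⊕ ι') →ₗ[ℝ] ℝ, ∀ a ∈ D.simpleRoots, 0 < φ a := by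
  obtain ⟨h, hh⟩ := D.exists_dual fun _ => 1
  -- The value 1 + h(θ) at c gives -θ + c the value 1.
  refine ⟨extFun ι' h (1 + h (D.P.root D.θ)), ?_⟩
  rintro a (⟨i, hi, rfl⟩ | rfl)
  · rw [← emb_root, extFun_emb, hh i hi]; exact one_pos
  · rw [zero_root_eq, map_add, map_neg, extFun_emb, extFun_cVec]; simp

/-- For a simple affine root `a` there is a linear functional which vanishes at `a` and is positive
at the other simple affine roots. -/
theorem exists_wall_functional {a : Hat ℝ (ι ⊕ ι')} (ha : a ∈ D.simpleRoots) :
    ∃ φ : Hat ℝ (ι ⊕ ι') →ₗ[ℝ] ℝ, φ a = 0 ∧ ∀ b ∈ D.simpleRoots, b ≠ a → 0 < φ b := by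
  classical
  rcases ha with ⟨i, hi, rfl⟩ | rfl
  · obtain ⟨h, hh⟩ := D.exists_dual fun j => if j = i then 0 else 1
    have hθ : 0 ≤ h (D.P.root D.θ) := D.nonneg_of_mem_closure
      (fun j hj => by rw [hh j hj]; split_ifs <;> norm_num) D.highest_mem
    refine ⟨extFun ι' h (1 + h (D.P.root D.θ)), ?_, ?_⟩
    · rw [← emb_root, extFun_emb, hh i hi, if_pos rfl]
    · rintro b (⟨j, hj, rfl⟩ | rfl) hb
      · have : j ≠ i := fun h => hb (by rw [h])
        rw [← emb_root, extFun_emb, hh j hj, if_neg this]; exact one_pos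
      · rw [zero_root_eq, map_add, map_neg, extFun_emb, extFun_cVec]; simp
  · obtain ⟨h, hh⟩ := D.exists_dual fun j => 1
    -- The value h(θ) at c makes the functional vanish exactly at the affine simple root -θ + c.
    refine ⟨extFun ι' h (h (D.P.root D.θ)), ?_, ?_⟩
    · rw [zero_root_eq, map_add, map_neg, extFun_emb, extFun_cVec]; simp
    · rintro b (⟨j, hj, rfl⟩ | rfl) hb
      · rw [← emb_root, extFun_emb, hh j hj]; exact one_pos
      · exact absurd rfl hb

theorem simpleRoots_subset_posRoots : D.simpleRoots ⊆ D.posRoots := fun _ h =>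
  ⟨D.simpleRoots_subset h, AddSubmonoid.subset_closure h⟩

/-- With m = n + 1, write α + mc = (n + 1)(-θ + c) + nθ + (θ - (-α)). The last two summands are
nonnegative combinations of simple roots, by maximality of θ against -α. -/
theorem affRoot_mem_posRoots_of_pos (i : I) {m : ℤ} (hm : 0 < m) :
    D.affRoot i m ∈ D.posRoots := by
  refine ⟨⟨i, m, rfl⟩, ?_⟩
  obtain ⟨n, rfl⟩ : ∃ n : ℕ, m = n + 1 := ⟨(m - 1).toNat, by omega⟩
  have h1 := D.emb_mem_closure (D.highest (D.P.reflectionPerm i i))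
  have h2 := D.emb_mem_closure D.highest_mem
  have h3 : ((-D.rootV D.θ, 1, 0) : Hat ℝ (ι ⊕ ι')) ∈ AddSubmonoid.closure D.simpleRoots :=
    AddSubmonoid.subset_closure (Or.inr rfl)
  have h4 := add_mem (add_mem (nsmul_mem h3 (n + 1)) (nsmul_mem h2 n)) h1
  convert h4 using 1
  rw [affRoot_eq, zero_root_eq, root_neg, map_sub, map_neg]
  push_cast
  rw [← Nat.cast_smul_eq_nsmul ℝ, ← Nat.cast_smul_eq_nsmul ℝ]
  push_cast
  module

theorem neg_affRoot (i : I) (m : ℤ) :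
    -D.affRoot i m = D.affRoot (D.P.reflectionPerm i i) (-m) := by
  rw [affRoot_eq, affRoot_eq, root_neg, map_neg]
  push_cast
  module

theorem pos_or_neg {a : Hat ℝ (ι ⊕ ι')} (ha : a ∈ D.affRoots) :
    a ∈ D.posRoots ∨ -a ∈ D.posRoots := by
  obtain ⟨i, m, rfl⟩ := ha
  rcases lt_trichotomy m 0 with hm | rfl | hm
  · right
    rw [neg_affRoot]
    exact D.affRoot_mem_posRoots_of_pos _ (by omega)
  · rcases D.base.root_mem_or_neg_mem i with h | h
    · left
      refine ⟨⟨i, 0, rfl⟩, ?_⟩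
      rw [← emb_root]; exact D.emb_mem_closure h
    · right
      refine ⟨D.neg_mem_affRoots ⟨i, 0, rfl⟩, ?_⟩
      rw [← emb_root, ← map_neg]; exact D.emb_mem_closure h
  · exact Or.inl (D.affRoot_mem_posRoots_of_pos i hm)

theorem functional_pos {φ : Hat ℝ (ι ⊕ ι') →ₗ[ℝ] ℝ} (hφ : ∀ a ∈ D.simpleRoots, 0 < φ a)
    {a : Hat ℝ (ι ⊕ ι')} (ha : a ∈ D.posRoots) : 0 < φ a := by
  have key : ∀ x ∈ AddSubmonoid.closure D.simpleRoots, x = 0 ∨ 0 < φ x := by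
    intro x hx
    induction hx using AddSubmonoid.closure_induction with
    | mem x hx => exact Or.inr (hφ x hx)
    | zero => exact Or.inl rfl
    | add x y _ _ hx hy =>
      rcases hx with rfl | hx <;> rcases hy with rfl | hy
      · left; simp
      · right; simpa using hy
      · right; simpa using hx
      · right; rw [map_add]; exact add_pos hx hy
  exact (key a ha.2).resolve_left (D.ne_zero_of_mem ha.1)

theorem neg_notMem_posRoots {a : Hat ℝ (ι ⊕ ι')} (ha : a ∈ D.posRoots) : -a ∉ D.posRoots := by
  intro h
  obtain ⟨φ, hφ⟩ := D.exists_pos_functional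
  have h1 := D.functional_pos hφ ha
  have h2 := D.functional_pos hφ h
  rw [map_neg] at h2
  linarith

/-- The factor 0 is impossible because roots are nonzero, and factors of at least 2 because the root
system is reduced. -/
theorem eq_of_nsmul {a b : Hat ℝ (ι ⊕ ι')} (ha : a ∈ D.affRoots) (hb : b ∈ D.affRoots) {n : ℕ}
    (h : b = n • a) : b = a := by
  have h0 := D.ne_zero_of_mem hb
  obtain ⟨i, m, rfl⟩ := ha
  obtain ⟨j, l, rfl⟩ := hb
  have hr : D.P.root j = n • D.P.root i := by
    funext t
    have := congrFun (congrArg Prod.fst h) (Sum.inl t)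
    simpa [affRoot, rootV] using this
  match n with
  | 0 => exact absurd (by simpa using h) h0
  | 1 => simpa using h
  | n + 2 =>
    have := D.isReduced
    exact absurd ⟨j, hr⟩ (D.P.nsmul_notMem_range_root (n := n + 2) (i := i))

/-- The reflection in a simple affine root `a` permutes the positive affine roots other
than `a`. -/
theorem refl_mem_posRoots {a b : Hat ℝ (ι ⊕ ι')} (ha : a ∈ D.simpleRoots) (hb : b ∈ D.posRoots)
    (hab : b ≠ a) : refl a b ∈ D.posRoots := by
  obtain ⟨φ, h0, hφ⟩ := D.exists_wall_functional ha
  -- On the positive cone the zero set of the wall functional is ℕa, so a positive root different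
  -- from a has positive value.
  have key : ∀ x ∈ AddSubmonoid.closure D.simpleRoots, 0 ≤ φ x ∧ (φ x = 0 → ∃ n : ℕ, x = n • a) := by
    intro x hx
    induction hx using AddSubmonoid.closure_induction with
    | mem x hx =>
      by_cases h : x = a
      · subst h; exact ⟨h0.ge, fun _ => ⟨1, (one_smul _ _).symm⟩⟩
      · exact ⟨(hφ x hx h).le, fun h' => absurd h' (hφ x hx h).ne'⟩
    | zero => exact ⟨by simp, fun _ => ⟨0, by simp⟩⟩
    | add x y _ _ hx hy =>
      rw [map_add]
      refine ⟨add_nonneg hx.1 hy.1, fun h => ?_⟩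
      obtain ⟨n, hn⟩ := hx.2 (by linarith [hx.1, hy.1])
      obtain ⟨m, hm⟩ := hy.2 (by linarith [hx.1, hy.1])
      exact ⟨n + m, by rw [add_smul, ← hn, ← hm]⟩
  have hpos : 0 < φ b := by
    refine lt_of_le_of_ne (key b hb.2).1 fun h => hab ?_
    obtain ⟨n, hn⟩ := (key b hb.2).2 h.symm
    exact D.eq_of_nsmul (D.simpleRoots_subset ha) hb.1 hn
  -- The reflection changes b by a multiple of a, where φ vanishes. As φ stays positive, the image
  -- cannot be a negative root.
  have hφr : φ (refl a b) = φ b := by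
    rw [refl_apply, map_sub, map_smul, h0]; simp
  have hr : refl a b ∈ D.affRoots := D.WHat_affRoots (D.s ⟨a, D.simpleRoots_subset ha⟩) hb.1
  refine (D.pos_or_neg hr).resolve_right fun h => ?_
  have := (key _ h.2).1
  rw [map_neg, hφr] at this
  linarith

/-! ### Generation by simple reflections and `Ω` -/

/-- The inversions of `g`: positive affine roots which `g` maps to negative ones. -/
def inversions (g : Hat ℝ (ι ⊕ ι') ≃ₗ[ℝ] Hat ℝ (ι ⊕ ι')) : Set (Hat ℝ (ι ⊕ ι')) :=
  {a | a ∈ D.posRoots ∧ -g a ∈ D.posRoots}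

theorem nonneg_of_affRoot_mem {i : I} {m : ℤ} (h : D.affRoot i m ∈ D.posRoots) : 0 ≤ m := by
  have key : ∀ x ∈ AddSubmonoid.closure D.simpleRoots, 0 ≤ x.2.1 := by
    intro x hx
    induction hx using AddSubmonoid.closure_induction with
    | mem x hx =>
      rcases hx with ⟨i, -, rfl⟩ | rfl
      · simp [affRoot]
      · simp
    | zero => simp
    | add x y _ _ hx hy => exact add_nonneg hx hy
  have := key _ h.2
  simpa [affRoot] using this

/-- A generator moves the c-coefficient of the roots over a given α by a fixed amount, so only
finitely many can change sign; inversions of gh lie among those of h and the preimages under h of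
those of g. Stability of the affine roots is carried along because the induction runs over bare
automorphisms. -/
theorem inversions_finite (w : D.WHat) : (D.inversions w.1).Finite := by
  suffices h : (∀ a ∈ D.affRoots, w.1 a ∈ D.affRoots) ∧ (D.inversions w.1).Finite from h.2
  have hneg : ∀ {j : I} {m : ℤ}, -D.affRoot j m ∈ D.posRoots → m ≤ 0 := by
    intro j m h
    rw [neg_affRoot] at h
    have := D.nonneg_of_affRoot_mem h
    omega
  refine D.WHat_induction
    (p := fun g => (∀ a ∈ D.affRoots, g a ∈ D.affRoots) ∧ (D.inversions g).Finite) ?_ ?_ ?_ ?_ w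
  · intro i
    refine ⟨fun a ha => D.WHat_affRoots (D.s ⟨D.affRoot i 0, i, 0, rfl⟩) ha,
      (Set.finite_range fun j => D.affRoot j 0).subset ?_⟩
    rintro a ⟨h1, h2⟩
    obtain ⟨j, m, rfl⟩ := h1.1
    rw [refl_affRoot_affRoot] at h2
    have e1 := D.nonneg_of_affRoot_mem h1
    have e2 := hneg h2
    obtain rfl : m = 0 := by omega
    exact ⟨j, rfl⟩
  · intro y
    refine ⟨fun a ha => D.WHat_affRoots (D.t y) ha, ?_⟩
    choose z hz using fun j => D.integral y y.2 j
    refine (Set.finite_iUnion fun j : I => (Set.finite_Icc 0 (z j)).image (D.affRoot j)).subset ?_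
    rintro a ⟨h1, h2⟩
    obtain ⟨j, m, rfl⟩ := h1.1
    obtain ⟨z', hz', h3⟩ := D.transl_affRoot y j m
    rw [h3] at h2
    have e1 := D.nonneg_of_affRoot_mem h1
    have e2 := hneg h2
    have e3 : z' = z j := by
      have := hz j
      rw [show (Sum.elim (D.P.root j) 0 : ι ⊕ ι' → ℝ) = D.rootV j from rfl, hz'] at this
      exact_mod_cast this
    exact Set.mem_iUnion.mpr ⟨j, m, ⟨e1, by omega⟩, rfl⟩
  · refine ⟨fun a ha => ha, ?_⟩
    convert Set.finite_empty
    exact Set.eq_empty_of_forall_notMem fun a ha => D.neg_notMem_posRoots ha.1 ha.2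
  · rintro g h ⟨hg, hg'⟩ ⟨hh, hh'⟩
    refine ⟨fun a ha => hg _ (hh a ha), (hh'.union (hg'.preimage h.injective.injOn)).subset ?_⟩
    rintro a ⟨h1, h2⟩
    rcases D.pos_or_neg (hh a h1.1) with h3 | h3
    · exact Or.inr ⟨h3, h2⟩
    · exact Or.inl ⟨h1, h3⟩

theorem omega_of_simple {w : D.WHat} (h : ∀ a ∈ D.simpleRoots, w.1 a ∈ D.posRoots) :
    w ∈ D.Ω := by
  intro a ha
  refine ⟨D.WHat_affRoots w ha.1, ?_⟩
  have key : ∀ x ∈ AddSubmonoid.closure D.simpleRoots,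
      w.1 x ∈ AddSubmonoid.closure D.simpleRoots := by
    intro x hx
    induction hx using AddSubmonoid.closure_induction with
    | mem x hx => exact (h x hx).2
    | zero => simp
    | add x y _ _ hx hy => rw [map_add]; exact add_mem hx hy
  exact key a ha.2

/-- The letters: simple affine roots and elements of `Ω`. -/
abbrev Letter := D.simpleRoots ⊕ D.Ω

variable {D} in
/-- The simple reflection in `a`. -/
def sref (a : D.simpleRoots) : D.WHat := D.s ⟨a.1, D.simpleRoots_subset a.2⟩

variable {D} in
/-- The group element which belongs to a letter. -/
def Letter.elt : D.Letter → D.WHat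
  | Sum.inl a => sref a
  | Sum.inr ω => ω.1

/-- The group element represented by a word. -/
def wordElt (L : List D.Letter) : D.WHat := (L.map Letter.elt).prod

theorem wordElt_nil : D.wordElt [] = 1 := rfl

theorem wordElt_cons (l : D.Letter) (L : List D.Letter) :
    D.wordElt (l :: L) = l.elt * D.wordElt L := by simp [wordElt]

theorem wordElt_append (L L' : List D.Letter) :
    D.wordElt (L ++ L') = D.wordElt L * D.wordElt L' := by simp [wordElt]

theorem sref_coe (a : D.simpleRoots) : (sref a).1 = refl a.1 := rfl

theorem sref_self (a : D.simpleRoots) : (sref a).1 a.1 = -a.1 :=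
  refl_self (D.form_affRoot_ne (D.simpleRoots_subset a.2))

theorem sref_mul_self (a : D.simpleRoots) : sref a * sref a = 1 := D.s_mul_self _

theorem sref_sref (a : D.simpleRoots) (x : Hat ℝ (ι ⊕ ι')) :
    (sref a).1 ((sref a).1 x) = x := reflMap_involutive a.1 x

/-- `Ŵ^Y` is generated by the simple reflections and `Ω`. -/
theorem exists_word (w : D.WHat) : ∃ L, D.wordElt L = w := by
  -- If no simple root is inverted, the element lies in Ω. Otherwise a simple reflection on the
  -- right removes an inversion.
  induction hn : (D.inversions w.1).ncard using Nat.strong_induction_on generalizing w with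
  | _ n ih =>
    by_cases hs : ∀ a ∈ D.simpleRoots, w.1 a ∈ D.posRoots
    · exact ⟨[Sum.inr ⟨w, D.omega_of_simple hs⟩], by simp [wordElt, Letter.elt]⟩
    · push Not at hs
      obtain ⟨a, ha, hwa⟩ := hs
      have hpa := D.simpleRoots_subset_posRoots ha
      have hinv : a ∈ D.inversions w.1 :=
        ⟨hpa, (D.pos_or_neg (D.WHat_affRoots w hpa.1)).resolve_left hwa⟩
      let a' : D.simpleRoots := ⟨a, ha⟩
      -- As s_a permutes the positive roots other than a, it carries inversions of w s_a to
      -- inversions of w; a itself is lost, and the count drops strictly.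
      have hsub : D.inversions (w * sref a').1 ⊆ (sref a').1 '' (D.inversions w.1 \ {a}) := by
        rintro b ⟨h1, h2⟩
        have h2' : -w.1 ((sref a').1 b) ∈ D.posRoots := h2
        have hba : b ≠ a := by
          rintro rfl
          rw [D.sref_self a', map_neg, neg_neg] at h2'
          exact hwa h2'
        refine ⟨(sref a').1 b, ⟨⟨D.refl_mem_posRoots ha h1 hba, h2'⟩, fun h => ?_⟩,
          D.sref_sref a' b⟩
        have h3 : (sref a').1 b = a := h
        have h4 := D.sref_sref a' b
        rw [h3, D.sref_self a'] at h4
        rw [← h4] at h1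
        exact D.neg_notMem_posRoots hpa h1
      have hfin := D.inversions_finite w
      have hlt : (D.inversions (w * sref a').1).ncard < n := by
        refine lt_of_le_of_lt (Set.ncard_le_ncard hsub ((hfin.sdiff).image _)) ?_
        refine lt_of_le_of_lt (Set.ncard_image_le hfin.sdiff) ?_
        rw [← hn]
        exact Set.ncard_sdiff_singleton_lt_of_mem hinv hfin
      obtain ⟨L, hL⟩ := ih _ hlt (w * sref a') rfl
      refine ⟨L ++ [Sum.inl a'], ?_⟩
      rw [wordElt_append, hL]
      simp [wordElt, Letter.elt, mul_assoc, sref_mul_self]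

end Datum

namespace Datum

variable {I ι ι' : Type*} [Finite I] [Fintype ι] [Fintype ι'] (D : Datum I ι ι')

/-! ### The decomposition `Ŵ^Y = Y ⋊ W` -/

theorem transl_add {κ : Type*} [Fintype κ] (u v : κ → ℝ) :
    transl (u + v) = transl u * transl v := by
  refine LinearEquiv.ext fun x => ?_
  change translMap _ _ = translMap _ (translMap _ _)
  refine Prod.ext ?_ (Prod.ext ?_ rfl)
  · simp only [translMap, LinearMap.coe_mk, AddHom.coe_mk, smul_add]; abel
  · simp only [translMap, LinearMap.coe_mk, AddHom.coe_mk, dotProduct_add, add_dotProduct,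
      smul_dotProduct, smul_eq_mul, dotProduct_comm v u]
    ring

theorem t_add (y y' : D.Y) : D.t (y + y') = D.t y * D.t y' :=
  Subtype.ext (transl_add (y : ι ⊕ ι' → ℝ) y')

theorem t_zero : D.t 0 = 1 := by
  have := D.t_add 0 0
  rw [add_zero] at this
  exact (mul_eq_left.mp this.symm)

/-- Reflections normalize the translations: this moves s_α past t_u at the price of reflecting u. -/
theorem refl_mul_transl (i : I) (u : ι ⊕ ι' → ℝ) :
    refl (D.affRoot i 0) * transl u =
      transl (u - (2 * (u ⬝ᵥ D.rootV i) / (D.rootV i ⬝ᵥ D.rootV i)) • D.rootV i) *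
        refl (D.affRoot i 0) := by
  have h := D.root_dot_pos i
  refine LinearEquiv.ext fun x => ?_
  obtain ⟨v, η, ξ⟩ := x
  change reflMap _ (translMap _ _) = translMap _ (reflMap _ _)
  set α := D.rootV i with hα
  refine Prod.ext ?_ (Prod.ext ?_ ?_)
  · simp only [reflMap, translMap, vee, form, affRoot, LinearMap.coe_mk, AddHom.coe_mk,
      ← hα, Prod.fst_sub, Prod.snd_sub, Prod.smul_fst, Prod.smul_snd, dotProduct_smul, add_dotProduct,
      smul_dotProduct, smul_eq_mul, Int.cast_zero]
    generalize α ⬝ᵥ α = q at h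
    generalize v ⬝ᵥ α = p
    generalize u ⬝ᵥ α = r
    funext j
    simp only [Pi.sub_apply, Pi.smul_apply, Pi.add_apply, smul_eq_mul]
    simp only [mul_zero, add_zero]
    field_simp
    ring
  · simp only [reflMap, translMap, vee, form, affRoot, LinearMap.coe_mk, AddHom.coe_mk,
      ← hα, Prod.snd_sub, Prod.fst_sub, Prod.smul_fst, Prod.smul_snd, dotProduct_smul,
      add_dotProduct, sub_dotProduct, dotProduct_sub, smul_dotProduct, smul_eq_mul, Int.cast_zero,
      dotProduct_comm α u]
    generalize α ⬝ᵥ α = q at h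
    generalize v ⬝ᵥ α = p
    generalize u ⬝ᵥ α = r
    simp only [mul_zero, add_zero]
    field_simp
    ring
  · simp [reflMap, translMap, affRoot]

/-- The products t_y u form a set that contains 1 and is stable under left multiplication by the
generators; the reflected lattice vector remains in Y because it differs from y by an integral
multiple of a coroot. -/
theorem exists_eq_t_mul (w : D.WHat) : ∃ (y : D.Y) (u : D.W), w = D.t y * u.1 := by
  suffices h : ∀ (y : D.Y) (u : D.W), ∃ (y' : D.Y) (u' : D.W),
      w.1 * (D.t y * u.1).1 = (D.t y' * u'.1).1 by
    obtain ⟨y, u, h⟩ := h 0 1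
    refine ⟨y, u, Subtype.ext ?_⟩
    rw [← h, t_zero]
    simp
  refine D.WHat_induction (p := fun g => ∀ (y : D.Y) (u : D.W), ∃ (y' : D.Y) (u' : D.W),
      g * (D.t y * u.1).1 = (D.t y' * u'.1).1) ?_ ?_ ?_ ?_ w
  · intro i y u
    have hmem : (y : ι ⊕ ι' → ℝ) - (2 * ((y : ι ⊕ ι' → ℝ) ⬝ᵥ D.rootV i) /
        (D.rootV i ⬝ᵥ D.rootV i)) • D.rootV i ∈ D.Y := by
      refine sub_mem y.2 ?_
      obtain ⟨z, hz⟩ := D.integral y y.2 i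
      have hz' : (y : ι ⊕ ι' → ℝ) ⬝ᵥ D.rootV i = z := hz
      have hc := zsmul_mem (D.coroot_mem i) z
      rw [← Int.cast_smul_eq_zsmul ℝ, smul_smul, ← rootV_dot] at hc
      rw [hz']
      convert hc using 2
      · ring
      · rfl
    refine ⟨⟨_, hmem⟩, ⟨D.s ⟨D.affRoot i 0, i, 0, rfl⟩, Subgroup.subset_closure ⟨i, rfl⟩⟩ * u, ?_⟩
    change refl (D.affRoot i 0) * (transl (y : ι ⊕ ι' → ℝ) * u.1.1) =
      transl _ * (refl (D.affRoot i 0) * u.1.1)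
    rw [← mul_assoc, refl_mul_transl, mul_assoc]
  · intro y' y u
    refine ⟨y' + y, u, ?_⟩
    rw [t_add]
    rfl
  · exact fun y u => ⟨y, u, one_mul _⟩
  · intro g h hg hh y u
    obtain ⟨y', u', h'⟩ := hh y u
    rw [mul_assoc, h']
    exact hg y' u'

theorem W_fix (u : D.W) {x : Hat ℝ (ι ⊕ ι')} (hx : ∀ j, x.1 (Sum.inl j) = 0) : u.1.1 x = x := by
  obtain ⟨u, hu⟩ := u
  change u.1 x = x
  induction hu using Subgroup.closure_induction with
  | mem u hu =>
    obtain ⟨i, rfl⟩ := hu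
    change refl (D.affRoot i 0) x = x
    rw [refl_apply]
    have : form x (vee (D.affRoot i 0)) = 0 := by
      rw [vee, form_smul_right]
      simp [form, affRoot, rootV, dotProduct, hx]
    rw [this, zero_smul, sub_zero]
  | one => rfl
  | mul u v _ _ hu hv =>
    change u.1 (v.1 x) = x
    rw [hv, hu]
  | inv u _ hu =>
    conv_lhs => rw [← hu]
    exact D.WHat_inv_apply u x

/-- W fixes d, and the c-coefficient of a level zero vector is its pairing with d. -/
theorem W_affRoot (u : D.W) (i : I) : ∃ j, u.1.1 (D.affRoot i 0) = D.affRoot j 0 := by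
  have hi : (u.1.1 (D.affRoot i 0)) ∈ D.affRoots := D.WHat_affRoots u.1 ⟨i, 0, rfl⟩
  obtain ⟨j, m, hj⟩ := hi
  refine ⟨j, ?_⟩
  have hd : form (u.1.1 (D.affRoot i 0)) (u.1.1 dVec) = 0 := by
    rw [D.form_WHat]; simp [form, affRoot, dVec]
  rw [D.W_fix u (x := dVec) (fun j => rfl), hj] at hd
  have hm : m = 0 := by simpa [form, affRoot, dVec] using hd
  rw [hj, hm]

theorem W_ext {u v : D.W} (h : ∀ i, u.1.1 (D.affRoot i 0) = v.1.1 (D.affRoot i 0)) : u = v := by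
  refine Subtype.ext (Subtype.ext (LinearEquiv.ext fun x => ?_))
  have h1 : ∀ x : ι → ℝ, u.1.1 (emb ι ι' x) = v.1.1 (emb ι ι' x) := by
    intro x
    have hx : x ∈ Submodule.span ℝ (Set.range D.P.root) := by
      have := D.isRootSystem
      rw [RootPairing.IsRootSystem.span_root_eq_top]; trivial
    induction hx using Submodule.span_induction with
    | mem x hx => obtain ⟨i, rfl⟩ := hx; rw [emb_root]; exact h i
    | zero => simp
    | add x y _ _ hx hy => rw [map_add, map_add, map_add, hx, hy]
    | smul r x _ hx => rw [map_smul, map_smul, map_smul, hx]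
  have h2 : ∀ j, (x - emb ι ι' fun j => x.1 (Sum.inl j)).1 (Sum.inl j) = 0 := by
    intro j; simp [emb]
  rw [← sub_add_cancel x (emb ι ι' fun j => x.1 (Sum.inl j)), map_add, map_add, h1,
    D.W_fix u h2, D.W_fix v h2]

/-- The roots span V_s and W fixes V' ⊕ ℝc ⊕ ℝd, so an element of W is determined by its action on
the finitely many root indices. -/
instance W_finite : Finite D.W := by
  choose f hf using D.W_affRoot
  refine Finite.of_injective f fun u v h => D.W_ext fun i => ?_
  rw [hf, hf, h]

/-- Evaluation at d recovers y: W fixes d, and t_y d has V-component y. -/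
theorem t_mul_injective : Function.Injective fun p : D.Y × D.W => D.t p.1 * p.2.1 := by
  rintro ⟨y, u⟩ ⟨y', u'⟩ h
  have h' : D.t y * u.1 = D.t y' * u'.1 := h
  have hd := congrArg (fun w : D.WHat => w.1 dVec) h'
  have h1 : ∀ (y : D.Y) (u : D.W), (D.t y * u.1).1 dVec = transl (y : ι ⊕ ι' → ℝ) dVec := by
    intro y u
    conv_rhs => rw [← D.W_fix u (x := dVec) (fun j => rfl)]
    rfl
  simp only [h1] at hd
  have hy : y = y' := by
    have := congrArg Prod.fst hd
    refine Subtype.ext ?_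
    simpa [transl, translMap, dVec] using this
  subst hy
  have hu : u = u' := Subtype.ext (mul_left_cancel h')
  rw [hu]

/-- `Ŵ^Y` consists of the products `t_y u` with `y ∈ Y` and `u ∈ W`. -/
def prodEquiv : D.Y × D.W ≃ D.WHat :=
  Equiv.ofBijective (fun p => D.t p.1 * p.2.1) ⟨D.t_mul_injective, fun w => by
    obtain ⟨y, u, h⟩ := D.exists_eq_t_mul w
    exact ⟨(y, u), h.symm⟩⟩

theorem prodEquiv_apply (y : D.Y) (u : D.W) : D.prodEquiv (y, u) = D.t y * u.1 := rfl

theorem t_injective : Function.Injective D.t := by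
  intro y y' h
  have := D.t_mul_injective (a₁ := (y, 1)) (a₂ := (y', 1)) (congrArg (· * 1) h)
  exact congrArg Prod.fst this

/-- `Y` as a `ℤ`-submodule of `V`. -/
abbrev YMod : Submodule ℤ (ι ⊕ ι' → ℝ) := AddSubgroup.toIntSubmodule D.Y

instance YMod_discrete : DiscreteTopology D.YMod := D.discrete

/-- A discrete subspace of a separable space is countable. Together with finiteness of W and I, this
makes Baire's theorem applicable to conditions indexed by group elements and roots. -/
instance Y_countable : Countable D.Y := by
  have := D.discrete
  exact TopologicalSpace.separableSpace_iff_countable.mp inferInstance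

instance WHat_countable : Countable D.WHat := D.prodEquiv.symm.injective.countable

instance affRoots_countable : Countable D.affRoots := by
  have : D.affRoots = Set.range fun p : I × ℤ => D.affRoot p.1 p.2 := by
    ext a
    constructor
    · rintro ⟨i, m, rfl⟩; exact ⟨(i, m), rfl⟩
    · rintro ⟨p, rfl⟩; exact ⟨p.1, p.2, rfl⟩
  rw [this]
  exact (Set.countable_range _).to_subtype

end Datum

namespace Datum

variable {I ι ι' : Type*} [Finite I] [Fintype ι] [Fintype ι'] (D : Datum I ι ι')

/-! ### Words and deletions -/

/-- The roots `g₁ ⋯ gᵢ₋₁ aᵢ`, for the positions `i` of a word which hold a simple reflection. -/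
def wordRoots : List D.Letter → List (Hat ℝ (ι ⊕ ι'))
  | [] => []
  | Sum.inl a :: L => a.1 :: (wordRoots L).map (sref a).1
  | Sum.inr ω :: L => (wordRoots L).map ω.1.1

/-- The roots of `wordRoots`, each with the word from which its position is deleted. -/
def deletions : List D.Letter → List (Hat ℝ (ι ⊕ ι') × List D.Letter)
  | [] => []
  | Sum.inl a :: L =>
    (a.1, L) :: (deletions L).map fun p => ((sref a).1 p.1, Sum.inl a :: p.2)
  | Sum.inr ω :: L => (deletions L).map fun p => (ω.1.1 p.1, Sum.inr ω :: p.2)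

theorem deletions_map_fst (L : List D.Letter) :
    (D.deletions L).map Prod.fst = D.wordRoots L := by
  induction L with
  | nil => rfl
  | cons l L ih =>
    cases l <;> simp [deletions, wordRoots, ← ih]

/-- Deleting a_i from g_1 ⋯ g_n amounts to left multiplication by the reflection in g_1 ⋯ g_{i-1}
a_i, because s_{wa} = w s_a w⁻¹. -/
theorem mem_deletions {L : List D.Letter} {p : Hat ℝ (ι ⊕ ι') × List D.Letter}
    (hp : p ∈ D.deletions L) :
    ∃ h : p.1 ∈ D.affRoots, D.wordElt p.2 = D.s ⟨p.1, h⟩ * D.wordElt L := by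
  induction L generalizing p with
  | nil => simp [deletions] at hp
  | cons l L ih =>
    have key : ∀ (w : D.WHat) (p : Hat ℝ (ι ⊕ ι') × List D.Letter),
        (∃ h : p.1 ∈ D.affRoots, D.wordElt p.2 = D.s ⟨p.1, h⟩ * D.wordElt L) →
        ∃ h : w.1 p.1 ∈ D.affRoots,
          w * D.wordElt p.2 = D.s ⟨w.1 p.1, h⟩ * (w * D.wordElt L) := by
      rintro w p ⟨h, h'⟩
      refine ⟨D.WHat_affRoots w h, ?_⟩
      rw [h', D.s_map w ⟨p.1, h⟩]
      group
    cases l with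
    | inl a =>
      simp only [deletions, List.mem_cons, List.mem_map] at hp
      rcases hp with rfl | ⟨q, hq, rfl⟩
      · refine ⟨D.simpleRoots_subset a.2, ?_⟩
        rw [wordElt_cons]
        change _ = sref a * (sref a * _)
        rw [← mul_assoc, sref_mul_self, one_mul]
      · obtain ⟨h, h'⟩ := key (sref a) q (ih hq)
        exact ⟨h, by rw [wordElt_cons, wordElt_cons]; exact h'⟩
    | inr ω =>
      simp only [deletions, List.mem_map] at hp
      obtain ⟨q, hq, rfl⟩ := hp
      obtain ⟨h, h'⟩ := key ω.1 q (ih hq)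
      exact ⟨h, by rw [wordElt_cons, wordElt_cons]; exact h'⟩

theorem wordRoots_subset {L : List D.Letter} {b : Hat ℝ (ι ⊕ ι')} (hb : b ∈ D.wordRoots L) :
    b ∈ D.affRoots := by
  rw [← deletions_map_fst, List.mem_map] at hb
  obtain ⟨p, hp, rfl⟩ := hb
  exact (D.mem_deletions hp).1

open Classical in
/-- The indicator of the positive affine roots. -/
def posInd (b : Hat ℝ (ι ⊕ ι')) : ℤ := if b ∈ D.posRoots then 1 else 0

-- A simple reflection permutes the positive roots other than a, so positivity changes only at a and
-- -a.
open Classical in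
theorem posInd_sub_posInd_refl (a : D.simpleRoots) {b : Hat ℝ (ι ⊕ ι')} (hb : b ∈ D.affRoots) :
    D.posInd b - D.posInd ((sref a).1 b) =
      (if b = a.1 then 1 else 0) - if b = -a.1 then 1 else 0 := by
  have hpa := D.simpleRoots_subset_posRoots a.2
  have hna : -a.1 ≠ a.1 := fun h => D.neg_notMem_posRoots hpa (by rw [h]; exact hpa)
  unfold posInd
  by_cases h1 : b = a.1
  · subst h1
    rw [sref_self, if_pos hpa, if_neg (D.neg_notMem_posRoots hpa), if_pos rfl, if_neg hna.symm]
  by_cases h2 : b = -a.1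
  · subst h2
    rw [map_neg, sref_self, neg_neg, if_pos hpa, if_neg (D.neg_notMem_posRoots hpa), if_pos rfl,
      if_neg hna]
  rw [if_neg h1, if_neg h2]
  rcases D.pos_or_neg hb with hp | hp
  · rw [if_pos hp, if_pos (show (sref a).1 b ∈ D.posRoots from D.refl_mem_posRoots a.2 hp h1)]
    simp
  · have h3 : -(sref a).1 b ∈ D.posRoots := by
      rw [← map_neg]
      exact D.refl_mem_posRoots a.2 hp fun h => h2 (by rw [← h, neg_neg])
    have h4 : (sref a).1 b ∉ D.posRoots := fun h => D.neg_notMem_posRoots h h3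
    have h5 : b ∉ D.posRoots := fun h => D.neg_notMem_posRoots h hp
    rw [if_neg h4, if_neg h5]

/-- Ω is defined by an inclusion, but a positive b with ω⁻¹b negative would contradict it; the
inclusion is therefore an equivalence. -/
theorem omega_inv {ω : D.WHat} (hω : ω ∈ D.Ω) {b : Hat ℝ (ι ⊕ ι')} (hb : b ∈ D.affRoots) :
    (ω⁻¹).1 b ∈ D.posRoots ↔ b ∈ D.posRoots := by
  have hb' := D.WHat_affRoots ω⁻¹ hb
  constructor
  · intro h
    have := hω _ h
    rwa [WHat_apply_inv] at this
  · intro h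
    refine (D.pos_or_neg hb').resolve_right fun h' => ?_
    have := hω _ h'
    rw [map_neg, WHat_apply_inv] at this
    exact D.neg_notMem_posRoots h this

open Classical in
theorem count_map_WHat (w : D.WHat) (b : Hat ℝ (ι ⊕ ι')) (l : List (Hat ℝ (ι ⊕ ι'))) :
    (l.map w.1).count b = l.count ((w⁻¹).1 b) := by
  conv_lhs => rw [← D.WHat_apply_inv w b]
  exact List.count_map_of_injective _ _ w.1.injective _

-- The signed multiplicity of b among the roots of a word telescopes along the letters. The right
-- side does not involve the word beyond its group element, which is the point.
open Classical in
theorem count_wordRoots (L : List D.Letter) {b : Hat ℝ (ι ⊕ ι')} (hb : b ∈ D.affRoots) :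
    ((D.wordRoots L).count b : ℤ) - (D.wordRoots L).count (-b) =
      D.posInd b - D.posInd (((D.wordElt L)⁻¹).1 b) := by
  induction L generalizing b with
  | nil =>
    have : ((D.wordElt [])⁻¹).1 b = b := by rw [wordElt_nil, inv_one]; rfl
    rw [this]; simp [wordRoots]
  | cons l L ih =>
    have hmul : ((D.wordElt (l :: L))⁻¹).1 b = ((D.wordElt L)⁻¹).1 ((l.elt⁻¹).1 b) := by
      rw [wordElt_cons, mul_inv_rev]; rfl
    have hb' := D.WHat_affRoots l.elt⁻¹ hb
    have := ih hb'
    rw [hmul]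
    cases l with
    | inl a =>
      have hinv : (Letter.elt (Sum.inl a) : D.WHat)⁻¹ = sref a := D.s_inv _
      rw [hinv] at this ⊢
      have h1 := D.posInd_sub_posInd_refl a hb
      have hs : ((sref a)⁻¹ : D.WHat) = sref a := D.s_inv _
      rw [wordRoots, List.count_cons, List.count_cons, count_map_WHat, count_map_WHat, hs, map_neg]
      have e1 : (a.1 == b) = decide (b = a.1) := by
        rw [Bool.eq_iff_iff, beq_iff_eq, decide_eq_true_iff]; exact eq_comm
      have e2 : (a.1 == -b) = decide (b = -a.1) := by
        rw [Bool.eq_iff_iff, beq_iff_eq, decide_eq_true_iff]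
        exact ⟨fun h => by rw [h, neg_neg], fun h => by rw [h, neg_neg]⟩
      rw [e1, e2]
      simp only [decide_eq_true_eq]
      rw [Nat.cast_add, Nat.cast_add, Nat.cast_ite, Nat.cast_ite, Nat.cast_zero, Nat.cast_one]
      linarith
    | inr ω =>
      rw [wordRoots, count_map_WHat, count_map_WHat, map_neg]
      have h1 : D.posInd ((ω.1⁻¹).1 b) = D.posInd b := by
        unfold posInd
        simp only [D.omega_inv ω.2 hb]
      rw [← h1]
      exact this

/-- Sums of odd functions over the roots of a word depend only on the group element. -/
theorem sum_wordRoots_eq {L L' : List D.Letter} (hL : D.wordElt L = D.wordElt L')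
    {h : Hat ℝ (ι ⊕ ι') → ℂ} (hodd : ∀ b ∈ D.affRoots, h (-b) = -h b) :
    ((D.wordRoots L).map h).sum = ((D.wordRoots L').map h).sum := by
  classical
  -- Comparing the roots of L together with the negated roots of L' to the opposite arrangement
  -- turns the equality of signed multiplicities into a permutation of lists.
  have hperm : (D.wordRoots L ++ (D.wordRoots L').map (fun b => -b)).Perm
      (D.wordRoots L' ++ (D.wordRoots L).map (fun b => -b)) := by
    refine List.perm_iff_count.mpr fun b => ?_
    have hneg : ∀ l : List (Hat ℝ (ι ⊕ ι')), (l.map fun b => -b).count b = l.count (-b) := by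
      intro l
      conv_lhs => rw [← neg_neg b]
      exact List.count_map_of_injective _ (fun b => -b) neg_injective _
    rw [List.count_append, List.count_append, hneg, hneg]
    by_cases hb : b ∈ D.affRoots
    · have h1 := D.count_wordRoots L hb
      have h2 := D.count_wordRoots L' hb
      rw [hL, ← h2] at h1
      omega
    · have h0 : ∀ M, (D.wordRoots M).count b = 0 := fun M =>
        List.count_eq_zero_of_not_mem fun h => hb (D.wordRoots_subset h)
      have h0' : ∀ M, (D.wordRoots M).count (-b) = 0 := fun M =>
        List.count_eq_zero_of_not_mem fun h => hb (by
          have := D.neg_mem_affRoots (D.wordRoots_subset h)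
          rwa [neg_neg] at this)
      rw [h0, h0', h0, h0']
  have hsum := (hperm.map h).sum_eq
  have hneg : ∀ M, (((D.wordRoots M).map fun b => -b).map h).sum =
      -((D.wordRoots M).map h).sum := by
    intro M
    have hM : ∀ b ∈ D.wordRoots M, b ∈ D.affRoots := fun b hb => D.wordRoots_subset hb
    generalize D.wordRoots M = N at hM
    induction N with
    | nil => simp
    | cons b N ih =>
      simp only [List.map_cons, List.sum_cons, neg_add]
      rw [hodd b (hM b (by simp)), ih fun c hc => hM c (by simp [hc])]
  rw [List.map_append, List.map_append, List.sum_append, List.sum_append, hneg, hneg] at hsum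
  linear_combination hsum / 2

/-! ### The operators attached to words -/

section Operators

variable (k : Hat ℝ (ι ⊕ ι') → ℂ) (z : Hat ℂ (ι ⊕ ι'))

/-- The operator of a letter on the span of the orbit points `wz`, `w ∈ Ŵ^Y`. -/
def letterOp : D.Letter → Module.End ℂ (D.WHat →₀ ℂ)
  | Sum.inl a => Finsupp.linearCombination ℂ fun w =>
      Finsupp.single (sref a * w) (1 - k a.1 / xval a.1 (cAct w.1 z)) -
        Finsupp.single w (k a.1 / xval a.1 (cAct w.1 z))
  | Sum.inr ω => Finsupp.linearCombination ℂ fun w => Finsupp.single (ω.1 * w) 1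

/-- The operator of a word. -/
def wordOp (L : List D.Letter) : Module.End ℂ (D.WHat →₀ ℂ) := (L.map (D.letterOp k z)).prod

theorem wordOp_cons (l : D.Letter) (L : List D.Letter) :
    D.wordOp k z (l :: L) = D.letterOp k z l * D.wordOp k z L := by simp [wordOp]

theorem wordOp_append (L L' : List D.Letter) :
    D.wordOp k z (L ++ L') = D.wordOp k z L * D.wordOp k z L' := by simp [wordOp]

/-- Multiplication by the linear function `(f, ·)` on the orbit of `z`. -/
def mulOp (f : Hat ℂ (ι ⊕ ι')) : Module.End ℂ (D.WHat →₀ ℂ) :=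
  Finsupp.linearCombination ℂ fun w => Finsupp.single w (form f (cAct w.1 z))

/-- The determinant of an element of `Ŵ^Y`. -/
def sgn (w : D.WHat) : ℂ := ((LinearMap.det (w.1 : Hat ℝ (ι ⊕ ι') →ₗ[ℝ] Hat ℝ (ι ⊕ ι')) : ℝ) : ℂ)

theorem sgn_mul (u w : D.WHat) : D.sgn (u * w) = D.sgn u * D.sgn w := by
  have : ((u * w).1 : Hat ℝ (ι ⊕ ι') →ₗ[ℝ] Hat ℝ (ι ⊕ ι')) =
      (u.1 : Hat ℝ (ι ⊕ ι') →ₗ[ℝ] Hat ℝ (ι ⊕ ι')) * w.1 := rfl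
  rw [sgn, sgn, sgn, this, map_mul, Complex.ofReal_mul]

theorem sgn_sref (a : D.simpleRoots) : D.sgn (sref a) = -1 := by
  rw [sgn, sref_coe, det_refl (D.form_affRoot_ne (D.simpleRoots_subset a.2))]
  simp

theorem sgn_ne_zero (w : D.WHat) : D.sgn w ≠ 0 := by
  have h1 : D.sgn 1 = 1 := by
    have : ((1 : D.WHat).1 : Hat ℝ (ι ⊕ ι') →ₗ[ℝ] Hat ℝ (ι ⊕ ι')) = 1 := rfl
    rw [sgn, this, map_one, Complex.ofReal_one]
  have := D.sgn_mul w w⁻¹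
  rw [mul_inv_cancel, h1] at this
  exact left_ne_zero_of_mul (this ▸ one_ne_zero)

/-- The functional with the values `det w` at the orbit points. -/
def sgnFun : (D.WHat →₀ ℂ) →ₗ[ℂ] ℂ := Finsupp.linearCombination ℂ D.sgn

/-- For a reflection, -(1 - k/x) - k/x = -1: the dependence on k and on the point cancels. -/
theorem sgnFun_letterOp (l : D.Letter) :
    D.sgnFun ∘ₗ D.letterOp k z l = D.sgn l.elt • D.sgnFun := by
  refine Finsupp.lhom_ext' fun w => LinearMap.ext_ring ?_
  cases l with
  | inl a =>
    simp only [letterOp, sgnFun, LinearMap.comp_apply, Finsupp.lsingle_apply,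
      Finsupp.linearCombination_single, one_smul, map_sub, LinearMap.smul_apply, smul_eq_mul,
      Letter.elt, sgn_mul, sgn_sref]
    ring
  | inr ω =>
    simp only [letterOp, sgnFun, LinearMap.comp_apply, Finsupp.lsingle_apply,
      Finsupp.linearCombination_single, one_smul, LinearMap.smul_apply, smul_eq_mul,
      Letter.elt, sgn_mul]
    ring

theorem sgnFun_wordOp (L : List D.Letter) :
    D.sgnFun ∘ₗ D.wordOp k z L = D.sgn (D.wordElt L) • D.sgnFun := by
  induction L with
  | nil =>
    have h1 : D.sgn 1 = 1 := by
      have := D.sgn_mul 1 1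
      rw [mul_one] at this
      exact (mul_eq_left₀ (D.sgn_ne_zero 1)).mp this.symm
    rw [wordElt_nil, h1, one_smul]; rfl
  | cons l L ih =>
    rw [wordOp_cons, wordElt_cons, sgn_mul, mul_smul, ← ih, Module.End.mul_eq_comp,
      ← LinearMap.comp_assoc, sgnFun_letterOp, LinearMap.smul_comp]

variable {k z}

theorem form_cAct_eq (w : D.WHat) (f x : Hat ℂ (ι ⊕ ι')) :
    form f (cAct w.1 x) = form (cAct (w⁻¹).1 f) x := by
  rw [← form_cAct (D.form_WHat w⁻¹) f, ← cAct_WHat_mul, inv_mul_cancel]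
  rw [show ((1 : D.WHat).1) = 1 from rfl, cAct_one]

theorem mulOp_omega (f : Hat ℂ (ι ⊕ ι')) (ω : D.Ω) :
    D.mulOp z f * D.letterOp k z (Sum.inr ω) =
      D.letterOp k z (Sum.inr ω) * D.mulOp z (cAct (ω.1⁻¹).1 f) := by
  refine Finsupp.lhom_ext' fun w => LinearMap.ext_ring ?_
  simp only [mulOp, letterOp, LinearMap.comp_apply, Finsupp.lsingle_apply, Module.End.mul_apply,
    Finsupp.linearCombination_single, one_smul, cAct_WHat_mul, D.form_cAct_eq ω.1,
    Finsupp.smul_single, smul_eq_mul, mul_one]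

theorem form_sub_form_sref (a : D.simpleRoots) (f x : Hat ℂ (ι ⊕ ι')) :
    form f x - form f (cAct (sref a).1 x) = xval a.1 x * form f (toC a.1) := by
  rw [sref_coe, cAct_refl, form_sub_right, form_smul_right, xval]; ring

/-- This is the cross relation of the degenerate double affine Hecke algebra. At x = wz the
difference (f, x) - (f, s_a x) equals (a^∨, x)(f, a), whose first factor cancels the denominator,
leaving a scalar operator. -/
theorem mulOp_sref (hz : z ∈ D.reg k) (hk : D.IsMultiplicity k) (f : Hat ℂ (ι ⊕ ι'))
    (a : D.simpleRoots) :
    D.mulOp z f * D.letterOp k z (Sum.inl a) + (k a.1 * form f (toC a.1)) • 1 =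
      D.letterOp k z (Sum.inl a) * D.mulOp z (cAct (sref a).1 f) := by
  refine Finsupp.lhom_ext' fun w => LinearMap.ext_ring ?_
  have hs : ((sref a)⁻¹ : D.WHat) = sref a := D.s_inv _
  have hx : xval a.1 (cAct w.1 z) ≠ 0 :=
    (reg_cAct hk w hz a.1 (D.simpleRoots_subset a.2)).1
  have h1 := D.form_sub_form_sref a f (cAct w.1 z)
  have h2 : form (cAct (sref a).1 f) (cAct w.1 z) = form f (cAct (sref a).1 (cAct w.1 z)) := by
    rw [D.form_cAct_eq (sref a), hs]
  simp only [mulOp, letterOp, LinearMap.comp_apply, Finsupp.lsingle_apply, Module.End.mul_apply,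
    Finsupp.linearCombination_single, one_smul, cAct_WHat_mul, map_sub, Finsupp.smul_single,
    LinearMap.add_apply, LinearMap.smul_apply, Module.End.one_apply, smul_eq_mul, mul_one,
    smul_sub, h2]
  rw [sub_add, ← Finsupp.single_sub, mul_comm (1 - _) _]
  congr 2
  field_simp
  linear_combination (k a.1) * h1

/-- The cross relation, iterated: moving f through the word leaves, for each reflection letter, the
operator of the word with that letter deleted. -/
theorem mulOp_wordOp (hz : z ∈ D.reg k) (hk : D.IsMultiplicity k) (f : Hat ℂ (ι ⊕ ι'))
    (L : List D.Letter) :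
    D.mulOp z f * D.wordOp k z L + ((D.deletions L).map fun p =>
        (k p.1 * form f (toC p.1)) • D.wordOp k z p.2).sum =
      D.wordOp k z L * D.mulOp z (cAct ((D.wordElt L)⁻¹).1 f) := by
  induction L generalizing f with
  | nil =>
    rw [wordElt_nil, inv_one, show ((1 : D.WHat).1) = 1 from rfl, cAct_one]
    simp [wordOp, deletions]
  | cons l L ih =>
    have hmul : cAct ((D.wordElt (l :: L))⁻¹).1 f =
        cAct ((D.wordElt L)⁻¹).1 (cAct (l.elt⁻¹).1 f) := by
      rw [wordElt_cons, mul_inv_rev, cAct_WHat_mul]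
    -- Prefixing a letter with element w replaces each root b by wb; invariance of k and of the form
    -- preserves the coefficients.
    have hdel : ∀ w : D.WHat, ∀ l : D.Letter, w = l.elt →
        D.letterOp k z l * ((D.deletions L).map fun p =>
          (k p.1 * form (cAct (w⁻¹).1 f) (toC p.1)) • D.wordOp k z p.2).sum =
        (((D.deletions L).map fun p => (w.1 p.1, l :: p.2)).map fun p =>
          (k p.1 * form f (toC p.1)) • D.wordOp k z p.2).sum := by
      rintro w l rfl
      rw [← List.sum_map_mul_left, List.map_map]
      congr 1
      refine List.map_congr_left fun p hp => ?_
      obtain ⟨hpa, -⟩ := D.mem_deletions hp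
      simp only [Function.comp_apply, wordOp_cons, mul_smul_comm]
      rw [hk _ _ hpa, ← form_cAct_eq, cAct_toC]
    rw [hmul, wordOp_cons, mul_assoc (D.letterOp k z l), ← ih, mul_add, ← mul_assoc, ← mul_assoc]
    cases l with
    | inl a =>
      have hs : ((sref a)⁻¹ : D.WHat) = sref a := D.s_inv _
      have hd := hdel (sref a) (Sum.inl a) rfl
      have he : (Letter.elt (Sum.inl a) : D.WHat)⁻¹ = sref a := hs
      rw [hs] at hd
      rw [he, ← D.mulOp_sref hz hk, hd]
      simp only [deletions, List.map_cons, List.sum_cons]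
      rw [add_mul, smul_mul_assoc, one_mul, add_assoc]
    | inr ω =>
      have he : (Letter.elt (Sum.inr ω) : D.WHat)⁻¹ = ω.1⁻¹ := rfl
      rw [he, ← D.mulOp_omega, hdel ω.1 (Sum.inr ω) rfl]
      rfl

variable (k z)

/-- The functionals `A` for which `A ∘ wordOp L` depends only on the element that `L`
represents. -/
def wordFun : Submodule ℂ ((D.WHat →₀ ℂ) →ₗ[ℂ] ℂ) where
  carrier := {A | ∀ L L', D.wordElt L = D.wordElt L' →
    A ∘ₗ D.wordOp k z L = A ∘ₗ D.wordOp k z L'}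
  add_mem' hA hB L L' h := by rw [LinearMap.add_comp, LinearMap.add_comp, hA L L' h, hB L L' h]
  zero_mem' L L' _ := by rw [LinearMap.zero_comp, LinearMap.zero_comp]
  smul_mem' c A hA L L' h := by rw [LinearMap.smul_comp, LinearMap.smul_comp, hA L L' h]

theorem sgnFun_mem : D.sgnFun ∈ D.wordFun k z := by
  intro L L' h
  rw [sgnFun_wordOp, sgnFun_wordOp, h]

variable {k z}

/-- A deleted word represents s_b w, and A only sees this element. The corrections are thus a sum
over the roots b of k_b (f, b) F(s_b w), which is odd in b since k_b and s_b are even; so this sum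
depends only on w. -/
theorem comp_mulOp_mem (hz : z ∈ D.reg k) (hk : D.IsMultiplicity k) (f : Hat ℂ (ι ⊕ ι'))
    {A : (D.WHat →₀ ℂ) →ₗ[ℂ] ℂ} (hA : A ∈ D.wordFun k z) :
    A ∘ₗ D.mulOp z f ∈ D.wordFun k z := by
  classical
  intro L L' h
  refine LinearMap.ext fun x => ?_
  -- The value of A on word operators, as a function on the group; the hypothesis on A makes the
  -- choice of word irrelevant.
  let F : D.WHat → ℂ := fun w => A (D.wordOp k z (D.exists_word w).choose x)
  have hF : ∀ M, A (D.wordOp k z M x) = F (D.wordElt M) := fun M =>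
    LinearMap.congr_fun (hA _ _ (D.exists_word (D.wordElt M)).choose_spec.symm) x
  have key : ∀ M, A (D.mulOp z f (D.wordOp k z M x)) =
      A (D.wordOp k z M (D.mulOp z (cAct ((D.wordElt M)⁻¹).1 f) x)) -
        ((D.wordRoots M).map fun b => if hb : b ∈ D.affRoots then
          k b * form f (toC b) * F (D.s ⟨b, hb⟩ * D.wordElt M) else 0).sum := by
    intro M
    have := LinearMap.congr_fun (D.mulOp_wordOp hz hk f M) x
    rw [LinearMap.add_apply, Module.End.mul_apply, Module.End.mul_apply] at this
    rw [← this, map_add, ← deletions_map_fst, List.map_map, eq_sub_iff_add_eq]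
    congr 1
    have hev : ∀ l : List (Module.End ℂ (D.WHat →₀ ℂ)),
        A (l.sum x) = (l.map fun T => A (T x)).sum := by
      intro l
      induction l with
      | nil => simp
      | cons T l ih => simp [ih]
    rw [hev, List.map_map]
    congr 1
    refine List.map_congr_left fun p hp => ?_
    obtain ⟨hpa, hpe⟩ := D.mem_deletions hp
    simp only [Function.comp_apply, LinearMap.smul_apply, map_smul, smul_eq_mul]
    rw [dif_pos hpa, hF, hpe]
  change A (D.mulOp z f (D.wordOp k z L x)) = A (D.mulOp z f (D.wordOp k z L' x))
  rw [key, key, h]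
  congr 1
  · exact LinearMap.congr_fun (hA L L' h) _
  · refine D.sum_wordRoots_eq h fun b hb => ?_
    rw [dif_pos hb, dif_pos (D.neg_mem_affRoots hb), hk.neg hb, toC_neg, form_comm, form_neg_left,
      form_comm, D.s_neg ⟨b, hb⟩]
    ring

theorem exists_form_ne {κ : Type*} [Fintype κ] {x : Hat ℂ κ} (hx : x ≠ 0) :
    ∃ f : Hat ℂ κ, form f x ≠ 0 := by
  classical
  by_contra! h
  refine hx (Prod.ext ?_ (Prod.ext ?_ ?_))
  · funext j
    have := h (Pi.single j 1, 0, 0)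
    simpa [form] using this
  · simpa [form] using h (0, 0, 1)
  · simpa [form] using h (0, 1, 0)

theorem mulOp_single (f : Hat ℂ (ι ⊕ ι')) (w : D.WHat) (c : ℂ) :
    D.mulOp z f (Finsupp.single w c) = form f (cAct w.1 z) • Finsupp.single w c := by
  simp [mulOp, mul_comm]

/-- Lagrange interpolation starting from the sign functional: multiplication by f - (f, uz) kills
e_u, and since w₀z ≠ uz some f keeps the coefficient at e_{w₀} nonzero. -/
theorem exists_wordFun (hz : z ∈ D.reg k) (hk : D.IsMultiplicity k)
    (hfree : ∀ w : D.WHat, cAct w.1 z = z → w = 1) (w₀ : D.WHat) (S : Finset D.WHat)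
    (hS : w₀ ∉ S) :
    ∃ A ∈ D.wordFun k z, A (Finsupp.single w₀ 1) ≠ 0 ∧ ∀ w ∈ S, A (Finsupp.single w 1) = 0 := by
  classical
  induction S using Finset.induction_on with
  | empty =>
    refine ⟨D.sgnFun, D.sgnFun_mem k z, ?_, by simp⟩
    simpa [sgnFun] using D.sgn_ne_zero w₀
  | insert u S hu ih =>
    rw [Finset.mem_insert, not_or] at hS
    obtain ⟨A, hA, h0, h1⟩ := ih hS.2
    have hne : cAct w₀.1 z - cAct u.1 z ≠ 0 := by
      intro h
      have h' : cAct (u⁻¹ * w₀).1 z = z := by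
        rw [cAct_WHat_mul, sub_eq_zero.mp h, ← cAct_WHat_mul, inv_mul_cancel]
        exact cAct_one z
      exact hS.1 (inv_mul_eq_one.mp (hfree _ h')).symm
    obtain ⟨f, hf⟩ := exists_form_ne hne
    rw [form_sub_right] at hf
    refine ⟨A ∘ₗ D.mulOp z f - form f (cAct u.1 z) • A,
      sub_mem (D.comp_mulOp_mem hz hk f hA) (Submodule.smul_mem _ _ hA), ?_, ?_⟩
    · rw [LinearMap.sub_apply, LinearMap.comp_apply, mulOp_single, map_smul, LinearMap.smul_apply,
        ← sub_smul]
      exact smul_ne_zero hf h0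
    · intro w hw
      rw [LinearMap.sub_apply, LinearMap.comp_apply, mulOp_single, map_smul, LinearMap.smul_apply,
        ← sub_smul]
      rcases Finset.mem_insert.mp hw with rfl | hw
      · rw [sub_self, zero_smul]
      · rw [h1 w hw, smul_zero]

/-- If the stabilizer of `z` is trivial, then the operator of a word depends only on the group
element. -/
theorem wordOp_eq (hz : z ∈ D.reg k) (hk : D.IsMultiplicity k)
    (hfree : ∀ w : D.WHat, cAct w.1 z = z → w = 1) {L L' : List D.Letter}
    (h : D.wordElt L = D.wordElt L') : D.wordOp k z L = D.wordOp k z L' := by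
  classical
  refine LinearMap.ext fun x => sub_eq_zero.mp ?_
  set v := D.wordOp k z L x - D.wordOp k z L' x with hv
  by_contra hne
  obtain ⟨w₀, hw₀⟩ := Finsupp.support_nonempty_iff.mpr hne
  -- A functional that vanishes on the rest of the support isolates one nonzero coefficient of the
  -- difference, although A takes equal values on both words.
  obtain ⟨A, hA, h0, h1⟩ := D.exists_wordFun hz hk hfree w₀ (v.support.erase w₀) (by simp)
  have hAv : A v = v w₀ • A (Finsupp.single w₀ 1) := by
    conv_lhs => rw [← Finsupp.sum_single v, Finsupp.sum, map_sum]
    rw [Finset.sum_eq_single w₀]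
    · rw [← map_smul]; simp
    · intro w hw hne'
      have := h1 w (Finset.mem_erase.mpr ⟨hne', hw⟩)
      rw [← mul_one (v w), ← smul_eq_mul, ← Finsupp.smul_single, map_smul, this, smul_zero]
    · intro h; exact absurd hw₀ h
  have hA0 : A v = 0 := by
    have := LinearMap.congr_fun (hA L L' h) x
    rw [hv, map_sub, sub_eq_zero]
    exact this
  rw [hA0] at hAv
  exact smul_ne_zero (Finsupp.mem_support_iff.mp hw₀) h0 hAv.symm

end Operators

end Datum

namespace Datum

variable {I ι ι' : Type*} [Finite I] [Fintype ι] [Fintype ι'] (D : Datum I ι ι')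

/-! ### The cocycle along words -/

section WordCocycle

variable (k : Hat ℝ (ι ⊕ ι') → ℂ)

/-- The value of the cocycle at a letter. -/
def letterJ (z : Hat ℂ (ι ⊕ ι')) : D.Letter → MonoidAlgebra ℂ D.WHat
  | Sum.inl a => (xval a.1 z - k a.1)⁻¹ •
      (xval a.1 z • MonoidAlgebra.of ℂ D.WHat (sref a) + k a.1 • 1)
  | Sum.inr ω => MonoidAlgebra.of ℂ D.WHat ω.1

/-- The value of the cocycle along a word. -/
def wordJ (z : Hat ℂ (ι ⊕ ι')) : List D.Letter → MonoidAlgebra ℂ D.WHat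
  | [] => 1
  | l :: L => D.letterJ k (cAct (D.wordElt L).1 z) l * wordJ z L

/-- The cocycle rule at the level of words, where it holds by construction. -/
theorem wordJ_append (z : Hat ℂ (ι ⊕ ι')) (L L' : List D.Letter) :
    D.wordJ k z (L ++ L') = D.wordJ k (cAct (D.wordElt L').1 z) L * D.wordJ k z L' := by
  induction L with
  | nil => simp [wordJ]
  | cons l L ih =>
    rw [List.cons_append, wordJ, wordJ, ih, mul_assoc, wordElt_append, cAct_WHat_mul]

/-- The group elements represented by the subwords of a word. -/
def subwordElts (L : List D.Letter) : Set D.WHat := {w | ∃ L', L'.Sublist L ∧ D.wordElt L' = w}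

theorem subwordElts_finite (L : List D.Letter) : (D.subwordElts L).Finite := by
  refine ((List.finite_toSet L.sublists).image D.wordElt).subset ?_
  rintro w ⟨L', h, rfl⟩
  exact ⟨L', List.mem_sublists.mpr h, rfl⟩

theorem subwordElts_mono {L L' : List D.Letter} (h : L'.Sublist L) :
    D.subwordElts L' ⊆ D.subwordElts L := by
  rintro w ⟨M, hM, rfl⟩
  exact ⟨M, hM.trans h, rfl⟩

theorem mul_mem_subwordElts {l : D.Letter} {L : List D.Letter} {w : D.WHat}
    (h : w ∈ D.subwordElts L) : l.elt * w ∈ D.subwordElts (l :: L) := by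
  obtain ⟨M, hM, rfl⟩ := h
  exact ⟨l :: M, hM.cons_cons l, D.wordElt_cons l M⟩

/-- The span in the group algebra of the elements represented by subwords of `L`. -/
def subwordSpan (L : List D.Letter) : Submodule ℂ (MonoidAlgebra ℂ D.WHat) :=
  Submodule.span ℂ (MonoidAlgebra.of ℂ D.WHat '' D.subwordElts L)

theorem subwordSpan_mono {L L' : List D.Letter} (h : L'.Sublist L) :
    D.subwordSpan L' ≤ D.subwordSpan L :=
  Submodule.span_mono (Set.image_mono (D.subwordElts_mono h))

theorem of_mul_mem_subwordSpan {l : D.Letter} {L : List D.Letter} {x : MonoidAlgebra ℂ D.WHat}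
    (hx : x ∈ D.subwordSpan L) : MonoidAlgebra.of ℂ D.WHat l.elt * x ∈ D.subwordSpan (l :: L) := by
  induction hx using Submodule.span_induction with
  | mem x hx =>
    obtain ⟨w, hw, rfl⟩ := hx
    rw [← map_mul]
    exact Submodule.subset_span ⟨_, D.mul_mem_subwordElts hw, rfl⟩
  | zero => rw [mul_zero]; exact zero_mem _
  | add x y _ _ hx hy => rw [mul_add]; exact add_mem hx hy
  | smul c x _ hx => rw [mul_smul_comm]; exact Submodule.smul_mem _ _ hx

theorem wordJ_mem_subwordSpan (z : Hat ℂ (ι ⊕ ι')) (L : List D.Letter) :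
    D.wordJ k z L ∈ D.subwordSpan L := by
  induction L with
  | nil =>
    refine Submodule.subset_span ⟨1, ⟨[], List.Sublist.refl _, rfl⟩, ?_⟩
    rw [map_one]; rfl
  | cons l L ih =>
    have h1 := D.of_mul_mem_subwordSpan (l := l) ih
    have h2 := D.subwordSpan_mono (List.sublist_cons_self l L) ih
    cases l with
    | inl a =>
      rw [wordJ, letterJ, smul_mul_assoc, add_mul, smul_mul_assoc, smul_mul_assoc, one_mul]
      exact Submodule.smul_mem _ _ (add_mem (Submodule.smul_mem _ _ h1) (Submodule.smul_mem _ _ h2))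
    | inr ω => exact h1

/-- The span of the orbit points represented by subwords of `L`. -/
def subwordPoints (L : List D.Letter) : Submodule ℂ (D.WHat →₀ ℂ) :=
  Submodule.span ℂ ((fun w => Finsupp.single w 1) '' D.subwordElts L)

theorem single_mem_subwordPoints {L : List D.Letter} {w : D.WHat} (hw : w ∈ D.subwordElts L)
    (c : ℂ) : Finsupp.single w c ∈ D.subwordPoints L := by
  rw [← mul_one c, ← smul_eq_mul, ← Finsupp.smul_single]
  exact Submodule.smul_mem _ _ (Submodule.subset_span ⟨w, hw, rfl⟩)

theorem subwordPoints_mono {L L' : List D.Letter} (h : L'.Sublist L) :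
    D.subwordPoints L' ≤ D.subwordPoints L :=
  Submodule.span_mono (Set.image_mono (D.subwordElts_mono h))

theorem letterOp_mem_subwordPoints {z : Hat ℂ (ι ⊕ ι')} {l : D.Letter} {L : List D.Letter}
    {x : D.WHat →₀ ℂ} (hx : x ∈ D.subwordPoints L) :
    D.letterOp k z l x ∈ D.subwordPoints (l :: L) := by
  induction hx using Submodule.span_induction with
  | mem x hx =>
    obtain ⟨w, hw, rfl⟩ := hx
    have h1 := D.mul_mem_subwordElts (l := l) hw
    have h2 := D.subwordElts_mono (List.sublist_cons_self l L) hw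
    cases l with
    | inl a =>
      simp only [letterOp, Finsupp.linearCombination_single, one_smul]
      exact sub_mem (D.single_mem_subwordPoints h1 _) (D.single_mem_subwordPoints h2 _)
    | inr ω =>
      simp only [letterOp, Finsupp.linearCombination_single, one_smul]
      exact D.single_mem_subwordPoints h1 _
  | zero => rw [map_zero]; exact zero_mem _
  | add x y _ _ hx hy => rw [map_add]; exact add_mem hx hy
  | smul c x _ hx => rw [map_smul]; exact Submodule.smul_mem _ _ hx

theorem wordOp_mem_subwordPoints (z : Hat ℂ (ι ⊕ ι')) (L : List D.Letter) :
    D.wordOp k z L (Finsupp.single 1 1) ∈ D.subwordPoints L := by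
  induction L with
  | nil => exact D.single_mem_subwordPoints ⟨[], List.Sublist.refl _, rfl⟩ 1
  | cons l L ih =>
    rw [wordOp_cons, Module.End.mul_apply]
    exact D.letterOp_mem_subwordPoints k ih

variable {k} {z : Hat ℂ (ι ⊕ ι')}

/-- The representation of `Ŵ^Y` by word operators, for `z` with trivial stabilizer. -/
def wordRep (hz : z ∈ D.reg k) (hk : D.IsMultiplicity k)
    (hfree : ∀ w : D.WHat, cAct w.1 z = z → w = 1) : Representation ℂ D.WHat (D.WHat →₀ ℂ) where
  toFun w := D.wordOp k z (D.exists_word w).choose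
  map_one' := by
    rw [D.wordOp_eq hz hk hfree (L' := []) (D.exists_word 1).choose_spec]; rfl
  map_mul' u w := by
    rw [← wordOp_append]
    refine D.wordOp_eq hz hk hfree ?_
    rw [wordElt_append, (D.exists_word _).choose_spec, (D.exists_word _).choose_spec,
      (D.exists_word _).choose_spec]

theorem wordRep_wordElt (hz : z ∈ D.reg k) (hk : D.IsMultiplicity k)
    (hfree : ∀ w : D.WHat, cAct w.1 z = z → w = 1) (L : List D.Letter) :
    D.wordRep hz hk hfree (D.wordElt L) = D.wordOp k z L :=
  D.wordOp_eq hz hk hfree (D.exists_word _).choose_spec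

theorem wordRep_elt (hz : z ∈ D.reg k) (hk : D.IsMultiplicity k)
    (hfree : ∀ w : D.WHat, cAct w.1 z = z → w = 1) (l : D.Letter) :
    D.wordRep hz hk hfree l.elt = D.letterOp k z l := by
  have := D.wordRep_wordElt hz hk hfree [l]
  simpa [wordElt, wordOp] using this

/-- The orbit map `x ↦ x e₁` of the representation by word operators. -/
def orbitMap (hz : z ∈ D.reg k) (hk : D.IsMultiplicity k)
    (hfree : ∀ w : D.WHat, cAct w.1 z = z → w = 1) :
    MonoidAlgebra ℂ D.WHat →ₗ[ℂ] D.WHat →₀ ℂ :=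
  LinearMap.applyₗ (Finsupp.single 1 1) ∘ₗ (D.wordRep hz hk hfree).asAlgebraHom.toLinearMap

theorem orbitMap_apply (hz : z ∈ D.reg k) (hk : D.IsMultiplicity k)
    (hfree : ∀ w : D.WHat, cAct w.1 z = z → w = 1) (x : MonoidAlgebra ℂ D.WHat) :
    D.orbitMap hz hk hfree x = (D.wordRep hz hk hfree).asAlgebraHom x (Finsupp.single 1 1) := rfl

/-- With x = (a^∨, wz), the element x s_a + k sends e_w to (x - k) e_{s_a w}, since the two
multiples of e_w cancel; the denominator x - k normalizes this. -/
theorem asAlgebraHom_letterJ (hz : z ∈ D.reg k) (hk : D.IsMultiplicity k)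
    (hfree : ∀ w : D.WHat, cAct w.1 z = z → w = 1) (l : D.Letter) (w : D.WHat) :
    (D.wordRep hz hk hfree).asAlgebraHom (D.letterJ k (cAct w.1 z) l) (Finsupp.single w 1) =
      Finsupp.single (l.elt * w) 1 := by
  have h1 := D.wordRep_elt hz hk hfree l
  cases l with
  | inl a =>
    obtain ⟨hx, hx'⟩ := reg_cAct hk w hz a.1 (D.simpleRoots_subset a.2)
    change xval a.1 (cAct w.1 z) ≠ 0 at hx
    change xval a.1 (cAct w.1 z) ≠ k a.1 at hx'
    have h2 : (D.wordRep hz hk hfree) (sref a) = D.letterOp k z (Sum.inl a) := h1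
    simp only [letterJ, map_smul, map_add, map_one, Representation.asAlgebraHom_of, h2,
      LinearMap.smul_apply, LinearMap.add_apply, Module.End.one_apply]
    simp only [letterOp, Finsupp.linearCombination_single, one_smul, smul_sub, smul_add,
      Finsupp.smul_single, smul_eq_mul, mul_one, Letter.elt]
    rw [sub_add, ← Finsupp.single_sub]
    have h3 := sub_ne_zero.mpr hx'
    have e1 : (xval a.1 (cAct w.1 z) - k a.1)⁻¹ *
        (xval a.1 (cAct w.1 z) * (1 - k a.1 / xval a.1 (cAct w.1 z))) = 1 := by
      field_simp
    have e2 : (xval a.1 (cAct w.1 z) - k a.1)⁻¹ *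
        (xval a.1 (cAct w.1 z) * (k a.1 / xval a.1 (cAct w.1 z))) -
        (xval a.1 (cAct w.1 z) - k a.1)⁻¹ * k a.1 = 0 := by
      field_simp; ring
    rw [e1, e2, Finsupp.single_zero, sub_zero]
  | inr ω =>
    have h2 : (D.wordRep hz hk hfree) ω.1 = D.letterOp k z (Sum.inr ω) := h1
    rw [letterJ, Representation.asAlgebraHom_of, h2]
    simp [letterOp, Letter.elt]

theorem orbitMap_wordJ (hz : z ∈ D.reg k) (hk : D.IsMultiplicity k)
    (hfree : ∀ w : D.WHat, cAct w.1 z = z → w = 1) (L : List D.Letter) :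
    D.orbitMap hz hk hfree (D.wordJ k z L) = Finsupp.single (D.wordElt L) 1 := by
  induction L with
  | nil => rw [orbitMap_apply, wordJ, map_one]; rfl
  | cons l L ih =>
    rw [orbitMap_apply] at ih ⊢
    rw [wordJ, map_mul, Module.End.mul_apply, ih, asAlgebraHom_letterJ, wordElt_cons]

/-- Identify orbit points with group elements. The orbit map becomes an endomorphism of the finite
dimensional span of the subwords of L; it is onto because `wordJ` of a subword maps to the element
that the subword represents. Hence it is injective. -/
theorem orbitMap_injOn (hz : z ∈ D.reg k) (hk : D.IsMultiplicity k)
    (hfree : ∀ w : D.WHat, cAct w.1 z = z → w = 1) (L : List D.Letter)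
    {x : MonoidAlgebra ℂ D.WHat} (hx : x ∈ D.subwordSpan L)
    (h0 : D.orbitMap hz hk hfree x = 0) : x = 0 := by
  let e : (D.WHat →₀ ℂ) →ₗ[ℂ] MonoidAlgebra ℂ D.WHat :=
    Finsupp.linearCombination ℂ (MonoidAlgebra.of ℂ D.WHat)
  have he : ∀ w, e (Finsupp.single w 1) = MonoidAlgebra.of ℂ D.WHat w := fun w => by simp [e]
  have hpts : ∀ y ∈ D.subwordPoints L, e y ∈ D.subwordSpan L := by
    intro y hy
    induction hy using Submodule.span_induction with
    | mem y hy =>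
      obtain ⟨w, hw, rfl⟩ := hy
      exact Submodule.subset_span ⟨w, hw, (he w).symm⟩
    | zero => rw [map_zero]; exact zero_mem _
    | add x y _ _ hx hy => rw [map_add]; exact add_mem hx hy
    | smul c x _ hx => rw [map_smul]; exact Submodule.smul_mem _ _ hx
  have hmap : ∀ x ∈ D.subwordSpan L, (e ∘ₗ D.orbitMap hz hk hfree) x ∈ D.subwordSpan L := by
    intro x hx
    refine hpts _ ?_
    induction hx using Submodule.span_induction with
    | mem x hx =>
      obtain ⟨_, ⟨M, hM, rfl⟩, rfl⟩ := hx
      rw [orbitMap_apply, Representation.asAlgebraHom_of, wordRep_wordElt]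
      exact D.subwordPoints_mono hM (D.wordOp_mem_subwordPoints k z M)
    | zero => rw [map_zero]; exact zero_mem _
    | add x y _ _ hx hy => rw [map_add]; exact add_mem hx hy
    | smul c x _ hx => rw [map_smul]; exact Submodule.smul_mem _ _ hx
  let T : D.subwordSpan L →ₗ[ℂ] D.subwordSpan L := (e ∘ₗ D.orbitMap hz hk hfree).restrict hmap
  have hsurj : Function.Surjective T := by
    rintro ⟨y, hy⟩
    have : y ∈ (D.subwordSpan L).map (e ∘ₗ D.orbitMap hz hk hfree) := by
      refine Submodule.span_le.mpr ?_ hy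
      rintro _ ⟨_, ⟨M, hM, rfl⟩, rfl⟩
      refine ⟨D.wordJ k z M, D.subwordSpan_mono hM (D.wordJ_mem_subwordSpan k z M), ?_⟩
      rw [LinearMap.comp_apply, D.orbitMap_wordJ hz hk hfree M, he]
    obtain ⟨x, hx, hxy⟩ := this
    exact ⟨⟨x, hx⟩, Subtype.ext hxy⟩
  have : FiniteDimensional ℂ (D.subwordSpan L) :=
    FiniteDimensional.span_of_finite ℂ ((D.subwordElts_finite L).image _)
  have hinj : Function.Injective T := LinearMap.injective_iff_surjective.mpr hsurj
  have : (⟨x, hx⟩ : D.subwordSpan L) = 0 := hinj (by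
    rw [map_zero]
    refine Subtype.ext ?_
    change e (D.orbitMap hz hk hfree x) = 0
    rw [h0, map_zero])
  exact congrArg Subtype.val this

/-- Both values have the same orbit image. The concatenation L ++ L' supplies one finite dimensional
space that contains them both. -/
theorem wordJ_eq_of_free (hz : z ∈ D.reg k) (hk : D.IsMultiplicity k)
    (hfree : ∀ w : D.WHat, cAct w.1 z = z → w = 1) {L L' : List D.Letter}
    (h : D.wordElt L = D.wordElt L') : D.wordJ k z L = D.wordJ k z L' := by
  refine sub_eq_zero.mp (D.orbitMap_injOn hz hk hfree (L ++ L') (sub_mem ?_ ?_) ?_)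
  · exact D.subwordSpan_mono (List.sublist_append_left L L') (D.wordJ_mem_subwordSpan k z L)
  · exact D.subwordSpan_mono (List.sublist_append_right L L') (D.wordJ_mem_subwordSpan k z L')
  · rw [map_sub, orbitMap_wordJ, orbitMap_wordJ, h, sub_self]

end WordCocycle

/-! ### Density of the points with trivial stabilizer -/

theorem continuous_form_left {κ : Type*} [Fintype κ] (f : Hat ℂ κ) :
    Continuous fun z : Hat ℂ κ => form f z := by
  unfold form dotProduct
  fun_prop

theorem continuous_cAct {κ : Type*} [Fintype κ] (g : Hat ℝ κ ≃ₗ[ℝ] Hat ℝ κ) :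
    Continuous (cAct g) := (cActL g).continuous_of_finiteDimensional

theorem continuous_xval (a : Hat ℝ (ι ⊕ ι')) : Continuous (xval a) := continuous_form_left _

/-- A point with l z = c is the limit of z + u/(n+1), along which l avoids c. -/
theorem dense_setOf_linearMap_ne {E F : Type*} [NormedAddCommGroup E] [NormedSpace ℂ E]
    [AddCommGroup F] [Module ℂ F] (l : E →ₗ[ℂ] F) {u : E} (hu : l u ≠ 0) (c : F) :
    Dense {z | l z ≠ c} := by
  intro z
  by_cases hz : l z = c
  · have hlim : Filter.Tendsto (fun n : ℕ => z + ((1 : ℂ) / ((n : ℂ) + 1)) • u) Filter.atTop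
        (nhds z) := by
      have h1 := (tendsto_one_div_add_atTop_nhds_zero_nat (𝕜 := ℂ)).smul_const u
      simpa using h1.const_add z
    refine mem_closure_of_tendsto hlim (Filter.Eventually.of_forall fun n => ?_)
    change l _ ≠ c
    rw [map_add, map_smul, hz]
    intro h
    have hn : (1 : ℂ) / ((n : ℂ) + 1) ≠ 0 := one_div_ne_zero (Nat.cast_add_one_ne_zero n)
    exact smul_ne_zero hn hu (by simpa using h)
  · exact subset_closure hz

theorem form_affRoot_vee_ne {a : Hat ℝ (ι ⊕ ι')} (ha : a ∈ D.affRoots) :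
    xval a (toC a) ≠ 0 := by
  rw [xval, form_toC_toC, form_comm, form_vee_self (D.form_affRoot_ne ha)]
  norm_num

/-- Baire's theorem: each root gives two affine hyperplanes to avoid, and each w ≠ 1 a proper fixed
subspace, in all countably many open dense conditions. -/
theorem dense_free (k : Hat ℝ (ι ⊕ ι') → ℂ) :
    Dense {z | z ∈ D.reg k ∧ ∀ w : D.WHat, cAct w.1 z = z → w = 1} := by
  have hx : ∀ (a : D.affRoots) (c : ℂ),
      IsOpen {z | xval a.1 z ≠ c} ∧ Dense {z | xval a.1 z ≠ c} := by
    intro a c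
    refine ⟨isOpen_ne_fun (continuous_xval a.1) continuous_const, ?_⟩
    let l : Hat ℂ (ι ⊕ ι') →ₗ[ℂ] ℂ :=
      { toFun := xval a.1
        map_add' := fun x y => form_add_right _ _ _
        map_smul' := fun r x => form_smul_right _ _ _ }
    exact dense_setOf_linearMap_ne l (D.form_affRoot_vee_ne a.2) c
  have hw : ∀ w : {w : D.WHat // w ≠ 1}, IsOpen {z | cAct w.1.1 z ≠ z} ∧
      Dense {z | cAct w.1.1 z ≠ z} := by
    intro w
    refine ⟨isOpen_ne_fun (continuous_cAct _) continuous_id, ?_⟩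
    have hex : ∃ x, w.1.1 x ≠ x := by
      by_contra! h
      exact w.2 (Subtype.ext (LinearEquiv.ext h))
    obtain ⟨x, hx⟩ := hex
    have := dense_setOf_linearMap_ne (cActL w.1.1 - LinearMap.id) (u := toC x) (by
      rw [LinearMap.sub_apply, cActL_apply, cAct_toC, LinearMap.id_apply, ← toC_sub]
      intro h
      have h0 : w.1.1 x - x = 0 := by rw [← rePart_toC (w.1.1 x - x), h]; rfl
      exact hx (sub_eq_zero.mp h0)) 0
    simpa [sub_eq_zero, cActL_apply] using this
  have key := dense_iInter_of_isOpen
    (ι := (D.affRoots × Bool) ⊕ {w : D.WHat // w ≠ 1})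
    (f := Sum.elim (fun p => {z | xval p.1.1 z ≠ if p.2 then k p.1.1 else 0})
      fun w => {z | cAct w.1.1 z ≠ z})
    (by rintro (p | w); exacts [(hx _ _).1, (hw w).1])
    (by rintro (p | w); exacts [(hx _ _).2, (hw w).2])
  refine key.mono fun z hz => ?_
  rw [Set.mem_iInter] at hz
  refine ⟨fun a ha => ⟨?_, ?_⟩, fun w h => ?_⟩
  · simpa [xval] using hz (Sum.inl (⟨a, ha⟩, false))
  · simpa [xval] using hz (Sum.inl (⟨a, ha⟩, true))
  · by_contra hne
    exact hz (Sum.inr ⟨w, hne⟩) h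

variable {k : Hat ℝ (ι ⊕ ι') → ℂ}

/-- Continuity is tested on linear functionals, so no topology on the group algebra is needed;
generalizing φ absorbs left multiplication by a letter. -/
theorem continuousAt_wordJ (hk : D.IsMultiplicity k) {z : Hat ℂ (ι ⊕ ι')} (hz : z ∈ D.reg k)
    (L : List D.Letter) (φ : MonoidAlgebra ℂ D.WHat →ₗ[ℂ] ℂ) :
    ContinuousAt (fun x => φ (D.wordJ k x L)) z := by
  induction L generalizing φ with
  | nil => exact continuousAt_const
  | cons l L ih =>
    cases l with
    | inl a =>
      have e : ∀ x, φ (D.wordJ k x (Sum.inl a :: L)) =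
          (xval a.1 (cAct (D.wordElt L).1 x) - k a.1)⁻¹ * (xval a.1 (cAct (D.wordElt L).1 x) *
            (φ ∘ₗ LinearMap.mulLeft ℂ (MonoidAlgebra.of ℂ D.WHat (sref a))) (D.wordJ k x L) +
            k a.1 * φ (D.wordJ k x L)) := by
        intro x
        rw [wordJ, letterJ, smul_mul_assoc, add_mul, smul_mul_assoc, smul_mul_assoc, one_mul,
          map_smul, map_add, map_smul, map_smul]
        rfl
      simp only [e]
      have hc : ContinuousAt (fun x => xval a.1 (cAct (D.wordElt L).1 x)) z :=
        ((continuous_xval a.1).comp (continuous_cAct _)).continuousAt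
      have hne : xval a.1 (cAct (D.wordElt L).1 z) - k a.1 ≠ 0 :=
        sub_ne_zero.mpr (reg_cAct hk _ hz a.1 (D.simpleRoots_subset a.2)).2
      exact ((hc.sub continuousAt_const).inv₀ hne).mul
        ((hc.mul (ih _)).add (continuousAt_const.mul (ih φ)))
    | inr ω => exact ih (φ ∘ₗ LinearMap.mulLeft ℂ (MonoidAlgebra.of ℂ D.WHat ω.1))

/-- On `ĥ_reg` the value of the cocycle along a word depends only on the group element. -/
theorem wordJ_eq (hk : D.IsMultiplicity k) {z : Hat ℂ (ι ⊕ ι')} (hz : z ∈ D.reg k)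
    {L L' : List D.Letter} (h : D.wordElt L = D.wordElt L') : D.wordJ k z L = D.wordJ k z L' := by
  refine sub_eq_zero.mp ((Module.forall_dual_apply_eq_zero_iff ℂ _).mp fun φ => ?_)
  rw [map_sub, sub_eq_zero]
  set S := {z | z ∈ D.reg k ∧ ∀ w : D.WHat, cAct w.1 z = z → w = 1}
  have : (nhdsWithin z S).NeBot := mem_closure_iff_nhdsWithin_neBot.mp (D.dense_free k z)
  have h1 := ((D.continuousAt_wordJ hk hz L φ).mono_left (nhdsWithin_le_nhds (s := S)))
  have h2 := ((D.continuousAt_wordJ hk hz L' φ).mono_left (nhdsWithin_le_nhds (s := S)))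
  -- Both sides are limits along points with trivial stabilizer, where they agree.
  refine tendsto_nhds_unique h1 (h2.congr' ?_)
  filter_upwards [self_mem_nhdsWithin] with x hx
  rw [D.wordJ_eq_of_free hx.1 hk hx.2 h]

variable (k) in
/-- The cocycle. -/
def cocycle (w : D.WHat) (z : Hat ℂ (ι ⊕ ι')) : MonoidAlgebra ℂ D.WHat :=
  D.wordJ k z (D.exists_word w).choose

theorem cocycle_wordElt (hk : D.IsMultiplicity k) {z : Hat ℂ (ι ⊕ ι')} (hz : z ∈ D.reg k)
    (L : List D.Letter) : D.cocycle k (D.wordElt L) z = D.wordJ k z L :=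
  D.wordJ_eq hk hz (D.exists_word _).choose_spec

theorem cocycle_elt (hk : D.IsMultiplicity k) {z : Hat ℂ (ι ⊕ ι')} (hz : z ∈ D.reg k)
    (l : D.Letter) : D.cocycle k l.elt z = D.letterJ k z l := by
  have := D.cocycle_wordElt hk hz [l]
  rw [wordJ, wordJ, mul_one, wordElt_nil, show ((1 : D.WHat).1) = 1 from rfl, cAct_one] at this
  rw [← this]
  simp [wordElt]

theorem isCocycle_cocycle (hk : D.IsMultiplicity k) : D.IsCocycle k (D.cocycle k) where
  mul u w z hz := by
    obtain ⟨L, rfl⟩ := D.exists_word u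
    obtain ⟨L', rfl⟩ := D.exists_word w
    rw [← wordElt_append, D.cocycle_wordElt hk hz, D.cocycle_wordElt hk hz,
      D.cocycle_wordElt hk (reg_cAct hk _ hz), wordJ_append]
  simple a ha z hz := D.cocycle_elt hk hz (Sum.inl ⟨a, ha⟩)
  omega ω hω z hz := D.cocycle_elt hk hz (Sum.inr ⟨ω, hω⟩)

/-- The axioms prescribe J on letters and the product rule does the rest; the empty word is covered
because 1 ∈ Ω. -/
theorem IsCocycle.eq_wordJ {D : Datum I ι ι'}
    {J : D.WHat → Hat ℂ (ι ⊕ ι') → MonoidAlgebra ℂ D.WHat} (hJ : D.IsCocycle k J)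
    (hk : D.IsMultiplicity k) {z : Hat ℂ (ι ⊕ ι')} (hz : z ∈ D.reg k) (L : List D.Letter) :
    J (D.wordElt L) z = D.wordJ k z L := by
  induction L with
  | nil =>
    rw [wordElt_nil, wordJ, hJ.omega 1 (fun a ha => ha) z hz, map_one]
  | cons l L ih =>
    have hz' := reg_cAct hk (D.wordElt L) hz
    rw [wordElt_cons, hJ.mul _ _ z hz, ih, wordJ]
    congr 1
    cases l with
    | inl a => exact hJ.simple a.1 a.2 _ hz'
    | inr ω => exact hJ.omega ω.1 ω.2 _ hz'

theorem IsCocycle.eqOn {D : Datum I ι ι'}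
    {J : D.WHat → Hat ℂ (ι ⊕ ι') → MonoidAlgebra ℂ D.WHat} (hJ : D.IsCocycle k J)
    (hk : D.IsMultiplicity k) (w : D.WHat) : Set.EqOn (J w) (D.cocycle k w) (D.reg k) := by
  intro z hz
  obtain ⟨L, rfl⟩ := D.exists_word w
  rw [hJ.eq_wordJ hk hz, D.cocycle_wordElt hk hz]

end Datum

/-! ### Series of exponential functions -/

section ExpSeries

variable {X E G : Type*} [NormedAddCommGroup E] [NormedSpace ℝ E] [NormedAddCommGroup G]
  [NormedSpace ℂ G] (L : X → E →L[ℝ] ℂ) (A : X → G)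

theorem hasSum_swap {X G : Type*} [NormedAddCommGroup G] [CompleteSpace G] {F : X × ℕ → G}
    {f : X → G} (hF : Summable F)
    (hf : ∀ i, HasSum (fun n => F (i, n)) (f i)) :
    HasSum (fun n => ∑' i, F (i, n)) (∑' i, f i) := by
  have h1 := hF.hasSum.prod_fiberwise hf
  have hF' : HasSum (fun p : ℕ × X => F (p.2, p.1)) (∑' p, F p) :=
    (Equiv.prodComm ℕ X).hasSum_iff.mpr hF.hasSum
  rw [h1.tsum_eq]
  exact hF'.prod_fiberwise fun n => (hF'.summable.prod_factor n).hasSum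

/-- The majorant at `v` of the series `∑ exp(L i v) • A i`, on a ball with some radius. -/
def ExpSummable (v : E) : Prop :=
  ∃ r : ℝ, 0 < r ∧ Summable fun i => Real.exp ((L i v).re + r * ‖L i‖) * ‖A i‖

/-- The homogeneous part of degree `n` of `exp(l (v + ·)) • a`. -/
def expTerm (l : E →L[ℝ] ℂ) (a : G) (v : E) (n : ℕ) : E [×n]→L[ℝ] G :=
  (((ContinuousLinearMap.toSpanSingleton ℂ (Complex.exp (l v) • a)).restrictScalars
    ℝ).compContinuousMultilinearMap
      (((n.factorial : ℝ)⁻¹ • ContinuousMultilinearMap.mkPiAlgebraFin ℝ n ℂ).compContinuousLinearMap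
        fun _ => l))

theorem expTerm_apply (l : E →L[ℝ] ℂ) (a : G) (v : E) (n : ℕ) (y : E) :
    expTerm l a v n (fun _ => y) =
      (l y ^ n / (n.factorial : ℂ)) • Complex.exp (l v) • a := by
  simp [expTerm, div_eq_inv_mul]

theorem norm_expTerm_le (l : E →L[ℝ] ℂ) (a : G) (v : E) (n : ℕ) :
    ‖expTerm l a v n‖ ≤ Real.exp (l v).re * ‖a‖ * (‖l‖ ^ n / n.factorial) := by
  refine (ContinuousLinearMap.norm_compContinuousMultilinearMap_le _ _).trans ?_
  have h1 : ‖(ContinuousLinearMap.toSpanSingleton ℂ (Complex.exp (l v) • a)).restrictScalars ℝ‖ =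
      Real.exp (l v).re * ‖a‖ := by
    rw [ContinuousLinearMap.norm_restrictScalars, ContinuousLinearMap.norm_toSpanSingleton,
      norm_smul, Complex.norm_exp]
  rw [h1]
  refine mul_le_mul_of_nonneg_left ?_ (by positivity)
  refine (ContinuousMultilinearMap.norm_compContinuousLinearMap_le _ _).trans ?_
  rw [norm_smul, ContinuousMultilinearMap.norm_mkPiAlgebraFin, norm_inv, Real.norm_natCast,
    Finset.prod_const, Finset.card_univ, Fintype.card_fin, div_eq_inv_mul, mul_one]

theorem hasSum_expTerm (l : E →L[ℝ] ℂ) (a : G) (v y : E) :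
    HasSum (fun n => expTerm l a v n fun _ => y) (Complex.exp (l (v + y)) • a) := by
  simp only [expTerm_apply]
  have h := NormedSpace.expSeries_div_hasSum_exp (𝔸 := ℂ) (l y)
  rw [← Complex.exp_eq_exp_ℂ] at h
  have h2 := h.smul_const (Complex.exp (l v) • a)
  rwa [smul_smul, ← Complex.exp_add, ← map_add, add_comm] at h2

variable {L A} {v : E}

/-- Expand every exponential at v and exchange the sums. The double family b has as its row sums
exactly the assumed majorant, so it controls both the radius and the exchange. -/
theorem hasFPowerSeriesOnBall_expSeries [CompleteSpace G] {r : ℝ} (hr : 0 < r)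
    (hs : Summable fun i => Real.exp ((L i v).re + r * ‖L i‖) * ‖A i‖) :
    HasFPowerSeriesOnBall (fun x => ∑' i, Complex.exp (L i x) • A i)
      (fun n => ∑' i, expTerm (L i) (A i) v n) v (ENNReal.ofReal r) := by
  set b : X × ℕ → ℝ := fun p =>
    Real.exp (L p.1 v).re * ‖A p.1‖ * ((r * ‖L p.1‖) ^ p.2 / p.2.factorial) with hb
  have hb0 : ∀ p, 0 ≤ b p := fun p => by positivity
  have hrow : ∀ i, HasSum (fun n => b (i, n)) (Real.exp ((L i v).re + r * ‖L i‖) * ‖A i‖) := by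
    intro i
    have h := NormedSpace.expSeries_div_hasSum_exp (𝔸 := ℝ) (r * ‖L i‖)
    rw [← Real.exp_eq_exp_ℝ] at h
    have h2 := h.mul_left (Real.exp (L i v).re * ‖A i‖)
    have e : Real.exp ((L i v).re + r * ‖L i‖) * ‖A i‖ =
        Real.exp (L i v).re * ‖A i‖ * Real.exp (r * ‖L i‖) := by rw [Real.exp_add]; ring
    rw [e]
    exact h2
  have hbs : Summable b := by
    refine (summable_prod_of_nonneg hb0).mpr ⟨fun i => (hrow i).summable, ?_⟩
    simpa only [(hrow _).tsum_eq] using hs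
  have hterm : ∀ i n, ‖expTerm (L i) (A i) v n‖ * r ^ n ≤ b (i, n) := by
    intro i n
    refine (mul_le_mul_of_nonneg_right (norm_expTerm_le _ _ _ _) (by positivity)).trans_eq ?_
    simp only [hb, mul_pow]; ring
  have hcol : ∀ n, Summable fun i => b (i, n) := fun n =>
    hbs.comp_injective (i := fun i => (i, n)) fun i j h => (Prod.ext_iff.mp h).1
  have hts : ∀ n, Summable fun i => ‖expTerm (L i) (A i) v n‖ := fun n => by
    refine Summable.of_nonneg_of_le (fun i => norm_nonneg _) (fun i => ?_)
      ((hcol n).mul_right (r ^ n)⁻¹)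
    rw [← div_eq_mul_inv, le_div_iff₀ (by positivity)]
    exact hterm i n
  refine ⟨?_, by simpa using hr, ?_⟩
  · rw [ENNReal.ofReal_eq_coe_nnreal hr.le]
    refine FormalMultilinearSeries.le_radius_of_bound _ (∑' p, b p) fun n => ?_
    change ‖∑' i, expTerm (L i) (A i) v n‖ * r ^ n ≤ _
    calc ‖∑' i, expTerm (L i) (A i) v n‖ * r ^ n
        ≤ (∑' i, ‖expTerm (L i) (A i) v n‖) * r ^ n :=
          mul_le_mul_of_nonneg_right (norm_tsum_le_tsum_norm (hts n)) (by positivity)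
      _ = ∑' i, ‖expTerm (L i) (A i) v n‖ * r ^ n := tsum_mul_right.symm
      _ ≤ ∑' i, b (i, n) := ((hts n).mul_right _).tsum_le_tsum (fun i => hterm i n) (hcol n)
      _ ≤ ∑' p, b p := by
          refine Summable.tsum_le_tsum_of_inj (fun i => (i, n))
            (fun i j h => (Prod.ext_iff.mp h).1) (fun p _ => hb0 p) (fun i => le_rfl) (hcol n) hbs
  · intro y hy
    have hy' : ‖y‖ < r := by
      rw [Metric.mem_eball, edist_zero_right, ← ofReal_norm] at hy
      exact (ENNReal.ofReal_lt_ofReal_iff hr).mp hy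
    have hF : ∀ p : X × ℕ, ‖expTerm (L p.1) (A p.1) v p.2 fun _ => y‖ ≤ b p := by
      intro p
      refine ((expTerm (L p.1) (A p.1) v p.2).le_opNorm _).trans ?_
      rw [Finset.prod_const, Finset.card_univ, Fintype.card_fin]
      exact (mul_le_mul_of_nonneg_left (pow_le_pow_left₀ (norm_nonneg _) hy'.le _)
        (norm_nonneg _)).trans (hterm p.1 p.2)
    have hFs : Summable fun p : X × ℕ => expTerm (L p.1) (A p.1) v p.2 fun _ => y :=
      Summable.of_norm_bounded hbs hF
    have h2 := hasSum_swap hFs (fun i => hasSum_expTerm (L i) (A i) v y)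
    have hsn : ∀ n, Summable fun i => expTerm (L i) (A i) v n := fun n => (hts n).of_norm
    refine h2.congr_fun fun n => ?_
    exact ContinuousMultilinearMap.tsum_eval (hsn n) _

theorem ExpSummable.analyticAt [CompleteSpace G] (h : ExpSummable L A v) :
    AnalyticAt ℝ (fun x => ∑' i, Complex.exp (L i x) • A i) v := by
  obtain ⟨r, hr, hs⟩ := h
  exact (hasFPowerSeriesOnBall_expSeries hr hs).analyticAt

/-- The derivative is the degree one coefficient of the power series; this coefficient is itself a
convergent sum, because r‖L‖ ≤ exp(r‖L‖). -/
theorem ExpSummable.lineDeriv_eq [CompleteSpace G] (h : ExpSummable L A v) (u : E) :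
    lineDeriv ℝ (fun x => ∑' i, Complex.exp (L i x) • A i) v u =
      ∑' i, Complex.exp (L i v) • L i u • A i := by
  obtain ⟨r, hr, hs⟩ := h
  have hf := (hasFPowerSeriesOnBall_expSeries hr hs)
  have hd := hf.hasFPowerSeriesAt.hasFDerivAt
  rw [hd.differentiableAt.lineDeriv_eq_fderiv, hd.fderiv]
  have hsum : Summable fun i => expTerm (L i) (A i) v 1 := by
    refine Summable.of_norm_bounded (hs.mul_left r⁻¹) fun i => ?_
    refine (norm_expTerm_le _ _ _ _).trans ?_
    have h1 : r * ‖L i‖ ≤ Real.exp (r * ‖L i‖) := by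
      linarith [Real.add_one_le_exp (r * ‖L i‖)]
    have h2 : ‖L i‖ ≤ r⁻¹ * Real.exp (r * ‖L i‖) := by
      rw [le_inv_mul_iff₀ hr]; exact h1
    rw [Real.exp_add]
    calc Real.exp (L i v).re * ‖A i‖ * (‖L i‖ ^ 1 / (Nat.factorial 1 : ℕ))
        = Real.exp (L i v).re * ‖A i‖ * ‖L i‖ := by simp
      _ ≤ Real.exp (L i v).re * ‖A i‖ * (r⁻¹ * Real.exp (r * ‖L i‖)) :=
        mul_le_mul_of_nonneg_left h2 (by positivity)
      _ = _ := by ring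
  have hu : ∀ p : E [×1]→L[ℝ] G, continuousMultilinearCurryFin1 ℝ E G p u = p fun _ => u := by
    intro p
    rw [continuousMultilinearCurryFin1_apply]
    congr 1
  rw [hu, ContinuousMultilinearMap.tsum_eval hsum]
  refine tsum_congr fun i => ?_
  rw [expTerm_apply, smul_smul, smul_smul]
  simp [mul_comm]

/-- Differentiation costs a factor ‖L i‖, which is absorbed by halving r; so the hypothesis passes
to derivatives of every order. -/
theorem ExpSummable.smul (h : ExpSummable L A v) (u : E) :
    ExpSummable L (fun i => L i u • A i) v := by
  obtain ⟨r, hr, hs⟩ := h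
  refine ⟨r / 2, by positivity, Summable.of_nonneg_of_le (fun i => by positivity) (fun i => ?_)
    (hs.mul_left (2 / r * ‖u‖))⟩
  have h1 : r / 2 * ‖L i‖ ≤ Real.exp (r / 2 * ‖L i‖) := by
    linarith [Real.add_one_le_exp (r / 2 * ‖L i‖)]
  have h2 : ‖L i‖ ≤ 2 / r * Real.exp (r / 2 * ‖L i‖) := by
    calc ‖L i‖ = 2 / r * (r / 2 * ‖L i‖) := by field_simp
      _ ≤ _ := mul_le_mul_of_nonneg_left h1 (by positivity)
  have h3 : ‖L i u‖ ≤ 2 / r * Real.exp (r / 2 * ‖L i‖) * ‖u‖ :=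
    ((L i).le_opNorm u).trans (mul_le_mul_of_nonneg_right h2 (norm_nonneg _))
  have h4 : Real.exp ((L i v).re + r * ‖L i‖) =
      Real.exp ((L i v).re + r / 2 * ‖L i‖) * Real.exp (r / 2 * ‖L i‖) := by
    rw [← Real.exp_add]; congr 1; ring
  rw [norm_smul, h4]
  calc Real.exp ((L i v).re + r / 2 * ‖L i‖) * (‖L i u‖ * ‖A i‖)
      ≤ Real.exp ((L i v).re + r / 2 * ‖L i‖) *
        ((2 / r * Real.exp (r / 2 * ‖L i‖) * ‖u‖) * ‖A i‖) := by gcongr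
    _ = _ := by ring

theorem ExpSummable.summable_norm (h : ExpSummable L A v) :
    Summable fun i => ‖Complex.exp (L i v) • A i‖ := by
  obtain ⟨r, hr, hs⟩ := h
  refine Summable.of_nonneg_of_le (fun i => norm_nonneg _) (fun i => ?_) hs
  rw [norm_smul, Complex.norm_exp]
  refine mul_le_mul_of_nonneg_right (Real.exp_le_exp.mpr ?_) (norm_nonneg _)
  have : 0 ≤ r * ‖L i‖ := by positivity
  linarith

end ExpSeries

/-! ### Holomorphy of locally dominated series. -/

section HolomorphicSeries

variable {X E G : Type*} [NormedAddCommGroup E] [NormedSpace ℂ E] [NormedAddCommGroup G]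
  [NormedSpace ℂ G]

/-- Cauchy's estimate for the derivative of a bounded holomorphic function on a ball. -/
theorem norm_fderiv_le_of_forall_mem_ball {F : E → G} {z₀ z : E} {R C : ℝ} (hR : 0 < R)
    (hC : 0 ≤ C) (hF : ∀ x ∈ Metric.ball z₀ R, DifferentiableAt ℂ F x)
    (hb : ∀ x ∈ Metric.ball z₀ R, ‖F x‖ ≤ C) (hz : z ∈ Metric.ball z₀ (R / 2)) :
    ‖fderiv ℂ F z‖ ≤ C / (R / 4) := by
  refine ContinuousLinearMap.opNorm_le_bound _ (by positivity) fun h => ?_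
  by_cases hh : h = 0
  · simp [hh]
  have hn : 0 < ‖h‖ := norm_pos_iff.mpr hh
  have hρ : 0 < R / 4 / ‖h‖ := by positivity
  -- From the half ball a displacement of length at most R/4 stays in the ball of radius R, so the
  -- function can be restricted to a complex disc in direction h.
  have hmem : ∀ t : ℂ, ‖t‖ ≤ R / 4 / ‖h‖ → z + t • h ∈ Metric.ball z₀ R := by
    intro t ht
    rw [Metric.mem_ball] at hz ⊢
    have h1 : ‖t • h‖ ≤ R / 4 := by
      rw [norm_smul]; exact (le_div_iff₀ hn).mp ht
    calc dist (z + t • h) z₀ ≤ dist (z + t • h) z + dist z z₀ := dist_triangle _ _ _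
      _ < R / 4 + R / 2 := by
        refine add_lt_add_of_le_of_lt ?_ hz
        rw [dist_eq_norm, add_sub_cancel_left]; exact h1
      _ ≤ R := by linarith
  have hline : ∀ t : ℂ, HasDerivAt (fun t : ℂ => z + t • h) h t := fun t => by
    simpa using ((hasDerivAt_id t).smul_const h).const_add z
  have hd : ∀ t : ℂ, ‖t‖ ≤ R / 4 / ‖h‖ →
      HasDerivAt (fun t : ℂ => F (z + t • h)) (fderiv ℂ F (z + t • h) h) t := fun t ht =>
    (hF _ (hmem t ht)).hasFDerivAt.comp_hasDerivAt t (hline t)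
  have hdc : DiffContOnCl ℂ (fun t : ℂ => F (z + t • h)) (Metric.ball 0 (R / 4 / ‖h‖)) := by
    refine DifferentiableOn.diffContOnCl fun t ht => ?_
    have := Metric.closure_ball_subset_closedBall ht
    rw [mem_closedBall_zero_iff] at this
    exact (hd t this).differentiableAt.differentiableWithinAt
  have key := Complex.norm_deriv_le_of_forall_mem_sphere_norm_le hρ hdc (C := C) fun t ht => by
    refine hb _ (hmem t ?_)
    rw [mem_sphere_zero_iff_norm] at ht
    exact ht.le
  have h0 := hd 0 (by simpa using hρ.le)
  rw [h0.deriv] at key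
  simp only [zero_smul, add_zero] at key
  refine key.trans_eq ?_
  field_simp

theorem differentiableAt_tsum_of_ball [CompleteSpace G] {F : X → E → G} {u : X → ℝ}
    (hu : Summable u) {z₀ : E} {R : ℝ} (hR : 0 < R)
    (hF : ∀ i, ∀ x ∈ Metric.ball z₀ R, DifferentiableAt ℂ (F i) x)
    (hb : ∀ i, ∀ x ∈ Metric.ball z₀ R, ‖F i x‖ ≤ u i) :
    DifferentiableAt ℂ (fun z => ∑' i, F i z) z₀ := by
  have hu0 : ∀ i, 0 ≤ u i := fun i =>
    (norm_nonneg _).trans (hb i z₀ (Metric.mem_ball_self hR))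
  have hz₀ : z₀ ∈ Metric.ball z₀ (R / 2) := Metric.mem_ball_self (by positivity)
  have hsub : Metric.ball z₀ (R / 2) ⊆ Metric.ball z₀ R := Metric.ball_subset_ball (by linarith)
  -- The real structure serves only to see that the ball is convex, hence preconnected.
  let : NormedSpace ℝ E := NormedSpace.restrictScalars ℝ ℂ E
  refine (hasFDerivAt_tsum_of_isPreconnected (𝕜 := ℂ) (f := F) (f' := fun i z => fderiv ℂ (F i) z)
    (hu.div_const (R / 4)) Metric.isOpen_ball (convex_ball z₀ (R / 2)).isPreconnected
    (fun i x hx => (hF i x (hsub hx)).hasFDerivAt)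
    (fun i x hx => norm_fderiv_le_of_forall_mem_ball hR (hu0 i) (hF i) (hb i) hx) hz₀
    (Summable.of_norm_bounded hu fun i => hb i z₀ (Metric.mem_ball_self hR)) hz₀).differentiableAt

end HolomorphicSeries

/-! ### Estimates -/

section Estimates

variable {κ : Type*} [Fintype κ]

/-- The real linear function `(x, ·)` on `V̂`, for `x ∈ ĥ`. -/
def formL (x : Hat ℂ κ) : Hat ℝ κ →L[ℝ] ℂ :=
  LinearMap.toContinuousLinearMap
    { toFun := fun v => form x (toC v)
      map_add' := fun v w => by rw [toC_add, form_add_right]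
      map_smul' := fun r v => by rw [toC_smul, form_smul_right]; simp }

theorem formL_apply (x : Hat ℂ κ) (v : Hat ℝ κ) : formL x v = form x (toC v) := rfl

/-- The norm on κ → 𝕜 is the supremum norm, which accounts for the factor `Fintype.card κ` here and
in the later estimates. -/
theorem norm_dotProduct_le {𝕜 : Type*} [NormedField 𝕜] (x y : κ → 𝕜) :
    ‖x ⬝ᵥ y‖ ≤ Fintype.card κ * (‖x‖ * ‖y‖) := by
  rw [dotProduct]
  refine (norm_sum_le _ _).trans ?_
  rw [← nsmul_eq_mul, ← Finset.card_univ, ← Finset.sum_const]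
  refine Finset.sum_le_sum fun i _ => ?_
  rw [norm_mul]
  exact mul_le_mul (norm_le_pi_norm x i) (norm_le_pi_norm y i) (norm_nonneg _) (norm_nonneg _)

theorem norm_ofReal_pi (y : κ → ℝ) : ‖fun j => (y j : ℂ)‖ = ‖y‖ := by
  refine le_antisymm ((pi_norm_le_iff_of_nonneg (norm_nonneg _)).mpr fun j => ?_)
    ((pi_norm_le_iff_of_nonneg (norm_nonneg _)).mpr fun j => ?_)
  · rw [Complex.norm_real]; exact norm_le_pi_norm y j
  · rw [← Complex.norm_real]; exact norm_le_pi_norm (fun j => (y j : ℂ)) j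

theorem sq_norm_le_dotProduct (y : κ → ℝ) : ‖y‖ ^ 2 ≤ y ⬝ᵥ y := by
  have hnn : 0 ≤ y ⬝ᵥ y := Finset.sum_nonneg fun i _ => mul_self_nonneg (y i)
  have h : ‖y‖ ≤ Real.sqrt (y ⬝ᵥ y) := by
    refine (pi_norm_le_iff_of_nonneg (Real.sqrt_nonneg _)).mpr fun j => ?_
    refine Real.le_sqrt_of_sq_le ?_
    rw [Real.norm_eq_abs, sq_abs, sq, dotProduct]
    exact Finset.single_le_sum (f := fun i => y i * y i) (fun i _ => mul_self_nonneg (y i))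
      (Finset.mem_univ j)
  calc ‖y‖ ^ 2 ≤ Real.sqrt (y ⬝ᵥ y) ^ 2 := pow_le_pow_left₀ (norm_nonneg _) h 2
    _ = y ⬝ᵥ y := Real.sq_sqrt hnn

theorem norm_toC (v : Hat ℝ κ) : ‖toC v‖ = ‖v‖ := by
  simp only [toC, Prod.norm_def, norm_ofReal_pi, Complex.norm_real]

theorem norm_mid_le {𝕜 : Type*} [NormedField 𝕜] (x : Hat 𝕜 κ) : ‖x.2.1‖ ≤ ‖x‖ :=
  (norm_fst_le x.2).trans (norm_snd_le x)

theorem norm_last_le {𝕜 : Type*} [NormedField 𝕜] (x : Hat 𝕜 κ) : ‖x.2.2‖ ≤ ‖x‖ :=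
  (norm_snd_le x.2).trans (norm_snd_le x)

theorem norm_form_le (x y : Hat ℂ κ) : ‖form x y‖ ≤ (Fintype.card κ + 2) * (‖x‖ * ‖y‖) := by
  have h1 : ‖x.1 ⬝ᵥ y.1‖ ≤ Fintype.card κ * (‖x‖ * ‖y‖) :=
    (norm_dotProduct_le _ _).trans (by
      have := norm_fst_le x
      have := norm_fst_le y
      gcongr)
  have h2 : ‖x.2.1 * y.2.2‖ ≤ ‖x‖ * ‖y‖ := by
    rw [norm_mul]; have := norm_mid_le x; have := norm_last_le y; gcongr
  have h3 : ‖x.2.2 * y.2.1‖ ≤ ‖x‖ * ‖y‖ := by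
    rw [norm_mul]; have := norm_last_le x; have := norm_mid_le y; gcongr
  calc ‖form x y‖ ≤ ‖x.1 ⬝ᵥ y.1‖ + ‖x.2.1 * y.2.2‖ + ‖x.2.2 * y.2.1‖ := norm_add₃_le
    _ ≤ _ := by linarith

theorem norm_formL_le (x : Hat ℂ κ) : ‖formL x‖ ≤ (Fintype.card κ + 2) * ‖x‖ := by
  refine ContinuousLinearMap.opNorm_le_bound _ (by positivity) fun v => ?_
  rw [formL_apply]
  refine (norm_form_le _ _).trans_eq ?_
  rw [norm_toC]; ring

theorem norm_cAct_transl_le (y : κ → ℝ) (z : Hat ℂ κ) :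
    ‖cAct (transl y) z‖ ≤ ‖z‖ * (3 + (Fintype.card κ + 1) * ‖y‖ + Fintype.card κ * ‖y‖ ^ 2) := by
  set n : ℝ := (Fintype.card κ : ℝ)
  have hn : 0 ≤ n := Nat.cast_nonneg _
  have hy := norm_nonneg y
  have hz := norm_nonneg z
  have h1 := norm_fst_le z
  have h2 := norm_mid_le z
  have h3 := norm_last_le z
  have hyy : ‖(fun j => (y j : ℂ)) ⬝ᵥ fun j => (y j : ℂ)‖ ≤ n * ‖y‖ ^ 2 := by
    refine (norm_dotProduct_le _ _).trans_eq ?_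
    rw [norm_ofReal_pi, sq]
  have hzy : ‖z.1 ⬝ᵥ fun j => (y j : ℂ)‖ ≤ n * (‖z‖ * ‖y‖) := by
    refine (norm_dotProduct_le _ _).trans ?_
    rw [norm_ofReal_pi]; gcongr
  have hA : 0 ≤ ‖z‖ * ((n + 1) * ‖y‖) := by positivity
  have hB : 0 ≤ ‖z‖ * (n * ‖y‖ ^ 2) := by positivity
  have hD : 0 ≤ ‖z‖ * (n * ‖y‖) := by positivity
  rw [cAct_transl]
  refine max_le ?_ (max_le ?_ ?_)
  · change ‖z.1 + z.2.2 • (fun j => (y j : ℂ))‖ ≤ _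
    refine (norm_add_le _ _).trans ?_
    rw [norm_smul, norm_ofReal_pi]
    have : ‖z.2.2‖ * ‖y‖ ≤ ‖z‖ * ‖y‖ := by gcongr
    nlinarith
  · change ‖z.2.1 - z.2.2 / 2 * _ - _‖ ≤ _
    refine (norm_sub_le _ _).trans ?_
    have h4 : ‖z.2.1 - z.2.2 / 2 * ((fun j => (y j : ℂ)) ⬝ᵥ fun j => (y j : ℂ))‖ ≤
        ‖z‖ + ‖z‖ * (n * ‖y‖ ^ 2) := by
      refine (norm_sub_le _ _).trans (add_le_add h2 ?_)
      rw [norm_mul, norm_div]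
      have h5 : ‖z.2.2‖ / ‖(2 : ℂ)‖ ≤ ‖z‖ := by
        simp only [Complex.norm_ofNat]; linarith [norm_nonneg z.2.2]
      gcongr
    have : 0 ≤ ‖z‖ * ‖y‖ := by positivity
    nlinarith
  · change ‖z.2.2‖ ≤ _
    nlinarith

/-- In the expansion of (t_y z, v) the only term quadratic in y is minus half the product of both
levels with (y, y). The level of v is real and positive, so its real part gives Gaussian decay. -/
theorem re_form_transl_le {y : κ → ℝ} {z : Hat ℂ κ} {v : Hat ℝ κ} {ε ζ : ℝ} (hε : 0 ≤ ε)
    (hz : ε ≤ z.2.2.re) (hζ : 0 ≤ ζ) (hv : ζ ≤ v.2.2) :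
    (form (cAct (transl y) z) (toC v)).re ≤
      (Fintype.card κ + 2) * (‖z‖ * ‖v‖) + 2 * Fintype.card κ * (‖z‖ * ‖v‖) * ‖y‖ -
        ε * ζ / 2 * ‖y‖ ^ 2 := by
  set n : ℝ := (Fintype.card κ : ℝ)
  have hn : 0 ≤ n := Nat.cast_nonneg _
  let y' : κ → ℂ := fun j => (y j : ℂ)
  have e : form (cAct (transl y) z) (toC v) = form z (toC v) +
      z.2.2 * (y' ⬝ᵥ (toC v).1) - (z.1 ⬝ᵥ y') * v.2.2 -
      z.2.2 / 2 * ((y ⬝ᵥ y : ℝ) : ℂ) * v.2.2 := by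
    have hyy : ((y ⬝ᵥ y : ℝ) : ℂ) = y' ⬝ᵥ y' := by simp [dotProduct, y']
    rw [cAct_transl, hyy]
    simp only [form, translMap, toC, LinearMap.coe_mk, AddHom.coe_mk, add_dotProduct,
      smul_dotProduct, smul_eq_mul]
    ring
  have h1 : (form z (toC v)).re ≤ (n + 2) * (‖z‖ * ‖v‖) := by
    refine (Complex.re_le_norm _).trans ((norm_form_le _ _).trans_eq ?_)
    rw [norm_toC]
  have hv1 : ‖(toC v).1‖ ≤ ‖v‖ := by rw [← norm_toC]; exact norm_fst_le (toC v)
  have hv2 : ‖(v.2.2 : ℂ)‖ ≤ ‖v‖ := by rw [Complex.norm_real]; exact norm_last_le v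
  have hz1 := norm_fst_le z
  have hz2 := norm_last_le z
  have h2 : (z.2.2 * (y' ⬝ᵥ (toC v).1)).re ≤ n * (‖z‖ * ‖v‖) * ‖y‖ := by
    refine (Complex.re_le_norm _).trans ?_
    rw [norm_mul]
    calc ‖z.2.2‖ * ‖y' ⬝ᵥ (toC v).1‖ ≤ ‖z‖ * (n * (‖y‖ * ‖v‖)) := by
          refine mul_le_mul hz2 ((norm_dotProduct_le _ _).trans ?_) (norm_nonneg _) (norm_nonneg _)
          rw [norm_ofReal_pi]; gcongr
      _ = _ := by ring
  have h3 : -((z.1 ⬝ᵥ y') * v.2.2).re ≤ n * (‖z‖ * ‖v‖) * ‖y‖ := by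
    refine (neg_le_abs _).trans ((Complex.abs_re_le_norm _).trans ?_)
    rw [norm_mul]
    calc ‖z.1 ⬝ᵥ y'‖ * ‖(v.2.2 : ℂ)‖ ≤ (n * (‖z‖ * ‖y‖)) * ‖v‖ := by
          refine mul_le_mul ((norm_dotProduct_le _ _).trans ?_) hv2 (norm_nonneg _) (by positivity)
          rw [norm_ofReal_pi]; gcongr
      _ = _ := by ring
  have h4 : (z.2.2 / 2 * ((y ⬝ᵥ y : ℝ) : ℂ) * v.2.2).re = z.2.2.re / 2 * (y ⬝ᵥ y) * v.2.2 := by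
    rw [Complex.re_mul_ofReal, Complex.re_mul_ofReal]
    simp
  have h5 : ε * ζ / 2 * ‖y‖ ^ 2 ≤ z.2.2.re / 2 * (y ⬝ᵥ y) * v.2.2 := by
    have := sq_norm_le_dotProduct y
    calc ε * ζ / 2 * ‖y‖ ^ 2 = ε / 2 * ‖y‖ ^ 2 * ζ := by ring
      _ ≤ z.2.2.re / 2 * (y ⬝ᵥ y) * v.2.2 := by
        have h0 : 0 ≤ z.2.2.re := hε.trans hz
        have h0' : 0 ≤ y ⬝ᵥ y := (by positivity : (0:ℝ) ≤ ‖y‖ ^ 2).trans this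
        gcongr
  rw [e, Complex.sub_re, Complex.sub_re, Complex.add_re, h4]
  linarith

/-- Use t^n ≤ n! e^t, then complete the square: (A + 1)²/(4c) is the maximum of (A + 1)t - ct². -/
theorem exp_mul_pow_le {A c t : ℝ} (hc : 0 < c) (ht : 0 ≤ t) (n : ℕ) :
    Real.exp (A * t - c * t ^ 2) * t ^ n ≤ n.factorial * Real.exp ((A + 1) ^ 2 / (4 * c)) := by
  have h1 : t ^ n ≤ n.factorial * Real.exp t := by
    have := Real.pow_div_factorial_le_exp t ht n
    rwa [div_le_iff₀ (by positivity), mul_comm] at this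
  have h2 : A * t - c * t ^ 2 + t ≤ (A + 1) ^ 2 / (4 * c) := by
    rw [le_div_iff₀ (by positivity)]
    nlinarith [sq_nonneg (A + 1 - 2 * c * t)]
  calc Real.exp (A * t - c * t ^ 2) * t ^ n
      ≤ Real.exp (A * t - c * t ^ 2) * (n.factorial * Real.exp t) := by gcongr
    _ = n.factorial * Real.exp (A * t - c * t ^ 2 + t) := by rw [Real.exp_add]; ring
    _ ≤ _ := by gcongr

/-- Gaussian sums over a discrete subgroup converge. -/
theorem summable_gaussian (Λ : Submodule ℤ (κ → ℝ)) [DiscreteTopology Λ] (A : ℝ) {c : ℝ}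
    (hc : 0 < c) : Summable fun y : Λ => Real.exp (A * ‖y‖ - c * ‖y‖ ^ 2) := by
  classical
  -- The sum of ‖y‖^{-n} over a lattice converges for n larger than the rank.
  set n := Module.finrank ℤ Λ + 1
  have h1 := (ZLattice.summable_norm_pow_inv Λ n (Nat.lt_succ_self _)).mul_left
    (n.factorial * Real.exp ((A + 1) ^ 2 / (4 * c)))
  refine Summable.of_norm_bounded_eventually h1 ?_
  have h0 : ∀ᶠ y : Λ in Filter.cofinite, y ≠ 0 := by
    simp [Filter.eventually_cofinite]
  filter_upwards [h0] with y hy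
  have hy' : 0 < ‖y‖ := norm_pos_iff.mpr hy
  rw [Real.norm_of_nonneg (Real.exp_pos _).le, inv_pow, ← div_eq_mul_inv,
    le_div_iff₀ (by positivity)]
  exact exp_mul_pow_le hc hy'.le n

end Estimates

/-! ### Boundedness of k and uniform regularity. -/

namespace Datum

variable {I ι ι' : Type*} [Finite I] [Fintype ι] [Fintype ι'] (D : Datum I ι ι')
  {k : Hat ℝ (ι ⊕ ι') → ℂ}

/-- Translation by the coroot of α shifts the c-coefficient by (α^∨, α) = 2. -/
theorem multiplicity_sub_two (hk : D.IsMultiplicity k) (i : I) (m : ℤ) :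
    k (D.affRoot i (m - 2)) = k (D.affRoot i m) := by
  let y : D.Y := ⟨(2 / (D.P.root i ⬝ᵥ D.P.root i)) • D.rootV i, D.coroot_mem i⟩
  obtain ⟨z, hz, h⟩ := D.transl_affRoot y i m
  have h2 : (z : ℝ) = 2 := by
    rw [← hz]
    change ((2 / (D.P.root i ⬝ᵥ D.P.root i)) • D.rootV i) ⬝ᵥ D.rootV i = 2
    rw [smul_dotProduct, ← rootV_dot, smul_eq_mul, div_mul_cancel₀ _ (D.root_dot_pos i)]
  have h3 : z = 2 := by exact_mod_cast h2
  rw [← hk (D.t y) _ ⟨i, m, rfl⟩]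
  change _ = k (transl _ (D.affRoot i m))
  rw [h, h3]

/-- By periodicity k_{α+mc} depends only on α and the parity of m, so k takes finitely many values.
-/
theorem exists_multiplicity_bound (hk : D.IsMultiplicity k) :
    ∃ K : ℝ, 0 ≤ K ∧ ∀ a ∈ D.affRoots, ‖k a‖ ≤ K := by
  have hper : ∀ (i : I) (n : ℤ) (m : ℤ), k (D.affRoot i (m - 2 * n)) = k (D.affRoot i m) := by
    intro i n
    induction n using Int.induction_on with
    | zero => intro m; simp
    | succ n ih =>
      intro m
      rw [← ih m, ← D.multiplicity_sub_two hk i (m - 2 * n)]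
      congr 2; ring
    | pred n ih =>
      intro m
      rw [← ih m, ← D.multiplicity_sub_two hk i (m - 2 * (-n - 1))]
      congr 2; ring
  have hfin : (Set.range fun p : I × Bool => ‖k (D.affRoot p.1 (if p.2 then 1 else 0))‖).Finite :=
    Set.finite_range _
  obtain ⟨K, hK⟩ := hfin.bddAbove
  refine ⟨max K 0, le_max_right _ _, ?_⟩
  rintro _ ⟨i, m, rfl⟩
  refine le_trans ?_ (le_max_left _ _)
  rcases Int.even_or_odd' m with ⟨n, hn | hn⟩
  · have := hper i n m
    rw [hn, sub_self] at this
    rw [hn, ← this]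
    exact hK ⟨(i, false), rfl⟩
  · have := hper i n m
    rw [hn, add_sub_cancel_left] at this
    rw [hn, ← this]
    exact hK ⟨(i, true), rfl⟩

variable (k) in
/-- `z` keeps away from the singular hyperplanes, with the constant `δ`. -/
def URegular (δ : ℝ) (z : Hat ℂ (ι ⊕ ι')) : Prop :=
  ∀ a ∈ D.affRoots, xval a z ≠ 0 ∧ δ * (1 + ‖xval a z‖) ≤ ‖xval a z - k a‖

theorem URegular.mem_reg {D : Datum I ι ι'} {δ : ℝ} (hδ : 0 < δ) {z : Hat ℂ (ι ⊕ ι')}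
    (h : D.URegular k δ z) : z ∈ D.reg k := by
  intro a ha
  refine ⟨(h a ha).1, fun h0 => ?_⟩
  have h1 := (h a ha).2
  have h2 : xval a z - k a = 0 := sub_eq_zero.mpr h0
  rw [h2, norm_zero] at h1
  have : 0 < δ * (1 + ‖xval a z‖) := by positivity
  linarith

theorem URegular.cAct {D : Datum I ι ι'} (hk : D.IsMultiplicity k) {δ : ℝ} {z : Hat ℂ (ι ⊕ ι')}
    (h : D.URegular k δ z) (w : D.WHat) : D.URegular k δ (cAct w.1 z) := by
  intro a ha
  rw [xval_cAct, ← hk w⁻¹ a ha]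
  exact h _ (D.WHat_affRoots w⁻¹ ha)

theorem xval_affRoot (i : I) (m : ℤ) (z : Hat ℂ (ι ⊕ ι')) :
    xval (D.affRoot i m) z = ((2 / (D.rootV i ⬝ᵥ D.rootV i) : ℝ) : ℂ) *
      ((fun j => (D.rootV i j : ℂ)) ⬝ᵥ z.1 + m * z.2.2) := by
  rw [xval, vee, toC_smul, form_smul_left, form_affRoot_self]
  congr 1
  simp [form, toC, affRoot]

/-- Positive real part of the level makes (a^∨, z) grow linearly in m for a = α + mc. Hence all but
finitely many roots satisfy the bound with constant 1/2 near z₀, and continuity handles the finitely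
many others. -/
theorem eventually_URegular (hk : D.IsMultiplicity k) {z₀ : Hat ℂ (ι ⊕ ι')}
    (hz₀ : z₀ ∈ D.regPlus k) : ∃ δ : ℝ, 0 < δ ∧ ∀ᶠ z in nhds z₀, D.URegular k δ z := by
  obtain ⟨K, hK0, hK⟩ := D.exists_multiplicity_bound hk
  have hfin : ∀ S : Set (Hat ℝ (ι ⊕ ι')), S.Finite → S ⊆ D.affRoots →
      ∃ δ : ℝ, 0 < δ ∧ ∀ᶠ z in nhds z₀, ∀ a ∈ S,
        xval a z ≠ 0 ∧ δ * (1 + ‖xval a z‖) ≤ ‖xval a z - k a‖ := by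
    intro S hS
    induction S, hS using Set.Finite.induction_on with
    | empty => exact fun _ => ⟨1, one_pos, by simp⟩
    | @insert a S _ _ ih =>
      intro hsub
      obtain ⟨δ, hδ, h⟩ := ih ((Set.subset_insert _ _).trans hsub)
      obtain ⟨h0, h1⟩ := hz₀.1 a (hsub (Set.mem_insert _ _))
      change xval a z₀ ≠ 0 at h0
      change xval a z₀ ≠ k a at h1
      have h2 : 0 < ‖xval a z₀ - k a‖ := norm_pos_iff.mpr (sub_ne_zero.mpr h1)
      -- Half the ratio at z₀, so that the inequality is strict there and persists nearby.
      set δ' := ‖xval a z₀ - k a‖ / (2 * (1 + ‖xval a z₀‖)) with hδ'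
      have hδ'0 : 0 < δ' := by positivity
      have hc := (continuous_xval a).continuousAt (x := z₀)
      have h3 : δ' * (1 + ‖xval a z₀‖) < ‖xval a z₀ - k a‖ := by
        rw [hδ']
        have : ‖xval a z₀ - k a‖ / (2 * (1 + ‖xval a z₀‖)) * (1 + ‖xval a z₀‖) =
          ‖xval a z₀ - k a‖ / 2 := by field_simp
        rw [this]; linarith
      have h4 : ∀ᶠ z in nhds z₀, δ' * (1 + ‖xval a z‖) < ‖xval a z - k a‖ :=
        (continuousAt_const.mul (continuousAt_const.add hc.norm)).eventually_lt
          (hc.sub continuousAt_const).norm h3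
      refine ⟨min δ δ', lt_min hδ hδ'0, ?_⟩
      filter_upwards [h, h4, hc.eventually_ne h0] with z hz1 hz2 hz3
      rintro b (rfl | hb)
      · refine ⟨hz3, le_trans ?_ hz2.le⟩
        gcongr; exact min_le_right _ _
      · refine ⟨(hz1 b hb).1, le_trans ?_ (hz1 b hb).2⟩
        gcongr; exact min_le_left _ _
  set n : ℝ := (Fintype.card (ι ⊕ ι') : ℝ)
  have hqpos : ∀ i, 0 < D.rootV i ⬝ᵥ D.rootV i := fun i =>
    lt_of_le_of_ne (Finset.sum_nonneg fun j _ => mul_self_nonneg _) (D.root_dot_pos i).symm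
  -- N i is chosen so that |m| ≥ N i forces |(a^∨, z)| ≥ 2K + 1; with |k| ≤ K this gives |(a^∨, z) -
  -- k| ≥ (1 + |(a^∨, z)|)/2.
  have hex : ∀ i, ∃ N : ℕ, (2 * K + 1) * (D.rootV i ⬝ᵥ D.rootV i) / 2 +
      n * (‖D.rootV i‖ * (‖z₀‖ + 1)) ≤ N * (z₀.2.2.re / 2) := by
    intro i
    obtain ⟨N, hN⟩ := exists_nat_ge (((2 * K + 1) * (D.rootV i ⬝ᵥ D.rootV i) / 2 +
      n * (‖D.rootV i‖ * (‖z₀‖ + 1))) / (z₀.2.2.re / 2))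
    have : 0 < z₀.2.2.re / 2 := half_pos hz₀.2
    exact ⟨N, (div_le_iff₀ this).mp hN⟩
  choose N hN using hex
  set S : Set (Hat ℝ (ι ⊕ ι')) := ⋃ i : I, D.affRoot i '' Set.Icc (-(N i : ℤ)) (N i)
  have hSfin : S.Finite := Set.finite_iUnion fun i => (Set.finite_Icc _ _).image _
  obtain ⟨δ, hδ, h⟩ := hfin S hSfin (by
    rintro a ha
    obtain ⟨i, m, -, rfl⟩ := Set.mem_iUnion.mp ha
    exact ⟨i, m, rfl⟩)
  have hre : ∀ᶠ z : Hat ℂ (ι ⊕ ι') in nhds z₀, z₀.2.2.re / 2 < z.2.2.re := by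
    have hc : Continuous fun z : Hat ℂ (ι ⊕ ι') => z.2.2.re :=
      Complex.continuous_re.comp (continuous_snd.comp continuous_snd)
    exact continuousAt_const.eventually_lt hc.continuousAt (half_lt_self hz₀.2)
  have hnorm : ∀ᶠ z : Hat ℂ (ι ⊕ ι') in nhds z₀, ‖z‖ < ‖z₀‖ + 1 :=
    continuous_norm.continuousAt.eventually_lt continuousAt_const (by linarith)
  refine ⟨min δ (1 / 2), by positivity, ?_⟩
  filter_upwards [h, hre, hnorm] with z hz hzre hzn a ha
  obtain ⟨i, m, rfl⟩ := ha
  by_cases hm : m ∈ Set.Icc (-(N i : ℤ)) (N i)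
  · obtain ⟨h1, h2⟩ := hz _ (Set.mem_iUnion.mpr ⟨i, m, hm, rfl⟩)
    refine ⟨h1, le_trans ?_ h2⟩
    gcongr; exact min_le_left _ _
  · have hm' : (N i : ℝ) ≤ |(m : ℝ)| := by
      have : (N i : ℤ) ≤ |m| := by
        rw [Set.mem_Icc, ← abs_le, not_le] at hm
        exact hm.le
      exact_mod_cast this
    have hx : 2 * K + 1 ≤ ‖xval (D.affRoot i m) z‖ := by
      have hq := hqpos i
      have h1 : ‖(fun j => (D.rootV i j : ℂ)) ⬝ᵥ z.1‖ ≤ n * (‖D.rootV i‖ * (‖z₀‖ + 1)) := by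
        refine (norm_dotProduct_le _ _).trans ?_
        rw [norm_ofReal_pi]
        have : ‖z.1‖ ≤ ‖z₀‖ + 1 := (norm_fst_le z).trans hzn.le
        gcongr
      have h2 : N i * (z₀.2.2.re / 2) ≤ ‖(m : ℂ) * z.2.2‖ := by
        rw [norm_mul, Complex.norm_intCast]
        have h3 : z₀.2.2.re / 2 ≤ ‖z.2.2‖ := hzre.le.trans (Complex.re_le_norm _)
        have h4 : 0 < z₀.2.2.re / 2 := half_pos hz₀.2
        gcongr
      have h3 : ‖(m : ℂ) * z.2.2‖ - ‖(fun j => (D.rootV i j : ℂ)) ⬝ᵥ z.1‖ ≤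
          ‖(fun j => (D.rootV i j : ℂ)) ⬝ᵥ z.1 + m * z.2.2‖ := by
        have := norm_sub_le ((fun j => (D.rootV i j : ℂ)) ⬝ᵥ z.1 + m * z.2.2)
          ((fun j => (D.rootV i j : ℂ)) ⬝ᵥ z.1)
        rw [add_sub_cancel_left] at this
        linarith
      rw [xval_affRoot, norm_mul, Complex.norm_real, Real.norm_of_nonneg (by positivity)]
      have h4 := hN i
      calc 2 * K + 1 = 2 / (D.rootV i ⬝ᵥ D.rootV i) *
            ((2 * K + 1) * (D.rootV i ⬝ᵥ D.rootV i) / 2) := by field_simp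
        _ ≤ _ := by
          refine mul_le_mul_of_nonneg_left ?_ (by positivity)
          linarith
    have hka := hK _ ⟨i, m, rfl⟩
    refine ⟨norm_pos_iff.mp (by linarith), ?_⟩
    have h1 := norm_sub_norm_le (xval (D.affRoot i m) z) (k (D.affRoot i m))
    calc min δ (1 / 2) * (1 + ‖xval (D.affRoot i m) z‖)
        ≤ 1 / 2 * (1 + ‖xval (D.affRoot i m) z‖) := by gcongr; exact min_le_right _ _
      _ ≤ _ := by linarith

end Datum

namespace Datum

variable {I ι ι' : Type*} [Finite I] [Fintype ι] [Fintype ι'] {D : Datum I ι ι'}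
  {M : Type*} [NormedAddCommGroup M] [NormedSpace ℂ M] [FiniteDimensional ℂ M]
  (ρ : Representation ℂ D.WHat M) {k : Hat ℝ (ι ⊕ ι') → ℂ}

/-! ### The operators `π_M(J_w(z))` -/

theorem act_mul (x y : MonoidAlgebra ℂ D.WHat) : act ρ (x * y) = act ρ x ∘L act ρ y := by
  ext m
  simp [act]

theorem act_one : act ρ 1 = ContinuousLinearMap.id ℂ M := by
  ext m
  simp [act]

theorem act_add (x y : MonoidAlgebra ℂ D.WHat) : act ρ (x + y) = act ρ x + act ρ y := by
  ext m
  simp [act]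

theorem act_smul (c : ℂ) (x : MonoidAlgebra ℂ D.WHat) : act ρ (c • x) = c • act ρ x := by
  ext m
  simp [act]

theorem act_of (w : D.WHat) : act ρ (MonoidAlgebra.of ℂ D.WHat w) = repL ρ w := by
  ext m
  simp [act, repL]

theorem act_letterJ_inl (z : Hat ℂ (ι ⊕ ι')) (a : D.simpleRoots) :
    act ρ (D.letterJ k z (Sum.inl a)) = (xval a.1 z - k a.1)⁻¹ •
      (xval a.1 z • repL ρ (sref a) + k a.1 • ContinuousLinearMap.id ℂ M) := by
  rw [letterJ, act_smul, act_add, act_smul, act_smul, act_of, act_one]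

theorem act_letterJ_inr (z : Hat ℂ (ι ⊕ ι')) (ω : D.Ω) :
    act ρ (D.letterJ k z (Sum.inr ω)) = repL ρ ω.1 := by
  rw [letterJ, act_of]

theorem act_wordJ_cons (z : Hat ℂ (ι ⊕ ι')) (l : D.Letter) (L : List D.Letter) :
    act ρ (D.wordJ k z (l :: L)) =
      act ρ (D.letterJ k (cAct (D.wordElt L).1 z) l) ∘L act ρ (D.wordJ k z L) := by
  rw [wordJ, act_mul]

theorem act_cocycle_mul (hk : D.IsMultiplicity k) {z : Hat ℂ (ι ⊕ ι')} (hz : z ∈ D.reg k)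
    (u w : D.WHat) : act ρ (D.cocycle k (u * w) z) =
      act ρ (D.cocycle k u (cAct w.1 z)) ∘L act ρ (D.cocycle k w z) := by
  rw [(D.isCocycle_cocycle hk).mul u w z hz, act_mul]

theorem act_cocycle_one (hk : D.IsMultiplicity k) {z : Hat ℂ (ι ⊕ ι')} (hz : z ∈ D.reg k) :
    act ρ (D.cocycle k 1 z) = ContinuousLinearMap.id ℂ M := by
  have := D.cocycle_wordElt hk hz []
  rw [wordElt_nil] at this
  rw [this, wordJ, act_one]

/-- For a reflection letter, numerator and denominator are both of order 1 + |(a^∨, z)|. Uniform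
regularity holds with the same δ along the orbit, so the letter bounds multiply. -/
theorem exists_norm_act_wordJ_le (hk : D.IsMultiplicity k) {δ : ℝ} (hδ : 0 < δ)
    (L : List D.Letter) :
    ∃ C : ℝ, ∀ z, D.URegular k δ z → ‖act ρ (D.wordJ k z L)‖ ≤ C := by
  obtain ⟨K, hK0, hK⟩ := D.exists_multiplicity_bound hk
  induction L with
  | nil => exact ⟨‖act ρ 1‖, fun z _ => le_rfl⟩
  | cons l L ih =>
    obtain ⟨C, hC⟩ := ih
    have hl : ∃ B : ℝ, 0 ≤ B ∧ ∀ z, D.URegular k δ z → ‖act ρ (D.letterJ k z l)‖ ≤ B := by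
      cases l with
      | inl a =>
        refine ⟨(‖repL ρ (sref a)‖ + K) / δ, by positivity, fun z hz => ?_⟩
        have ha := D.simpleRoots_subset a.2
        obtain ⟨-, h1⟩ := hz a.1 ha
        have hpos : 0 < δ * (1 + ‖xval a.1 z‖) := by positivity
        have h2 : ‖xval a.1 z • repL ρ (sref a) + k a.1 • ContinuousLinearMap.id ℂ M‖ ≤
            (‖repL ρ (sref a)‖ + K) * (1 + ‖xval a.1 z‖) := by
          refine (norm_add_le _ _).trans ?_
          rw [norm_smul, norm_smul]
          have h3 : ‖k a.1‖ * ‖ContinuousLinearMap.id ℂ M‖ ≤ K * 1 :=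
            mul_le_mul (hK _ ha) ContinuousLinearMap.norm_id_le (norm_nonneg _) hK0
          have h4 := norm_nonneg (xval a.1 z)
          have h5 := norm_nonneg (repL ρ (sref a))
          have h6 : 0 ≤ K * ‖xval a.1 z‖ := by positivity
          nlinarith
        rw [act_letterJ_inl, norm_smul, norm_inv]
        calc ‖xval a.1 z - k a.1‖⁻¹ * _
            ≤ (δ * (1 + ‖xval a.1 z‖))⁻¹ * ((‖repL ρ (sref a)‖ + K) * (1 + ‖xval a.1 z‖)) := by
              gcongr
          _ = _ := by field_simp
      | inr ω =>
        exact ⟨‖repL ρ ω.1‖, norm_nonneg _, fun z _ => (congrArg norm (act_letterJ_inr ρ z ω)).le⟩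
    obtain ⟨B, hB0, hB⟩ := hl
    refine ⟨B * C, fun z hz => ?_⟩
    rw [act_wordJ_cons]
    exact (ContinuousLinearMap.opNorm_comp_le _ _).trans
      (mul_le_mul (hB _ (hz.cAct hk _)) (hC z hz) (norm_nonneg _) hB0)

theorem exists_norm_act_cocycle_le (hk : D.IsMultiplicity k) {δ : ℝ} (hδ : 0 < δ) (w : D.WHat) :
    ∃ C : ℝ, ∀ z, D.URegular k δ z → ‖act ρ (D.cocycle k w z)‖ ≤ C :=
  exists_norm_act_wordJ_le ρ hk hδ _

/-- `π_M(J_{t_y}(z))` grows at most exponentially in `y`. -/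
theorem exists_norm_act_cocycle_t_le (hk : D.IsMultiplicity k) {δ : ℝ} (hδ : 0 < δ) :
    ∃ A : ℝ, ∀ (y : D.Y) (z : Hat ℂ (ι ⊕ ι')), D.URegular k δ z →
      ‖act ρ (D.cocycle k (D.t y) z)‖ ≤ Real.exp (A * ‖y‖) := by
  -- The exponent c is additive in y by the cocycle rule, since uniform regularity persists along
  -- the orbit. Bounds for a ℤ-basis of Y and its negatives therefore suffice.
  let G (y : D.YMod) (c : ℝ) : Prop :=
    ∀ z, D.URegular k δ z → ‖act ρ (D.cocycle k (D.t y) z)‖ ≤ Real.exp c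
  have G_zero : G 0 0 := by
    intro z hz
    have : D.t (0 : D.YMod) = 1 := D.t_zero
    rw [this, act_cocycle_one ρ hk (hz.mem_reg hδ), Real.exp_zero]
    exact ContinuousLinearMap.norm_id_le
  have G_add : ∀ y y' c c', G y c → G y' c' → G (y + y') (c + c') := by
    intro y y' c c' h h' z hz
    have : D.t (y + y' : D.YMod) = D.t y * D.t y' := D.t_add y y'
    rw [this, act_cocycle_mul ρ hk (hz.mem_reg hδ), Real.exp_add]
    exact (ContinuousLinearMap.opNorm_comp_le _ _).trans
      (mul_le_mul (h _ (hz.cAct hk _)) (h' z hz) (norm_nonneg _) (Real.exp_pos _).le)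
  have G_mono : ∀ y c c', c ≤ c' → G y c → G y c' := fun y c c' hc h z hz =>
    (h z hz).trans (Real.exp_le_exp.mpr hc)
  have G_ex : ∀ y, ∃ c, G y c := by
    intro y
    obtain ⟨C, hC⟩ := exists_norm_act_cocycle_le ρ hk hδ (D.t y)
    refine ⟨C, fun z hz => (hC z hz).trans ?_⟩
    linarith [Real.add_one_le_exp C]
  have G_nsmul : ∀ y c (n : ℕ), G y c → G (n • y) (n * c) := by
    intro y c n h
    induction n with
    | zero => simpa using G_zero
    | succ n ih =>
      rw [succ_nsmul, Nat.cast_succ, add_mul, one_mul]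
      exact G_add _ _ _ _ ih h
  have G_zsmul : ∀ y c (m : ℤ), G y c → G (-y) c → G (m • y) (|(m : ℝ)| * c) := by
    intro y c m h h'
    obtain ⟨n, rfl | rfl⟩ := m.eq_nat_or_neg
    · simpa using G_nsmul y c n h
    · simpa using G_nsmul (-y) c n h'
  let b := Module.finBasis ℤ D.YMod
  have hc : ∃ c : ℝ, 0 ≤ c ∧ ∀ j, G (b j) c ∧ G (-b j) c := by
    choose c hc using fun j => G_ex (b j)
    choose c' hc' using fun j => G_ex (-b j)
    obtain ⟨B, hB⟩ := (Set.finite_range fun j => max (c j) (c' j)).bddAbove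
    refine ⟨max B 0, le_max_right _ _, fun j => ⟨G_mono _ _ _ ?_ (hc j), G_mono _ _ _ ?_ (hc' j)⟩⟩
    · exact (le_max_left _ _).trans ((hB ⟨j, rfl⟩).trans (le_max_left _ _))
    · exact (le_max_right _ _).trans ((hB ⟨j, rfl⟩).trans (le_max_left _ _))
  obtain ⟨c, hc0, hc⟩ := hc
  -- Basis coordinates of y are at most a constant times ‖y‖, which makes the exponent linear in the
  -- norm.
  refine ⟨∑ j : Fin (Module.finrank ℤ D.YMod), (ZLattice.normBound b)⁻¹ * c, fun y z hz => ?_⟩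
  have key : G y (∑ j, |((b.repr y j : ℤ) : ℝ)| * c) := by
    have hs : ∀ s : Finset (Fin (Module.finrank ℤ D.YMod)),
        G (∑ j ∈ s, b.repr y j • b j) (∑ j ∈ s, |((b.repr y j : ℤ) : ℝ)| * c) := by
      classical
      intro s
      induction s using Finset.induction_on with
      | empty => simpa using G_zero
      | insert j s hj ih =>
        rw [Finset.sum_insert hj, Finset.sum_insert hj]
        exact G_add _ _ _ _ (G_zsmul _ _ _ (hc j).1 (hc j).2) ih
    have := hs Finset.univ
    rwa [b.sum_repr y] at this
  refine G_mono y _ _ ?_ key z hz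
  rw [Finset.sum_mul]
  refine Finset.sum_le_sum fun j _ => ?_
  have h1 := ZLattice.abs_repr_le b y j
  push_cast at h1
  calc |((b.repr y j : ℤ) : ℝ)| * c ≤ ((ZLattice.normBound b)⁻¹ * ‖y‖) * c := by
        gcongr
        exact_mod_cast h1
    _ = _ := by ring

/-- A common majorant, for `z` near `z₀` and `v` in a bounded set of elements of level at least
`ζ > 0`, of the terms of the series `E_M⁺(v; z)`. -/
theorem exists_majorant (hk : D.IsMultiplicity k) {z₀ : Hat ℂ (ι ⊕ ι')} (hz₀ : z₀ ∈ D.regPlus k)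
    {R ζ : ℝ} (hζ : 0 < ζ) :
    ∃ (u : D.WHat → ℝ) (r : ℝ), Summable u ∧ 0 < r ∧ ∀ᶠ z in nhds z₀, z ∈ D.regPlus k ∧
      ∀ v : Hat ℝ (ι ⊕ ι'), ‖v‖ ≤ R → ζ ≤ v.2.2 → ∀ w : D.WHat,
        Real.exp ((formL (cAct w.1 z) v).re + r * ‖formL (cAct w.1 z)‖) *
          ‖act ρ (D.cocycle k w z)‖ ≤ u w := by
  obtain ⟨δ, hδ, hreg⟩ := D.eventually_URegular hk hz₀
  obtain ⟨A, hA⟩ := exists_norm_act_cocycle_t_le ρ hk hδ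
  choose C hC using fun u : D.W => exists_norm_act_cocycle_le ρ hk hδ u.1
  obtain ⟨Z, hZ⟩ := (Set.finite_range fun u : D.W => ‖cAct u.1.1 z₀‖ + 1).bddAbove
  have hZ' : ∀ u : D.W, ‖cAct u.1.1 z₀‖ + 1 ≤ Z := fun u => hZ ⟨u, rfl⟩
  have hZ0 : 0 < Z := (by positivity : 0 < ‖cAct (1 : D.W).1.1 z₀‖ + 1).trans_le (hZ' 1)
  have hnorm : ∀ᶠ z : Hat ℂ (ι ⊕ ι') in nhds z₀, ∀ u : D.W, ‖cAct u.1.1 z‖ < Z :=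
    Filter.eventually_all.mpr fun u => (continuous_cAct u.1.1).norm.continuousAt.eventually_lt
      continuousAt_const (by linarith [hZ' u])
  set ε := z₀.2.2.re / 2 with hε
  have hε0 : 0 < ε := half_pos hz₀.2
  have hre : ∀ᶠ z : Hat ℂ (ι ⊕ ι') in nhds z₀, ε < z.2.2.re := by
    have hc : Continuous fun z : Hat ℂ (ι ⊕ ι') => z.2.2.re :=
      Complex.continuous_re.comp (continuous_snd.comp continuous_snd)
    exact continuousAt_const.eventually_lt hc.continuousAt (half_lt_self hz₀.2)
  set n : ℝ := (Fintype.card (ι ⊕ ι') : ℝ) with hn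
  have hn0 : 0 ≤ n := Nat.cast_nonneg _
  -- This r lets the quadratic part of r‖(t_y x, ·)‖ consume at most half of the decay εζ/2; the
  -- factor n + 1 keeps the denominator positive. A₀ and A₁ below collect the constant and linear
  -- parts.
  set r : ℝ := ε * ζ / (4 * ((n + 2) * Z * (n + 1))) with hr
  have hr0 : 0 < r := by positivity
  have hrn : r * ((n + 2) * Z * n) ≤ ε * ζ / 4 := by
    calc r * ((n + 2) * Z * n) ≤ r * ((n + 2) * Z * (n + 1)) := by gcongr; linarith
      _ = _ := by rw [hr]; field_simp
  set A₀ : ℝ := (n + 2) * (Z * R) + r * ((n + 2) * Z * 3)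
  set A₁ : ℝ := 2 * n * (Z * R) + r * ((n + 2) * Z * (n + 1))
  let f : D.Y × D.W → ℝ := fun p =>
    Real.exp A₀ * Real.exp ((A₁ + A) * ‖p.1‖ - ε * ζ / 4 * ‖p.1‖ ^ 2) * C p.2
  have hf : Summable f := by
    have hs : Summable fun y : D.Y => Real.exp ((A₁ + A) * ‖y‖ - ε * ζ / 4 * ‖y‖ ^ 2) :=
      summable_gaussian D.YMod (A₁ + A) (by positivity)
    have hfs : Summable fun q : D.W × D.Y =>
        Real.exp A₀ * Real.exp ((A₁ + A) * ‖q.2‖ - ε * ζ / 4 * ‖q.2‖ ^ 2) * C q.1 := by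
      -- The bounds C are not known to be nonnegative, so the product of series is formed with |C|.
      have := (hs.mul_left (Real.exp A₀)).mul_of_nonneg
        (g := fun u : D.W => |C u|) (summable_of_hasFiniteSupport (Set.toFinite _))
        (fun y => by positivity) (fun u => abs_nonneg _)
      refine Summable.of_norm_bounded ((Equiv.prodComm D.W D.Y).summable_iff.mpr this) fun q => ?_
      simp
    exact (Equiv.prodComm D.Y D.W).summable_iff.mpr hfs
  refine ⟨fun w => f (D.prodEquiv.symm w), r, D.prodEquiv.symm.summable_iff.mpr hf, hr0, ?_⟩
  filter_upwards [hreg, hnorm, hre] with z hz1 hz2 hz3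
  refine ⟨⟨hz1.mem_reg hδ, hε0.trans hz3⟩, fun v hv1 hv2 w => ?_⟩
  obtain ⟨⟨y, u⟩, rfl⟩ := D.prodEquiv.surjective w
  rw [Equiv.symm_apply_apply, prodEquiv_apply, act_cocycle_mul ρ hk (hz1.mem_reg hδ)]
  have e : cAct (D.t y * u.1).1 z = cAct (transl (y : ι ⊕ ι' → ℝ)) (cAct u.1.1 z) :=
    D.cAct_WHat_mul (D.t y) u.1 z
  rw [e]
  have hx := (hz2 u).le
  have hlev : ε ≤ (cAct u.1.1 z).2.2.re := by rw [cAct_WHat_level]; exact hz3.le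
  set x := cAct u.1.1 z
  have h1 := re_form_transl_le (y := (y : ι ⊕ ι' → ℝ)) hε0.le hlev hζ.le hv2
  have h2 := (norm_formL_le (cAct (transl (y : ι ⊕ ι' → ℝ)) x)).trans
    (mul_le_mul_of_nonneg_left (norm_cAct_transl_le (y : ι ⊕ ι' → ℝ) x)
      (by positivity))
  rw [← hn] at h1 h2
  have hy : ‖(y : ι ⊕ ι' → ℝ)‖ = ‖y‖ := rfl
  rw [hy] at h1 h2
  have hy0 := norm_nonneg y
  have hxv : ‖x‖ * ‖v‖ ≤ Z * R := mul_le_mul hx hv1 (norm_nonneg _) hZ0.le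
  have h3 : (form (cAct (transl (y : ι ⊕ ι' → ℝ)) x) (toC v)).re ≤
      (n + 2) * (Z * R) + 2 * n * (Z * R) * ‖y‖ - ε * ζ / 2 * ‖y‖ ^ 2 := by
    refine h1.trans ?_
    gcongr
  have h4 : r * ‖formL (cAct (transl (y : ι ⊕ ι' → ℝ)) x)‖ ≤
      r * ((n + 2) * Z * 3) + r * ((n + 2) * Z * (n + 1)) * ‖y‖ + ε * ζ / 4 * ‖y‖ ^ 2 := by
    calc r * ‖formL (cAct (transl (y : ι ⊕ ι' → ℝ)) x)‖
        ≤ r * ((n + 2) * (Z * (3 + (n + 1) * ‖y‖ + n * ‖y‖ ^ 2))) := by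
          refine mul_le_mul_of_nonneg_left (h2.trans ?_) hr0.le
          gcongr
      _ = r * ((n + 2) * Z * 3) + r * ((n + 2) * Z * (n + 1)) * ‖y‖ +
          r * ((n + 2) * Z * n) * ‖y‖ ^ 2 := by ring
      _ ≤ _ := by gcongr
  have h5 : ‖act ρ (D.cocycle k (D.t y) x) ∘L act ρ (D.cocycle k u.1 z)‖ ≤
      Real.exp (A * ‖y‖) * C u :=
    (ContinuousLinearMap.opNorm_comp_le _ _).trans
      (mul_le_mul (hA y x (hz1.cAct hk u.1)) (hC u z hz1) (norm_nonneg _) (Real.exp_pos _).le)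
  calc _ ≤ Real.exp (A₀ + A₁ * ‖y‖ - ε * ζ / 4 * ‖y‖ ^ 2) * (Real.exp (A * ‖y‖) * C u) := by
        refine mul_le_mul (Real.exp_le_exp.mpr ?_) h5 (norm_nonneg _) (Real.exp_pos _).le
        rw [formL_apply]
        simp only [A₀, A₁]
        linarith
    _ = f (y, u) := by
        simp only [f]
        rw [← mul_assoc, ← Real.exp_add, ← Real.exp_add]
        congr 2
        ring

end Datum

namespace Datum

variable {I ι ι' : Type*} [Finite I] [Fintype ι] [Fintype ι'] {D : Datum I ι ι'}
  {M : Type*} [NormedAddCommGroup M] [NormedSpace ℂ M] [FiniteDimensional ℂ M]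
  (ρ : Representation ℂ D.WHat M) {k : Hat ℝ (ι ⊕ ι') → ℂ}

/-! ### Convergence, and the equations in `z` -/

theorem expSummable_WHat (hk : D.IsMultiplicity k) {z : Hat ℂ (ι ⊕ ι')} (hz : z ∈ D.regPlus k)
    {v : Hat ℝ (ι ⊕ ι')} (hv : v ∈ VPlus (ι ⊕ ι')) :
    ExpSummable (fun w : D.WHat => formL (cAct w.1 z))
      (fun w => act ρ (D.cocycle k w z)) v := by
  obtain ⟨u, r, hu, hr, h⟩ := exists_majorant ρ hk hz (R := ‖v‖) hv
  exact ⟨r, hr, Summable.of_nonneg_of_le (fun w => by positivity)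
    (h.self_of_nhds.2 v le_rfl le_rfl) hu⟩

theorem expSummable_Y (hk : D.IsMultiplicity k) {z : Hat ℂ (ι ⊕ ι')} (hz : z ∈ D.regPlus k)
    {v : Hat ℝ (ι ⊕ ι')} (hv : v ∈ VPlus (ι ⊕ ι')) :
    ExpSummable (fun y : D.Y => formL (cAct (D.t y).1 z))
      (fun y => act ρ (D.cocycle k (D.t y) z)) v := by
  obtain ⟨r, hr, h⟩ := expSummable_WHat ρ hk hz hv
  exact ⟨r, hr, h.comp_injective D.t_injective⟩

theorem summable_term (hk : D.IsMultiplicity k) {z : Hat ℂ (ι ⊕ ι')} (hz : z ∈ D.regPlus k)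
    {v : Hat ℝ (ι ⊕ ι')} (hv : v ∈ VPlus (ι ⊕ ι')) :
    Summable fun w : D.WHat => term ρ (D.cocycle k) v z w :=
  (expSummable_WHat ρ hk hz hv).summable_norm.of_norm

theorem summable_term_t (hk : D.IsMultiplicity k) {z : Hat ℂ (ι ⊕ ι')} (hz : z ∈ D.regPlus k)
    {v : Hat ℝ (ι ⊕ ι')} (hv : v ∈ VPlus (ι ⊕ ι')) :
    Summable fun y : D.Y => term ρ (D.cocycle k) v z (D.t y) :=
  (summable_term ρ hk hz hv).comp_injective D.t_injective

theorem term_mul (hk : D.IsMultiplicity k) {z : Hat ℂ (ι ⊕ ι')} (hz : z ∈ D.reg k)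
    (v : Hat ℝ (ι ⊕ ι')) (u w : D.WHat) : term ρ (D.cocycle k) v z (u * w) =
      term ρ (D.cocycle k) v (cAct w.1 z) u ∘L act ρ (D.cocycle k w z) := by
  rw [term, term, act_cocycle_mul ρ hk hz, cAct_WHat_mul, ContinuousLinearMap.smul_comp]

/-- Every w is uniquely t_y u with u in the finite group W, and the cocycle rule factors the term
accordingly. -/
theorem EPlus_eq_finsum (hk : D.IsMultiplicity k) {z : Hat ℂ (ι ⊕ ι')} (hz : z ∈ D.regPlus k)
    {v : Hat ℝ (ι ⊕ ι')} (hv : v ∈ VPlus (ι ⊕ ι')) :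
    EPlus ρ (D.cocycle k) v z = ∑ᶠ w : D.W,
      E ρ (D.cocycle k) v (cAct w.1.1 z) ∘L act ρ (D.cocycle k w.1 z) := by
  have hs := summable_term ρ hk hz hv
  have hfin : Fintype D.W := Fintype.ofFinite _
  obtain ⟨e, he⟩ : ∃ e : D.W × D.Y ≃ D.WHat, ∀ p, e p = D.t p.2 * p.1.1 :=
    ⟨(Equiv.prodComm D.W D.Y).trans D.prodEquiv, fun p => D.prodEquiv_apply p.2 p.1⟩
  have hs' := e.summable_iff.mpr hs
  have h1 := e.tsum_eq (term ρ (D.cocycle k) v z)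
  simp only [Function.comp_def, he] at hs' h1
  rw [EPlus, ← h1, hs'.tsum_prod, tsum_fintype, finsum_eq_sum_of_fintype]
  refine Finset.sum_congr rfl fun w _ => ?_
  have h2 := (summable_term_t ρ hk (regPlus_cAct hk w.1 hz) hv).tsum_mul_right
    (act ρ (D.cocycle k w.1 z))
  exact (tsum_congr fun y => term_mul ρ hk hz.1 v (D.t y) w.1).trans h2

/-- Reindexing by w ↦ wg. It is valid for all g in Ŵ^Y, so it yields both the difference equations
and W-invariance. -/
theorem EPlus_cAct (hk : D.IsMultiplicity k) {z : Hat ℂ (ι ⊕ ι')} (hz : z ∈ D.regPlus k)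
    {v : Hat ℝ (ι ⊕ ι')} (hv : v ∈ VPlus (ι ⊕ ι')) (g : D.WHat) :
    EPlus ρ (D.cocycle k) v (cAct g.1 z) ∘L act ρ (D.cocycle k g z) =
      EPlus ρ (D.cocycle k) v z := by
  refine ((summable_term ρ hk (regPlus_cAct hk g hz) hv).tsum_mul_right _).symm.trans ?_
  rw [EPlus, ← (Equiv.mulRight g).tsum_eq (term ρ (D.cocycle k) v z)]
  exact tsum_congr fun w => (term_mul ρ hk hz.1 v w g).symm

theorem E_cAct (hk : D.IsMultiplicity k) {z : Hat ℂ (ι ⊕ ι')} (hz : z ∈ D.regPlus k)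
    {v : Hat ℝ (ι ⊕ ι')} (hv : v ∈ VPlus (ι ⊕ ι')) (y : D.Y) :
    E ρ (D.cocycle k) v (cAct (D.t y).1 z) ∘L act ρ (D.cocycle k (D.t y) z) =
      E ρ (D.cocycle k) v z := by
  refine ((summable_term_t ρ hk (regPlus_cAct hk (D.t y) hz) hv).tsum_mul_right _).symm.trans ?_
  rw [E, ← (Equiv.addRight y).tsum_eq fun y => term ρ (D.cocycle k) v z (D.t y)]
  refine tsum_congr fun y' => ?_
  rw [Equiv.coe_addRight, t_add, term_mul ρ hk hz.1]
  rfl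

theorem toC_cVec {κ : Type*} : toC (cVec : Hat ℝ κ) = cVec := by
  refine Prod.ext ?_ (Prod.ext ?_ ?_)
  · funext j; simp [toC, cVec]
  · simp [toC, cVec]
  · simp [toC, cVec]

theorem cAct_add_smul_cVec (w : D.WHat) (z : Hat ℂ (ι ⊕ ι')) (c : ℂ) :
    cAct w.1 (z + c • cVec) = cAct w.1 z + c • cVec := by
  rw [cAct_add, cAct_smul, ← toC_cVec, cAct_toC, WHat_cVec]

theorem xval_add_smul_cVec {a : Hat ℝ (ι ⊕ ι')} (ha : a ∈ D.affRoots) (z : Hat ℂ (ι ⊕ ι'))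
    (c : ℂ) : xval a (z + c • cVec) = xval a z := by
  rw [xval, form_add_right, form_smul_right, form_cVec]
  have : (toC (vee a)).2.2 = 0 := by simp [toC, vee, D.level_of_mem ha]
  rw [this, mul_zero, add_zero, xval]

/-- Affine roots have level 0, hence their pairings ignore multiples of c. So in z-direction c only
the exponential factors of the series vary. -/
theorem wordJ_add_smul_cVec (z : Hat ℂ (ι ⊕ ι')) (c : ℂ) (L : List D.Letter) :
    D.wordJ k (z + c • cVec) L = D.wordJ k z L := by
  induction L with
  | nil => rfl
  | cons l L ih =>
    rw [wordJ, wordJ, ih, cAct_add_smul_cVec]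
    congr 1
    cases l with
    | inl a => rw [letterJ, letterJ, xval_add_smul_cVec (D.simpleRoots_subset a.2)]
    | inr ω => rfl

theorem term_add_smul_cVec (v : Hat ℝ (ι ⊕ ι')) (z : Hat ℂ (ι ⊕ ι')) (c : ℂ) (w : D.WHat) :
    term ρ (D.cocycle k) v (z + c • cVec) w =
      Complex.exp (c * v.2.2) • term ρ (D.cocycle k) v z w := by
  have h : form (cVec : Hat ℂ (ι ⊕ ι')) (toC v) = v.2.2 := by rw [form_comm, form_cVec]; rfl
  rw [term, term, cocycle, wordJ_add_smul_cVec, cAct_add_smul_cVec, form_add_left,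
    form_smul_left, h, Complex.exp_add, mul_comm, mul_smul, cocycle]

theorem lineDeriv_eq_of_exp {E G : Type*} [AddCommGroup E] [Module ℂ E] [NormedAddCommGroup G]
    [NormedSpace ℂ G] {Ψ : E → G} {z u : E} {ξ : ℂ}
    (h : ∀ c : ℂ, Ψ (z + c • u) = Complex.exp (c * ξ) • Ψ z) :
    lineDeriv ℂ Ψ z u = ξ • Ψ z := by
  rw [lineDeriv]
  simp only [h]
  have h1 : HasDerivAt (fun c : ℂ => Complex.exp (c * ξ)) ξ 0 := by
    simpa using ((hasDerivAt_id (0 : ℂ)).mul_const ξ).cexp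
  exact (h1.smul_const (Ψ z)).deriv

theorem differentiableAt_form {κ : Type*} [Fintype κ] (f z : Hat ℂ κ) :
    DifferentiableAt ℂ (fun z => form f z) z := by
  let l : Hat ℂ κ →ₗ[ℂ] ℂ :=
    { toFun := form f
      map_add' := fun x y => form_add_right _ _ _
      map_smul' := fun r x => form_smul_right _ _ _ }
  exact l.toContinuousLinearMap.differentiableAt

theorem differentiableAt_cAct {κ : Type*} [Fintype κ] (g : Hat ℝ κ ≃ₗ[ℝ] Hat ℝ κ)
    (z : Hat ℂ κ) : DifferentiableAt ℂ (cAct g) z :=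
  (cActL g).toContinuousLinearMap.differentiableAt

theorem differentiableAt_act_wordJ (hk : D.IsMultiplicity k) {z : Hat ℂ (ι ⊕ ι')}
    (hz : z ∈ D.reg k) (L : List D.Letter) :
    DifferentiableAt ℂ (fun z => act ρ (D.wordJ k z L)) z := by
  induction L with
  | nil => exact differentiableAt_const (act ρ (1 : MonoidAlgebra ℂ D.WHat))
  | cons l L ih =>
    simp only [act_wordJ_cons]
    refine DifferentiableAt.clm_comp ?_ ih
    cases l with
    | inl a =>
      simp only [act_letterJ_inl]
      have hx : DifferentiableAt ℂ (fun z => xval a.1 (cAct (D.wordElt L).1 z)) z :=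
        (differentiableAt_form (toC (vee a.1)) _).comp z (differentiableAt_cAct _ z)
      have hne : xval a.1 (cAct (D.wordElt L).1 z) - k a.1 ≠ 0 :=
        sub_ne_zero.mpr (reg_cAct hk _ hz a.1 (D.simpleRoots_subset a.2)).2
      exact ((hx.sub_const _).inv hne).smul ((hx.smul_const _).add_const _)
    | inr ω =>
      simp only [act_letterJ_inr]
      exact differentiableAt_const _

theorem differentiableAt_term (hk : D.IsMultiplicity k) {z : Hat ℂ (ι ⊕ ι')}
    (hz : z ∈ D.reg k) (v : Hat ℝ (ι ⊕ ι')) (w : D.WHat) :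
    DifferentiableAt ℂ (fun z => term ρ (D.cocycle k) v z w) z := by
  refine DifferentiableAt.fun_smul (DifferentiableAt.cexp ?_) (differentiableAt_act_wordJ ρ hk hz _)
  simp only [form_comm _ (toC v)]
  exact (differentiableAt_form (toC v) _).comp z (differentiableAt_cAct _ z)

theorem differentiableAt_tsum_term (hk : D.IsMultiplicity k) {z : Hat ℂ (ι ⊕ ι')}
    (hz : z ∈ D.regPlus k) {v : Hat ℝ (ι ⊕ ι')} (hv : v ∈ VPlus (ι ⊕ ι')) {X : Type*}
    {g : X → D.WHat} (hg : Function.Injective g) :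
    DifferentiableAt ℂ (fun z => ∑' x, term ρ (D.cocycle k) v z (g x)) z := by
  obtain ⟨u, r, hu, hr, h⟩ := exists_majorant ρ hk hz (R := ‖v‖) hv
  obtain ⟨ε, hε, hb⟩ := Metric.eventually_nhds_iff_ball.mp h
  refine differentiableAt_tsum_of_ball (hu.comp_injective hg) hε
    (fun i x hx => differentiableAt_term ρ hk (hb x hx).1.1 v _) fun i x hx => ?_
  refine le_trans ?_ ((hb x hx).2 v le_rfl le_rfl (g i))
  rw [term, norm_smul, Complex.norm_exp, ← formL_apply]
  refine mul_le_mul_of_nonneg_right (Real.exp_le_exp.mpr ?_) (norm_nonneg _)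
  have : 0 ≤ r * ‖formL (cAct (g i).1 x)‖ := by positivity
  linarith

theorem memAdKZ_E (hk : D.IsMultiplicity k) {v : Hat ℝ (ι ⊕ ι')} (hv : v ∈ VPlus (ι ⊕ ι')) :
    MemAdKZ ρ k (D.cocycle k) v.2.2 (E ρ (D.cocycle k) v) := by
  refine ⟨fun z hz => differentiableAt_tsum_term ρ hk hz hv D.t_injective, fun z hz => ?_,
    fun y z hz => E_cAct ρ hk hz hv y⟩
  refine lineDeriv_eq_of_exp fun c => ?_
  rw [E, E, ← (summable_term_t ρ hk hz hv).tsum_const_smul]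
  exact tsum_congr fun y => term_add_smul_cVec ρ v z c _

theorem memAdKZ_EPlus (hk : D.IsMultiplicity k) {v : Hat ℝ (ι ⊕ ι')} (hv : v ∈ VPlus (ι ⊕ ι')) :
    MemAdKZ ρ k (D.cocycle k) v.2.2 (EPlus ρ (D.cocycle k) v) := by
  refine ⟨fun z hz => differentiableAt_tsum_term ρ hk hz hv Function.injective_id, fun z hz => ?_,
    fun y z hz => EPlus_cAct ρ hk hz hv _⟩
  refine lineDeriv_eq_of_exp fun c => ?_
  rw [EPlus, EPlus, ← (summable_term ρ hk hz hv).tsum_const_smul]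
  exact tsum_congr fun w => term_add_smul_cVec ρ v z c w

/-! ### The equations in `v` -/

theorem isOpen_VPlus (κ : Type*) : IsOpen (VPlus κ) :=
  isOpen_lt continuous_const (continuous_snd.comp continuous_snd)

theorem formL_cVec {κ : Type*} [Fintype κ] (x : Hat ℂ κ) : formL x cVec = x.2.2 := by
  rw [formL_apply, toC_cVec, form_cVec]

theorem formL_dVec {κ : Type*} [Fintype κ] (x : Hat ℂ κ) : formL x dVec = x.2.1 := by
  simp [formL_apply, form, toC, dVec, dotProduct]

theorem formL_single {κ : Type*} [Fintype κ] [DecidableEq κ] (x : Hat ℂ κ) (j : κ) :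
    formL x (Pi.single j 1, 0, 0) = x.1 j := by
  have : (toC ((Pi.single j 1, 0, 0) : Hat ℝ κ)).1 = Pi.single j 1 := by
    funext i
    by_cases h : i = j
    · subst h; simp [toC]
    · simp [toC, h]
  rw [formL_apply, form, this, dotProduct_single]
  simp [toC]

theorem memLevel_tsum {κ X G : Type*} [Fintype κ] [NormedAddCommGroup G] [NormedSpace ℂ G]
    [FiniteDimensional ℂ G] {x : X → Hat ℂ κ} {A : X → G →L[ℂ] G} {γ : ℂ}
    (hs : ∀ v ∈ VPlus κ, ExpSummable (fun i => formL (x i)) A v) (hx : ∀ i, (x i).2.2 = γ) :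
    MemLevel γ fun v => ∑' i, Complex.exp (formL (x i) v) • A i := by
  have hc : CompleteSpace G := FiniteDimensional.complete ℂ G
  refine ⟨fun v hv => (hs v hv).analyticAt, fun v hv => ?_⟩
  rw [(hs v hv).lineDeriv_eq]
  simp only [formL_cVec, hx]
  rw [← (hs v hv).summable_norm.of_norm.tsum_const_smul]
  exact tsum_congr fun i => smul_comm _ _ _

/-- The exponential of (x, ·) is an eigenfunction of Δ + 2∂_c∂_d with eigenvalue (x, x), which is
the same for all terms. -/
theorem laplaceHat_tsum {κ X G : Type*} [Fintype κ] [NormedAddCommGroup G] [NormedSpace ℂ G]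
    [FiniteDimensional ℂ G] {x : X → Hat ℂ κ} {A : X → G →L[ℂ] G} {Γ : ℂ}
    (hs : ∀ v ∈ VPlus κ, ExpSummable (fun i => formL (x i)) A v) (hx : ∀ i, form (x i) (x i) = Γ)
    {v : Hat ℝ κ} (hv : v ∈ VPlus κ) :
    laplaceHat (fun v => ∑' i, Complex.exp (formL (x i) v) • A i) v =
      Γ • ∑' i, Complex.exp (formL (x i) v) • A i := by
  classical
  have hc : CompleteSpace G := FiniteDimensional.complete ℂ G
  have h2 : ∀ u u' : Hat ℝ κ, HasSum
      (fun i => Complex.exp (formL (x i) v) • formL (x i) u' • formL (x i) u • A i)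
      (lineDeriv ℝ (fun y => lineDeriv ℝ
        (fun v => ∑' i, Complex.exp (formL (x i) v) • A i) y u) v u') := by
    intro u u'
    -- The formula for the first derivative is needed on a neighbourhood of v before differentiating
    -- again.
    have e : (fun y => lineDeriv ℝ (fun v => ∑' i, Complex.exp (formL (x i) v) • A i) y u)
        =ᶠ[nhds v] fun y => ∑' i, Complex.exp (formL (x i) y) • formL (x i) u • A i := by
      filter_upwards [(isOpen_VPlus κ).mem_nhds hv] with y hy
      exact (hs y hy).lineDeriv_eq u
    rw [e.lineDeriv_eq, ((hs v hv).smul u).lineDeriv_eq]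
    exact (((hs v hv).smul u).smul u').summable_norm.of_norm.hasSum
  have h3 : HasSum (fun i => Γ • Complex.exp (formL (x i) v) • A i)
      (laplaceHat (fun v => ∑' i, Complex.exp (formL (x i) v) • A i) v) := by
    refine HasSum.congr_fun ((hasSum_sum fun j _ => h2 (Pi.single j 1, 0, 0)
      (Pi.single j 1, 0, 0)).add ((h2 dVec cVec).const_smul (2 : ℂ))) fun i => ?_
    simp only [formL_cVec, formL_dVec, formL_single, ← hx i, form, dotProduct]
    simp only [smul_smul, ← Finset.sum_smul, ← add_smul]
    congr 1
    simp only [add_mul, Finset.sum_mul]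
    rw [add_assoc]
    congr 1
    · exact Finset.sum_congr rfl fun j _ => by ring
    · ring
  rw [← h3.tsum_eq, (hs v hv).summable_norm.of_norm.tsum_const_smul]

theorem memLevel_E (hk : D.IsMultiplicity k) {z : Hat ℂ (ι ⊕ ι')} (hz : z ∈ D.regPlus k) :
    MemLevel z.2.2 fun v => E ρ (D.cocycle k) v z :=
  memLevel_tsum (fun _ hv => expSummable_Y ρ hk hz hv) fun _ => D.cAct_WHat_level _ z

theorem memS_EPlus (hk : D.IsMultiplicity k) {z : Hat ℂ (ι ⊕ ι')} (hz : z ∈ D.regPlus k) :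
    MemS z.2.2 (form z z) fun v => EPlus ρ (D.cocycle k) v z :=
  ⟨memLevel_tsum (fun _ hv => expSummable_WHat ρ hk hz hv) fun _ => D.cAct_WHat_level _ z,
    fun _ hv => laplaceHat_tsum (fun _ hv => expSummable_WHat ρ hk hz hv)
      (fun w => form_cAct (D.form_WHat w) z z) hv⟩

end Datum

namespace Datum

variable {I ι ι' : Type*} [Finite I] [Fintype ι] [Fintype ι'] {D : Datum I ι ι'}
  {M : Type*} [NormedAddCommGroup M] [NormedSpace ℂ M] [FiniteDimensional ℂ M]
  (ρ : Representation ℂ D.WHat M) {k : Hat ℝ (ι ⊕ ι') → ℂ}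

/-! ### Invariance under the integral-reflection operators -/

theorem form_cAct_toC_inv (g w : D.WHat) (z : Hat ℂ (ι ⊕ ι')) (v : Hat ℝ (ι ⊕ ι')) :
    form (cAct w.1 z) (toC ((g⁻¹).1 v)) = form (cAct (g * w).1 z) (toC v) := by
  rw [cAct_WHat_mul, form_comm (cAct g.1 _), form_cAct_eq, cAct_toC, form_comm]

theorem WHat_mem_VPlus (w : D.WHat) {v : Hat ℝ (ι ⊕ ι')} (hv : v ∈ VPlus (ι ⊕ ι')) :
    w.1 v ∈ VPlus (ι ⊕ ι') := by
  change 0 < (w.1 v).2.2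
  rw [WHat_level]; exact hv

theorem sub_smul_vee_level {a : Hat ℝ (ι ⊕ ι')} (ha : a ∈ D.affRoots) (v : Hat ℝ (ι ⊕ ι'))
    (τ : ℝ) : (v - τ • vee a).2.2 = v.2.2 := by
  simp [vee, D.level_of_mem ha]

/-- To be fixed by all products of the generating operators on `V̂⁺`, it suffices to be fixed by
each of them. -/
theorem isQInvariant_of_generators {f : Hat ℝ (ι ⊕ ι') → M →L[ℂ] M}
    (hs : ∀ a : D.affRoots, a.1 ∈ D.simpleRoots → Set.EqOn (qRefl ρ k a f) f (VPlus (ι ⊕ ι')))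
    (hω : ∀ ω ∈ D.Ω, Set.EqOn (qOmega ρ ω f) f (VPlus (ι ⊕ ι'))) : IsQInvariant ρ k f := by
  intro q hq
  -- A product applies one operator to the output of another, which agrees with f only on V̂⁺; the
  -- induction therefore runs over all such functions. The generators only use values on V̂⁺.
  suffices h : ∀ g, Set.EqOn g f (VPlus (ι ⊕ ι')) → Set.EqOn (q g) f (VPlus (ι ⊕ ι')) from
    h f fun _ _ => rfl
  induction hq using Submonoid.closure_induction with
  | mem q hq =>
    intro g hg v hv
    rcases hq with ⟨a, ha, rfl⟩ | ⟨ω, hω', rfl⟩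
    · rw [← hs a ha hv]
      have h1 : g ((D.s a).1⁻¹ v) = f ((D.s a).1⁻¹ v) := hg (WHat_mem_VPlus (D.s a)⁻¹ hv)
      have h2 : ∀ τ : ℝ, g (v - τ • vee a.1) = f (v - τ • vee a.1) := fun τ => hg (by
        change 0 < (v - τ • vee a.1).2.2
        rw [sub_smul_vee_level a.2]; exact hv)
      rw [qRefl, qRefl, h1]
      simp only [h2]
    · rw [← hω ω hω' hv, qOmega, qOmega]
      exact congrArg _ (hg (WHat_mem_VPlus ω⁻¹ hv))
  | one => exact fun g hg => hg
  | mul q q' _ _ ih ih' => exact fun g hg => ih _ (ih' g hg)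

theorem qOmega_EPlus (hk : D.IsMultiplicity k) {z : Hat ℂ (ι ⊕ ι')} (hz : z ∈ D.regPlus k)
    {ω : D.WHat} (hω : ω ∈ D.Ω) :
    Set.EqOn (qOmega ρ ω fun v => EPlus ρ (D.cocycle k) v z) (fun v => EPlus ρ (D.cocycle k) v z)
      (VPlus (ι ⊕ ι')) := by
  intro v hv
  have h := summable_term ρ hk hz (WHat_mem_VPlus ω⁻¹ hv)
  refine (h.tsum_mul_left (repL ρ ω)).symm.trans ?_
  change _ = ∑' w, term ρ (D.cocycle k) v z w
  rw [← (Equiv.mulLeft ω).tsum_eq (term ρ (D.cocycle k) v z)]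
  refine tsum_congr fun w => ?_
  change repL ρ ω ∘L term ρ (D.cocycle k) ((ω⁻¹).1 v) z w = term ρ (D.cocycle k) v z (ω * w)
  rw [term, term, act_cocycle_mul ρ hk hz.1,
    (D.isCocycle_cocycle hk).omega ω hω _ (reg_cAct hk w hz.1), act_of, form_cAct_toC_inv,
    ContinuousLinearMap.comp_smul]

/-- The integrand is an exponential in τ with rate -(a^∨, wz). At the end point v - (a, v)a^∨ is s_a
v, and (wz, s_a v) = (s_a wz, v). -/
theorem integral_term_sub_smul_vee {a : Hat ℝ (ι ⊕ ι')} (ha : a ∈ D.affRoots)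
    {z : Hat ℂ (ι ⊕ ι')} (v : Hat ℝ (ι ⊕ ι')) {w : D.WHat} (hx : xval a (cAct w.1 z) ≠ 0) :
    ∫ τ in (0 : ℝ)..form a v, term ρ (D.cocycle k) (v - τ • vee a) z w =
      ((xval a (cAct w.1 z))⁻¹ * (Complex.exp (form (cAct w.1 z) (toC v)) -
        Complex.exp (form (cAct (D.s ⟨a, ha⟩ * w).1 z) (toC v)))) •
          act ρ (D.cocycle k w z) := by
  set x := cAct w.1 z with hxdef
  have h1 : ∀ τ : ℝ, term ρ (D.cocycle k) (v - τ • vee a) z w =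
      (Complex.exp (form x (toC v)) * Complex.exp (-xval a x * τ)) • act ρ (D.cocycle k w z) := by
    intro τ
    rw [term, ← hxdef, toC_sub, toC_smul, form_sub_right, form_smul_right,
      form_comm x (toC (vee a)),
      ← Complex.exp_add]
    congr 2
    rw [xval]; ring
  have h2 : form (cAct (D.s ⟨a, ha⟩ * w).1 z) (toC v) =
      form x (toC v) + -xval a x * (form a v : ℝ) := by
    rw [cAct_WHat_mul, ← hxdef, s_coe, cAct_refl, form_sub_left, form_smul_left, form_toC_toC, xval]
    ring
  simp only [h1]
  rw [intervalIntegral.integral_smul_const, intervalIntegral.integral_const_mul,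
    integral_exp_mul_complex (neg_ne_zero.mpr hx), h2, Complex.exp_add]
  congr 1
  simp only [Complex.ofReal_zero, mul_zero, Complex.exp_zero]
  field_simp
  ring

/-- Dominated convergence: on the segment from v to s_a v the norm is bounded and the level
constant, so one majorant serves all τ. -/
theorem hasSum_integral_EPlus (hk : D.IsMultiplicity k) {z : Hat ℂ (ι ⊕ ι')}
    (hz : z ∈ D.regPlus k) {a : Hat ℝ (ι ⊕ ι')} (ha : a ∈ D.affRoots) {v : Hat ℝ (ι ⊕ ι')}
    (hv : v ∈ VPlus (ι ⊕ ι')) :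
    HasSum (fun w => ∫ τ in (0 : ℝ)..form a v, term ρ (D.cocycle k) (v - τ • vee a) z w)
      (∫ τ in (0 : ℝ)..form a v, EPlus ρ (D.cocycle k) (v - τ • vee a) z) := by
  obtain ⟨u, r, hu, hr, h⟩ := exists_majorant ρ hk hz
    (R := ‖v‖ + |form a v| * ‖vee a‖) hv
  have hmem : ∀ τ : ℝ, v - τ • vee a ∈ VPlus (ι ⊕ ι') := fun τ => by
    change 0 < (v - τ • vee a).2.2
    rw [sub_smul_vee_level ha]; exact hv
  refine intervalIntegral.hasSum_integral_of_dominated_convergence (fun w _ => u w)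
    (fun w => ?_) (fun w => ?_) (.of_forall fun _ _ => hu) intervalIntegrable_const
    (.of_forall fun τ _ => (summable_term ρ hk hz (hmem τ)).hasSum)
  · refine Continuous.aestronglyMeasurable ?_
    change Continuous fun τ : ℝ =>
      Complex.exp (formL (cAct w.1 z) (v - τ • vee a)) • act ρ (D.cocycle k w z)
    fun_prop
  · refine .of_forall fun τ hτ => ?_
    have hτ' : |τ| ≤ |form a v| := by
      have := Set.abs_sub_left_of_mem_uIcc (Set.uIoc_subset_uIcc hτ)
      simpa using this
    refine le_trans ?_ (h.self_of_nhds.2 (v - τ • vee a) ?_ (sub_smul_vee_level ha v τ).ge w)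
    · rw [term, norm_smul, Complex.norm_exp, ← formL_apply]
      refine mul_le_mul_of_nonneg_right (Real.exp_le_exp.mpr ?_) (norm_nonneg _)
      have : 0 ≤ r * ‖formL (cAct w.1 z)‖ := by positivity
      linarith
    · refine (norm_sub_le _ _).trans ?_
      rw [norm_smul, Real.norm_eq_abs]
      gcongr

theorem qRefl_EPlus (hk : D.IsMultiplicity k) {z : Hat ℂ (ι ⊕ ι')} (hz : z ∈ D.regPlus k)
    {a : D.affRoots} (ha : a.1 ∈ D.simpleRoots) :
    Set.EqOn (qRefl ρ k a fun v => EPlus ρ (D.cocycle k) v z)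
      (fun v => EPlus ρ (D.cocycle k) v z) (VPlus (ι ⊕ ι')) := by
  intro v hv
  have hx : ∀ w : D.WHat, xval a.1 (cAct w.1 z) ≠ 0 ∧ xval a.1 (cAct w.1 z) ≠ k a.1 := fun w =>
    reg_cAct hk w hz.1 a.1 a.2
  have hxs : ∀ w : D.WHat, xval a.1 (cAct (D.s a * w).1 z) = -xval a.1 (cAct w.1 z) := by
    intro w
    rw [cAct_WHat_mul, xval_cAct, s_inv, s_coe, refl_self (D.form_affRoot_ne a.2), xval_neg]
  have hact : ∀ w : D.WHat, act ρ (D.cocycle k (D.s a * w) z) =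
      (xval a.1 (cAct w.1 z) - k a.1)⁻¹ • (xval a.1 (cAct w.1 z) •
        (repL ρ (D.s a) ∘L act ρ (D.cocycle k w z)) + k a.1 • act ρ (D.cocycle k w z)) := by
    intro w
    rw [act_cocycle_mul ρ hk hz.1, (D.isCocycle_cocycle hk).simple a.1 ha _ (reg_cAct hk w hz.1),
      act_smul, act_add, act_smul, act_smul, act_of, act_one]
    rfl
  let e : D.WHat → ℂ := fun w => Complex.exp (form (cAct w.1 z) (toC v))
  let A : D.WHat → M →L[ℂ] M := fun w => act ρ (D.cocycle k w z)
  let x : D.WHat → ℂ := fun w => xval a.1 (cAct w.1 z)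
  -- Since (a^∨, s_a wz) = -(a^∨, wz), the factor 1 + k/x at s_a w cancels the denominator x - k of
  -- J_{s_a}(wz). This makes the w-term of Q̂(s_a)f - f equal to C(s_a w) - C(w).
  let C : D.WHat → M →L[ℂ] M := fun w => (e w * (1 + k a.1 * (x w)⁻¹)) • A w
  have h1 : HasSum (fun w => e (D.s a * w) • (repL ρ (D.s a) ∘L A w))
      (repL ρ (D.s a) ∘L EPlus ρ (D.cocycle k) ((D.s a).1⁻¹ v) z) := by
    have h := (summable_term ρ hk hz (WHat_mem_VPlus (D.s a)⁻¹ hv)).hasSum.mul_left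
      (repL ρ (D.s a))
    refine h.congr_fun fun w => ?_
    change _ = repL ρ (D.s a) ∘L term ρ (D.cocycle k) (((D.s a)⁻¹).1 v) z w
    rw [term, form_cAct_toC_inv, ContinuousLinearMap.comp_smul]
  have h2 := (hasSum_integral_EPlus ρ hk hz a.2 hv).const_smul (k a.1)
  have h3 : HasSum (fun w => e w • A w) (EPlus ρ (D.cocycle k) v z) :=
    (summable_term ρ hk hz hv).hasSum
  have h4 : HasSum (fun w => C (D.s a * w) - C w)
      (qRefl ρ k a (fun v => EPlus ρ (D.cocycle k) v z) v - EPlus ρ (D.cocycle k) v z) := by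
    refine ((h1.sub h2).sub h3).congr_fun fun w => ?_
    rw [integral_term_sub_smul_vee ρ a.2 v (hx w).1]
    have hx0 : x w ≠ 0 := (hx w).1
    have hx1 : x w - k a.1 ≠ 0 := sub_ne_zero.mpr (hx w).2
    have hA : A (D.s a * w) = (x w - k a.1)⁻¹ •
      (x w • (repL ρ (D.s a) ∘L A w) + k a.1 • A w) := hact w
    have hxsw : x (D.s a * w) = -x w := hxs w
    change (e (D.s a * w) * (1 + k a.1 * (x (D.s a * w))⁻¹)) • A (D.s a * w) -
      (e w * (1 + k a.1 * (x w)⁻¹)) • A w = e (D.s a * w) • (repL ρ (D.s a) ∘L A w) -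
        k a.1 • (((x w)⁻¹ * (e w - e (D.s a * w))) • A w) - e w • A w
    rw [hA, hxsw]
    match_scalars
    · field_simp
      ring
    · field_simp
      ring
  have h5 := (Equiv.mulLeft (D.s a)).hasSum_iff.mpr h4
  -- Reindexing by w ↦ s_a w changes the sign of every term, so the sum equals its own negative.
  -- Summability of C itself is not required.
  have h6 : HasSum (fun w => C (D.s a * w) - C w)
      (-(qRefl ρ k a (fun v => EPlus ρ (D.cocycle k) v z) v - EPlus ρ (D.cocycle k) v z)) := by
    refine h5.neg.congr_fun fun w => ?_
    simp only [Function.comp_apply, Equiv.coe_mulLeft]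
    rw [← mul_assoc, s_mul_self, one_mul, neg_sub]
  have h7 := eq_neg_iff_add_eq_zero.mp (h4.unique h6)
  rw [← two_smul ℂ] at h7
  exact sub_eq_zero.mp ((smul_eq_zero_iff_right two_ne_zero).mp h7)

theorem isQInvariant_EPlus (hk : D.IsMultiplicity k) {z : Hat ℂ (ι ⊕ ι')}
    (hz : z ∈ D.regPlus k) : IsQInvariant ρ k fun v => EPlus ρ (D.cocycle k) v z :=
  isQInvariant_of_generators ρ (fun _ ha => qRefl_EPlus ρ hk hz ha)
    fun _ hω => qOmega_EPlus ρ hk hz hω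

end Datum

end AffineBethe

end

open AffineBethe AffineBethe.Datum in
theorem theorem3 {I ι ι' M : Type*} [Finite I] [Fintype ι] [Fintype ι']
    [NormedAddCommGroup M] [NormedSpace ℂ M] [FiniteDimensional ℂ M]
    (D : Datum I ι ι') (k : Hat ℝ (ι ⊕ ι') → ℂ) (hk : D.IsMultiplicity k)
    (ρ : Representation ℂ D.WHat M) (hρ : IsUnitarizable ρ) :
    -- the cocycle `J` exists and is unique
    ∃ J : D.WHat → Hat ℂ (ι ⊕ ι') → MonoidAlgebra ℂ D.WHat,
      D.IsCocycle k J ∧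
      (∀ J', D.IsCocycle k J' → ∀ w, Set.EqOn (J' w) (J w) (D.reg k)) ∧
      -- convergence of the two series
      (∀ v ∈ VPlus (ι ⊕ ι'), ∀ z ∈ D.regPlus k,
        Summable (fun y : D.Y => term ρ J v z (D.t y)) ∧
        Summable (fun w : D.WHat => term ρ J v z w)) ∧
      -- (1)
      (∀ v ∈ VPlus (ι ⊕ ι'), ∀ z ∈ D.regPlus k,
        EPlus ρ J v z = ∑ᶠ w : D.W, E ρ J v (cAct w.1.1 z) ∘L act ρ (J w.1 z)) ∧
      -- (2)
      (∀ κ : ℂ, 0 < κ.re → ∀ z ∈ D.reg k, z.2.2 = κ →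
        MemLevel κ (fun v => E ρ J v z) ∧
        MemS κ (form z z) (fun v => EPlus ρ J v z) ∧
        IsQInvariant ρ k (fun v => EPlus ρ J v z)) ∧
      -- (3)
      (∀ ξ : ℝ, 0 < ξ → ∀ v : Hat ℝ (ι ⊕ ι'), v.2.2 = ξ →
        MemAdKZ ρ k J ξ (E ρ J v) ∧
        MemAdKZ ρ k J ξ (EPlus ρ J v) ∧
        IsWInvariant ρ k J (EPlus ρ J v)) := by
  refine ⟨D.cocycle k, D.isCocycle_cocycle hk, fun J' hJ' w => hJ'.eqOn hk w, ?_, ?_, ?_, ?_⟩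
  · exact fun v hv z hz => ⟨summable_term_t ρ hk hz hv, summable_term ρ hk hz hv⟩
  · exact fun v hv z hz => EPlus_eq_finsum ρ hk hz hv
  · rintro κ hκ z hz rfl
    exact ⟨memLevel_E ρ hk ⟨hz, hκ⟩, memS_EPlus ρ hk ⟨hz, hκ⟩, isQInvariant_EPlus ρ hk ⟨hz, hκ⟩⟩
  · rintro ξ hξ v rfl
    exact ⟨memAdKZ_E ρ hk hξ, memAdKZ_EPlus ρ hk hξ, fun w _ z hz => EPlus_cAct ρ hk hz hξ w⟩
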